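/- Let $B$ be a C*-algebra and let $M_\infty(B)=\bigcup_n M_n(B)$, where $M_n(B)$ is the upper left corner of $M_{n+1}(B)$. For $a,b\in M_\infty(B)_+$ write $a\precsim_B b$ if there is a sequence $(c_n)$ in $M_\infty(B)$ with $\lim_n c_n b c_n^*=a$, and $a\sim_B b$ if $a\precsim_B b$ and $b\precsim_B a$; let $\langle a\rangle_B$ be the class of $a$. Let $W(B)=M_\infty(B)_+/{\sim_B}$ with $\langle a\rangle_B+\langle b\rangle_B=\langle a\oplus b\rangle_B$, $0=\langle 0\rangle_B$ and the order $\langle a\rangle_B\le\langle b\rangle_B$ iff $a\precsim_B b$, and let $\mathrm{Cu}(B)=W(\mathcal K\otimes B)$, where $\mathcal K$ is the algebra of compact operators on a separable infinite-dimensional Hilbert space. A homomorphism $\psi\colon B\to C$ induces maps $W(\psi)$ and $\mathrm{Cu}(\psi)$ by $\langle a\rangle\mapsto\langle\psi(a)\rangle$. Let $B_{++}$ be the set of those $a\in B_+$ for which there is no projection $q\in M_\infty(B)$ with $\langle a\rangle_B=\langle q\rangle_B$, and set $\mathrm{Cu}_+(B)=\{\langle a\rangle : a\in(\mathcal K\otimes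 B)_{++}\}$ and $W_+(B)=\mathrm{Cu}_+(B)\cap W(B)$, that is, $W_+(B)$ is the set of elements of $W(B)$ whose image under the map $W(B)\to\mathrm{Cu}(B)$ induced by $M_\infty(B)\subseteq\mathcal K\otimes B$ lies in $\mathrm{Cu}_+(B)$. An action $\alpha\colon G\to\mathrm{Aut}(A)$ of a finite group $G$ on an infinite-dimensional simple unital C*-algebra $A$ is called tracially strictly approximately inner if for every finite set $F\subset A$, every $\varepsilon>0$ and every positive $x\in A$ with $\|x\|=1$ there are a projection $e\in A$ and unitaries $z_g\in U(eAe)$ for $g\in G$ such that 1. $\|ea-ae\|<\varepsilon$ for all $a\in F$; 2. $\|\alpha_g(eae)-z_g eae z_g^*\|<\varepsilon$ for all $a\in F$ and $g\in G$; 3. $\|z_gz_h-z_{gh}\|<\varepsilon$ for all $g,h\in G$; 4. $1-e$ is Murray-von Neumann equivalent to a projection in the hereditary C*-subalgebra of $A$ generated by $x$; 5. $\|exe\|>1-\varepsilon$. **Theorem.** Let $A$ be a stably finite simple unital C*-algebra which is not of type I, and let $\alpha\colon G\to\mathrm{Aut}(A)$ be an action of a finite group $G$ on $A$ which is tracially strictly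 approximately inner. Let $\iota\colon A\to C^*(G,A,\alpha)$ be the inclusion into the crossed product. Then $W_+(A)\cup\{0\}$ and $\mathrm{Cu}_+(A)\cup\{0\}$ are subsemigroups of $W(A)$ and $\mathrm{Cu}(A)$, and: (a) $W(\iota)\colon W(A)\to W(C^*(G,A,\alpha))$ restricts to an isomorphism of ordered semigroups from $W_+(A)\cup\{0\}$ onto its image in $W(C^*(G,A,\alpha))$; (b) $\mathrm{Cu}(\iota)\colon \mathrm{Cu}(A)\to \mathrm{Cu}(C^*(G,A,\alpha))$ restricts to an isomorphism of ordered semigroups from $\mathrm{Cu}_+(A)\cup\{0\}$ onto its image in $\mathrm{Cu}(C^*(G,A,\alpha))$. Here the domains carry the order and addition of $W(A)$, $\mathrm{Cu}(A)$, and the images carry those of $W(C^*(G,A,\alpha))$, $\mathrm{Cu}(C^*(G,A,\alpha))$. -/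

import Mathlib

noncomputable section

universe u v

/-- An element of a `*`-ring is positive if it is of the form `c* c`. In a C*-algebra, and in the
union of the matrix algebras over a C*-algebra, this is the usual notion. -/
def IsPositiveElement {R : Type u} [Mul R] [Star R] (a : R) : Prop :=
  ∃ c : R, a = star c * c

/-! ### The algebra of finite matrices of arbitrary size -/

section MInf

attribute [local instance] CStarAlgebra.spectralOrder CStarAlgebra.spectralOrderedRing

/-- The space of infinite matrices over `B` that vanish outside some `n × n` corner. -/
def finiteMatrices (B : Type u) [NonUnitalCStarAlgebra B] : Submodule ℂ (ℕ → ℕ → B) where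
  carrier := {a | ∃ n : ℕ, ∀ i j, n ≤ i ∨ n ≤ j → a i j = 0}
  zero_mem' := ⟨0, fun _ _ _ => rfl⟩
  add_mem' := by
    rintro a b ⟨n, hn⟩ ⟨m, hm⟩
    refine ⟨max n m, fun i j h => ?_⟩
    simp only [Pi.add_apply]
    rw [hn i j (by omega), hm i j (by omega), add_zero]
  smul_mem' := by
    rintro c a ⟨n, hn⟩
    refine ⟨n, fun i j h => ?_⟩
    simp only [Pi.smul_apply]
    rw [hn i j h, smul_zero]

/-- The `*`-algebra `M_∞(B) = ⋃ₙ Mₙ(B)`, where `Mₙ(B)` sits in `Mₙ₊₁(B)` as the upper left corner. -/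
def MInf (B : Type u) [NonUnitalCStarAlgebra B] : Type u := finiteMatrices B

namespace MInf

variable {B : Type u} [NonUnitalCStarAlgebra B]

instance : AddCommGroup (MInf B) := inferInstanceAs (AddCommGroup (finiteMatrices B))

instance : Module ℂ (MInf B) := inferInstanceAs (Module ℂ (finiteMatrices B))

/-- The matrix entries. -/
def coeff (a : MInf B) : ℕ → ℕ → B := a.1

/-- `a` lies in `Mₙ(B)`. -/
def Supp (n : ℕ) (a : MInf B) : Prop := ∀ i j, n ≤ i ∨ n ≤ j → a.coeff i j = 0

/-- The matrix with the given entries. -/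
def mk (f : ℕ → ℕ → B) (h : ∃ n : ℕ, ∀ i j, n ≤ i ∨ n ≤ j → f i j = 0) : MInf B := ⟨f, h⟩

@[simp] theorem coeff_mk (f : ℕ → ℕ → B) (h) : (mk f h).coeff = f := rfl

theorem exists_supp (a : MInf B) : ∃ n, Supp n a := a.2

theorem Supp.mono {n m : ℕ} {a : MInf B} (h : Supp n a) (hnm : n ≤ m) : Supp m a :=
  fun i j hij => h i j (by omega)

theorem ext {a b : MInf B} (h : ∀ i j, a.coeff i j = b.coeff i j) : a = b :=
  Subtype.ext (funext fun i => funext fun j => h i j)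

@[simp] theorem coeff_zero (i j : ℕ) : (0 : MInf B).coeff i j = 0 := rfl
@[simp] theorem coeff_add (a b : MInf B) (i j : ℕ) :
    (a + b).coeff i j = a.coeff i j + b.coeff i j := rfl
@[simp] theorem coeff_neg (a : MInf B) (i j : ℕ) : (-a).coeff i j = -a.coeff i j := rfl
@[simp] theorem coeff_sub (a b : MInf B) (i j : ℕ) :
    (a - b).coeff i j = a.coeff i j - b.coeff i j := rfl
@[simp] theorem coeff_smul (c : ℂ) (a : MInf B) (i j : ℕ) :
    (c • a).coeff i j = c • a.coeff i j := rfl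

theorem mulAux {n : ℕ} {a : MInf B} (ha : Supp n a) (b : MInf B) (i j : ℕ) :
    ∑ᶠ k, a.coeff i k * b.coeff k j = ∑ k : Fin n, a.coeff i k * b.coeff k j := by
  rw [finsum_eq_sum_of_support_subset (s := Finset.range n), Finset.sum_range]
  intro k hk
  simp only [Finset.coe_range, Set.mem_Iio]
  by_contra hcon
  exact hk (by simp [ha i k (by omega)])

instance : Mul (MInf B) where
  mul a b := mk (fun i j => ∑ᶠ k, a.coeff i k * b.coeff k j) <| by
    obtain ⟨n, hn⟩ := a.exists_supp
    obtain ⟨m, hm⟩ := b.exists_supp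
    refine ⟨max n m, fun i j h => ?_⟩
    rw [mulAux hn]
    refine Finset.sum_eq_zero fun k _ => ?_
    rcases h with h | h
    · rw [hn i k (by omega), zero_mul]
    · rw [hm k j (by omega), mul_zero]

theorem coeff_mul (a b : MInf B) (i j : ℕ) :
    (a * b).coeff i j = ∑ᶠ k, a.coeff i k * b.coeff k j := rfl

theorem coeff_mul_of_supp {n : ℕ} {a : MInf B} (ha : Supp n a) (b : MInf B) (i j : ℕ) :
    (a * b).coeff i j = ∑ k : Fin n, a.coeff i k * b.coeff k j := mulAux ha b i j

instance : Star (MInf B) where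
  star a := mk (fun i j => star (a.coeff j i)) <| by
    obtain ⟨n, hn⟩ := a.exists_supp
    exact ⟨n, fun i j h => by rw [hn j i h.symm, star_zero]⟩

@[simp] theorem coeff_star (a : MInf B) (i j : ℕ) : (star a).coeff i j = star (a.coeff j i) := rfl

theorem Supp.add {n : ℕ} {a b : MInf B} (ha : Supp n a) (hb : Supp n b) : Supp n (a + b) :=
  fun i j h => by simp [ha i j h, hb i j h]

theorem Supp.smul {n : ℕ} {a : MInf B} (c : ℂ) (ha : Supp n a) : Supp n (c • a) :=
  fun i j h => by simp [ha i j h]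

theorem Supp.neg {n : ℕ} {a : MInf B} (ha : Supp n a) : Supp n (-a) :=
  fun i j h => by simp [ha i j h]

theorem Supp.star {n : ℕ} {a : MInf B} (ha : Supp n a) : Supp n (star a) :=
  fun i j h => by simp [ha j i h.symm]

theorem Supp.mul {n : ℕ} {a b : MInf B} (ha : Supp n a) (hb : Supp n b) : Supp n (a * b) := by
  intro i j h
  rw [coeff_mul_of_supp ha]
  refine Finset.sum_eq_zero fun k _ => ?_
  rcases h with h | h
  · rw [ha i k (by omega), zero_mul]
  · rw [hb k j (by omega), mul_zero]

theorem supp_zero (n : ℕ) : Supp n (0 : MInf B) := fun _ _ _ => rfl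

theorem exists_supp₂ (a b : MInf B) : ∃ n, Supp n a ∧ Supp n b := by
  obtain ⟨n, hn⟩ := a.exists_supp
  obtain ⟨m, hm⟩ := b.exists_supp
  exact ⟨max n m, hn.mono (by omega), hm.mono (by omega)⟩

theorem exists_supp₃ (a b c : MInf B) : ∃ n, Supp n a ∧ Supp n b ∧ Supp n c := by
  obtain ⟨n, hn, hn'⟩ := exists_supp₂ a b
  obtain ⟨m, hm⟩ := c.exists_supp
  exact ⟨max n m, hn.mono (by omega), hn'.mono (by omega), hm.mono (by omega)⟩

/-- The upper left `n × n` corner. -/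
def corner (n : ℕ) (a : MInf B) : CStarMatrix (Fin n) (Fin n) B :=
  CStarMatrix.ofMatrix fun i j => a.coeff i j

@[simp] theorem corner_apply (n : ℕ) (a : MInf B) (i j : Fin n) :
    corner n a i j = a.coeff i j := rfl

theorem corner_add (n : ℕ) (a b : MInf B) : corner n (a + b) = corner n a + corner n b := rfl
theorem corner_smul (n : ℕ) (c : ℂ) (a : MInf B) : corner n (c • a) = c • corner n a := rfl
theorem corner_neg (n : ℕ) (a : MInf B) : corner n (-a) = -corner n a := rfl
theorem corner_zero (n : ℕ) : corner n (0 : MInf B) = 0 := rfl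
theorem corner_star (n : ℕ) (a : MInf B) : corner n (star a) = star (corner n a) := rfl

theorem corner_mul {n : ℕ} {a : MInf B} (ha : Supp n a) (b : MInf B) :
    corner n (a * b) = corner n a * corner n b := by
  ext i j
  rw [corner_apply, coeff_mul_of_supp ha, CStarMatrix.mul_apply]
  rfl

theorem ext_corner {n : ℕ} {a b : MInf B} (ha : Supp n a) (hb : Supp n b)
    (h : corner n a = corner n b) : a = b := by
  refine ext fun i j => ?_
  by_cases hij : n ≤ i ∨ n ≤ j
  · rw [ha i j hij, hb i j hij]
  · push Not at hij
    exact congrFun (congrFun h ⟨i, hij.1⟩) ⟨j, hij.2⟩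

instance : NonUnitalRing (MInf B) where
  __ := (inferInstance : AddCommGroup (MInf B))
  mul_assoc a b c := by
    obtain ⟨n, ha, hb, hc⟩ := exists_supp₃ a b c
    refine ext_corner ((ha.mul hb).mul hc) (ha.mul (hb.mul hc)) ?_
    rw [corner_mul (ha.mul hb), corner_mul ha, corner_mul ha, corner_mul hb, mul_assoc]
  left_distrib a b c := by
    obtain ⟨n, ha, hb, hc⟩ := exists_supp₃ a b c
    refine ext_corner (ha.mul (hb.add hc)) ((ha.mul hb).add (ha.mul hc)) ?_
    rw [corner_add, corner_mul ha, corner_mul ha, corner_mul ha, corner_add, mul_add]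
  right_distrib a b c := by
    obtain ⟨n, ha, hb, hc⟩ := exists_supp₃ a b c
    refine ext_corner ((ha.add hb).mul hc) ((ha.mul hc).add (hb.mul hc)) ?_
    rw [corner_add, corner_mul ha, corner_mul hb, corner_mul (ha.add hb), corner_add, add_mul]
  zero_mul a := by
    obtain ⟨n, ha⟩ := a.exists_supp
    refine ext_corner ((supp_zero n).mul ha) (supp_zero n) ?_
    rw [corner_mul (supp_zero n), corner_zero, zero_mul]
  mul_zero a := by
    obtain ⟨n, ha⟩ := a.exists_supp
    refine ext_corner (ha.mul (supp_zero n)) (supp_zero n) ?_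
    rw [corner_mul ha, corner_zero, mul_zero]

instance : StarRing (MInf B) where
  star_involutive a := ext fun i j => by simp
  star_mul a b := by
    obtain ⟨n, ha, hb⟩ := exists_supp₂ a b
    refine ext_corner (ha.mul hb).star (hb.star.mul ha.star) ?_
    rw [corner_star, corner_mul ha, corner_mul hb.star, star_mul, corner_star, corner_star]
  star_add a b := ext fun i j => by simp

instance : StarModule ℂ (MInf B) where
  star_smul c a := ext fun i j => by simp

instance : IsScalarTower ℂ (MInf B) (MInf B) where
  smul_assoc c a b := by
    obtain ⟨n, ha, hb⟩ := exists_supp₂ a b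
    refine ext_corner ((ha.smul c).mul hb) ((ha.mul hb).smul c) ?_
    change corner n ((c • a) * b) = corner n (c • (a * b))
    rw [corner_mul (ha.smul c), corner_smul, corner_smul, corner_mul ha, smul_mul_assoc]

instance : SMulCommClass ℂ (MInf B) (MInf B) where
  smul_comm c a b := by
    obtain ⟨n, ha, hb⟩ := exists_supp₂ a b
    refine ext_corner ((ha.mul hb).smul c) (ha.mul (hb.smul c)) ?_
    change corner n (c • (a * b)) = corner n (a * (c • b))
    rw [corner_mul ha, corner_smul, corner_smul, corner_mul ha, mul_smul_comm]

/-- The element of `M_∞(B)` given by an `n × n` matrix. -/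
def ofCorner (n : ℕ) (M : CStarMatrix (Fin n) (Fin n) B) : MInf B :=
  mk (fun i j => if h : i < n ∧ j < n then M ⟨i, h.1⟩ ⟨j, h.2⟩ else 0)
    ⟨n, fun i j h => dif_neg (by omega)⟩

theorem supp_ofCorner (n : ℕ) (M : CStarMatrix (Fin n) (Fin n) B) : Supp n (ofCorner n M) :=
  fun _ _ h => dif_neg (by omega)

@[simp] theorem corner_ofCorner (n : ℕ) (M : CStarMatrix (Fin n) (Fin n) B) :
    corner n (ofCorner n M) = M := by
  ext i j
  simp [ofCorner]

theorem ofCorner_corner {n : ℕ} {a : MInf B} (ha : Supp n a) : ofCorner n (corner n a) = a :=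
  ext_corner (supp_ofCorner n _) ha (corner_ofCorner n _)

/-- The inclusion of the `n × n` matrices into the `m × m` matrices as the upper left corner. -/
def pad {n m : ℕ} (h : n ≤ m) :
    CStarMatrix (Fin n) (Fin n) B →⋆ₙₐ[ℂ] CStarMatrix (Fin m) (Fin m) B where
  toFun M := corner m (ofCorner n M)
  map_zero' := by
    rw [ext_corner (b := (0 : MInf B)) (supp_ofCorner n 0) (supp_zero n) (corner_ofCorner n 0),
      corner_zero]
  map_add' M N := by
    rw [← corner_add]
    congr 1
    refine ext_corner (supp_ofCorner n _) ((supp_ofCorner n _).add (supp_ofCorner n _)) ?_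
    simp [corner_add]
  map_smul' c M := by
    change corner m (ofCorner n (c • M)) = c • corner m (ofCorner n M)
    rw [← corner_smul]
    congr 1
    refine ext_corner (supp_ofCorner n _) ((supp_ofCorner n _).smul c) ?_
    simp [corner_smul]
  map_mul' M N := by
    rw [← corner_mul ((supp_ofCorner n M).mono h)]
    congr 1
    refine ext_corner (supp_ofCorner n _) ((supp_ofCorner n _).mul (supp_ofCorner n _)) ?_
    simp [corner_mul (supp_ofCorner n M)]
  map_star' M := by
    rw [← corner_star]
    congr 1
    refine ext_corner (supp_ofCorner n _) (supp_ofCorner n _).star ?_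
    simp [corner_star]

theorem pad_injective {n m : ℕ} (h : n ≤ m) :
    Function.Injective (pad (B := B) h) := by
  intro M N hMN
  have := ext_corner ((supp_ofCorner n M).mono h) ((supp_ofCorner n N).mono h) hMN
  rw [← corner_ofCorner n M, this, corner_ofCorner]

/-- The norm of `a ∈ Mₙ(B)` is its C*-norm in `Mₙ(B)`. -/
instance : Norm (MInf B) where
  norm a := ‖corner (Classical.choose a.exists_supp) a‖

theorem norm_corner_eq {n m : ℕ} {a : MInf B} (hn : Supp n a) (hnm : n ≤ m) :
    ‖corner m a‖ = ‖corner n a‖ := by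
  rw [← NonUnitalStarAlgHom.norm_map (pad (B := B) hnm) (pad_injective hnm) (corner n a)]
  change _ = ‖corner m (ofCorner n (corner n a))‖
  rw [ofCorner_corner hn]

theorem norm_eq {n : ℕ} {a : MInf B} (hn : Supp n a) : ‖a‖ = ‖corner n a‖ := by
  have hs := Classical.choose_spec a.exists_supp
  change ‖corner (Classical.choose a.exists_supp) a‖ = _
  rw [← norm_corner_eq hs (le_max_left _ n), ← norm_corner_eq hn (le_max_right _ n)]

theorem normCore : NormedSpace.Core ℂ (MInf B) where
  norm_nonneg a := norm_nonneg (corner _ a)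
  norm_smul c a := by
    obtain ⟨n, ha⟩ := a.exists_supp
    rw [norm_eq ha, norm_eq (ha.smul c), corner_smul, norm_smul]
  norm_triangle a b := by
    obtain ⟨n, ha, hb⟩ := exists_supp₂ a b
    rw [norm_eq ha, norm_eq hb, norm_eq (ha.add hb), corner_add]
    exact norm_add_le _ _
  norm_eq_zero_iff a := by
    obtain ⟨n, ha⟩ := a.exists_supp
    rw [norm_eq ha, norm_eq_zero]
    refine ⟨fun h => ext_corner ha (supp_zero n) (h.trans (corner_zero n).symm), ?_⟩
    rintro rfl
    exact corner_zero n

instance : NormedAddCommGroup (MInf B) := NormedAddCommGroup.ofCore normCore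

instance : NormedSpace ℂ (MInf B) := NormedSpace.ofCore normCore

instance : NonUnitalNormedRing (MInf B) where
  __ := (inferInstance : NormedAddCommGroup (MInf B))
  __ := (inferInstance : NonUnitalRing (MInf B))
  norm_mul_le a b := by
    obtain ⟨n, ha, hb⟩ := exists_supp₂ a b
    rw [norm_eq ha, norm_eq hb, norm_eq (ha.mul hb), corner_mul ha]
    exact norm_mul_le _ _

instance : CStarRing (MInf B) where
  norm_mul_self_le a := by
    obtain ⟨n, ha⟩ := a.exists_supp
    rw [norm_eq ha, norm_eq (ha.star.mul ha), corner_mul ha.star, corner_star,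
      CStarRing.norm_star_mul_self]


/-- The inclusion of `Mₙ(B)` in `M_∞(B)` as a `*`-homomorphism. -/
def ofCornerHom (n : ℕ) : CStarMatrix (Fin n) (Fin n) B →⋆ₙₐ[ℂ] MInf B where
  toFun := ofCorner n
  map_zero' := ext_corner (supp_ofCorner n 0) (supp_zero n) (corner_ofCorner n 0)
  map_add' M N := ext_corner (supp_ofCorner n _) ((supp_ofCorner n _).add (supp_ofCorner n _))
    (by simp [corner_add])
  map_smul' c M := ext_corner (supp_ofCorner n _) ((supp_ofCorner n _).smul c)
    (by simp [corner_smul])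
  map_mul' M N := ext_corner (supp_ofCorner n _) ((supp_ofCorner n _).mul (supp_ofCorner n _))
    (by simp [corner_mul (supp_ofCorner n M)])
  map_star' M := ext_corner (supp_ofCorner n _) (supp_ofCorner n _).star
    (by simp [corner_star])

theorem continuous_ofCorner (n : ℕ) : Continuous (ofCorner (B := B) n) := by
  refine AddMonoidHomClass.continuous_of_bound (ofCornerHom (B := B) n) 1 fun M => ?_
  change ‖ofCorner n M‖ ≤ _
  rw [norm_eq (supp_ofCorner n M), corner_ofCorner, one_mul]

/-- Convergence in `Mₙ(B)` is entrywise convergence. -/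
theorem tendsto_of_coeff {ι : Type*} {l : Filter ι} {n : ℕ} {f : ι → MInf B} {a : MInf B}
    (hf : ∀ t, Supp n (f t)) (ha : Supp n a)
    (h : ∀ i j, Filter.Tendsto (fun t => (f t).coeff i j) l (nhds (a.coeff i j))) :
    Filter.Tendsto f l (nhds a) := by
  have h1 : Filter.Tendsto (fun t => corner n (f t)) l (nhds (corner n a)) :=
    tendsto_pi_nhds.2 fun i => tendsto_pi_nhds.2 fun j => h i j
  have h2 := ((continuous_ofCorner (B := B) n).tendsto (corner n a)).comp h1
  rw [ofCorner_corner ha] at h2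
  refine h2.congr fun t => ?_
  exact ofCorner_corner (hf t)

variable {C : Type v} [NonUnitalCStarAlgebra C]

/-- Every `*`-homomorphism from `M_∞(B)` to a C*-algebra is contractive. -/
theorem norm_hom_le (f : MInf B →⋆ₙₐ[ℂ] C) (a : MInf B) : ‖f a‖ ≤ ‖a‖ := by
  obtain ⟨n, ha⟩ := a.exists_supp
  have h := NonUnitalStarAlgHom.norm_apply_le (f.comp (ofCornerHom n)) (corner n a)
  rw [norm_eq ha]
  refine le_trans (le_of_eq ?_) h
  change _ = ‖f (ofCorner n (corner n a))‖
  rw [ofCorner_corner ha]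

/-- The homomorphism `M_∞(B) → M_∞(C)` induced by a homomorphism `B → C`. -/
def map (φ : B →⋆ₙₐ[ℂ] C) : MInf B →⋆ₙₐ[ℂ] MInf C where
  toFun a := mk (fun i j => φ (a.coeff i j)) <| by
    obtain ⟨n, hn⟩ := a.exists_supp
    exact ⟨n, fun i j h => by rw [hn i j h, map_zero]⟩
  map_zero' := ext fun i j => by simp
  map_add' a b := ext fun i j => by simp
  map_smul' c a := ext fun i j => by simp
  map_mul' a b := by
    obtain ⟨n, ha⟩ := a.exists_supp
    refine ext fun i j => ?_
    rw [coeff_mul_of_supp (n := n) (fun i j h => by simp [ha i j h]), coeff_mk,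
      coeff_mul_of_supp ha, map_sum]
    simp
  map_star' a := ext fun i j => by simp [map_star]

@[simp] theorem coeff_map (φ : B →⋆ₙₐ[ℂ] C) (a : MInf B) (i j : ℕ) :
    (map φ a).coeff i j = φ (a.coeff i j) := rfl

theorem norm_map_le (φ : B →⋆ₙₐ[ℂ] C) (a : MInf B) : ‖map φ a‖ ≤ ‖a‖ := by
  obtain ⟨n, ha⟩ := a.exists_supp
  rw [norm_eq ha, norm_eq (n := n) (fun i j h => by simp [ha i j h])]
  exact NonUnitalStarAlgHom.norm_apply_le (CStarMatrix.mapₙₐ (n := Fin n) φ) (corner n a)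

theorem continuous_map (φ : B →⋆ₙₐ[ℂ] C) : Continuous (map φ) :=
  AddMonoidHomClass.continuous_of_bound (map φ) 1 fun a => by
    simpa using norm_map_le φ a

/-- The inclusion `B = M₁(B) → M_∞(B)`. -/
def single : B →⋆ₙₐ[ℂ] MInf B where
  toFun b := mk (fun i j => if i = 0 ∧ j = 0 then b else 0)
    ⟨1, fun i j h => if_neg (by omega)⟩
  map_zero' := ext fun i j => by simp
  map_add' a b := ext fun i j => by
    simp only [coeff_mk, coeff_add]
    split_ifs <;> simp
  map_smul' c a := ext fun i j => by
    simp only [coeff_mk, coeff_smul]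
    split_ifs <;> simp
  map_mul' a b := by
    refine ext fun i j => ?_
    rw [coeff_mul_of_supp (n := 1) (fun i j h => by
      rw [coeff_mk]; exact if_neg (by omega))]
    by_cases hi : i = 0 <;> by_cases hj : j = 0 <;> simp [hi, hj]
  map_star' a := ext fun i j => by
    simp only [coeff_mk, coeff_star]
    by_cases hi : i = 0 <;> by_cases hj : j = 0 <;> simp [hi, hj]

theorem coeff_single (b : B) (i j : ℕ) :
    (single b).coeff i j = if i = 0 ∧ j = 0 then b else 0 := rfl

theorem supp_single (b : B) : Supp 1 (single b) := fun _ _ _ => if_neg (by omega)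

theorem continuous_single : Continuous (single (B := B)) := by
  refine continuous_iff_continuousAt.2 fun b => ?_
  refine tendsto_of_coeff (n := 1) supp_single (supp_single b) fun i j => ?_
  simp only [coeff_single]
  split_ifs
  · exact Filter.tendsto_id
  · exact tendsto_const_nhds

end MInf
end MInf

/-! ### The stabilization -/

/-- The stabilization `𝒦 ⊗ B`, constructed as the completion of the normed `*`-algebra `M_∞(B)`,
that is, as the C*-algebraic inductive limit of the algebras `Mₙ(B)`. -/
def Stabilization (B : Type u) [NonUnitalCStarAlgebra B] : Type u :=
  UniformSpace.Completion (MInf B)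

namespace Stabilization

open UniformSpace UniformSpace.Completion

variable {B : Type u} [NonUnitalCStarAlgebra B]

instance : NormedAddCommGroup (Stabilization B) :=
  inferInstanceAs (NormedAddCommGroup (Completion (MInf B)))

instance : NormedSpace ℂ (Stabilization B) :=
  inferInstanceAs (NormedSpace ℂ (Completion (MInf B)))

instance : CompleteSpace (Stabilization B) :=
  inferInstanceAs (CompleteSpace (Completion (MInf B)))

/-- The inclusion of `M_∞(B)` as a dense subalgebra. -/
def of (a : MInf B) : Stabilization B := (a : Completion (MInf B))

theorem norm_of (a : MInf B) : ‖of a‖ = ‖a‖ := norm_coe a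

theorem of_add (a b : MInf B) : of (a + b) = of a + of b := coe_add a b

theorem of_zero : of (0 : MInf B) = 0 := rfl

theorem of_smul (c : ℂ) (a : MInf B) : of (c • a) = c • of a := coe_smul c a

theorem isDenseInducing_of : IsDenseInducing (of (B := B)) := isDenseInducing_coe

theorem continuous_of : Continuous (of (B := B)) := isDenseInducing_of.continuous

theorem denseRange_of : DenseRange (of (B := B)) := isDenseInducing_of.dense

@[elab_as_elim]
theorem induction₁ {p : Stabilization B → Prop} (x : Stabilization B)
    (hp : IsClosed {x | p x}) (ih : ∀ a, p (of a)) : p x :=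
  Completion.induction_on x hp ih

@[elab_as_elim]
theorem induction₂ {p : Stabilization B → Stabilization B → Prop} (x y : Stabilization B)
    (hp : IsClosed {x : Stabilization B × Stabilization B | p x.1 x.2})
    (ih : ∀ a b, p (of a) (of b)) : p x y :=
  Completion.induction_on₂ x y hp ih

@[elab_as_elim]
theorem induction₃ {p : Stabilization B → Stabilization B → Stabilization B → Prop}
    (x y z : Stabilization B)
    (hp : IsClosed {x : Stabilization B × Stabilization B × Stabilization B | p x.1 x.2.1 x.2.2})
    (ih : ∀ a b c, p (of a) (of b) (of c)) : p x y z :=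
  Completion.induction_on₃ x y z hp ih

/-- The inclusion of `M_∞(B)` as an additive homomorphism. -/
def ofAddHom : MInf B →+ Stabilization B where
  toFun := of
  map_zero' := of_zero
  map_add' := of_add

/-- The product, extended from `M_∞(B)` by continuity. -/
instance : Mul (Stabilization B) where
  mul x y := (isDenseInducing_of.prodMap isDenseInducing_of).extend
    (fun p : MInf B × MInf B => of (p.1 * p.2)) (x, y)

theorem of_mul (a b : MInf B) : of (a * b) = of a * of b :=
  ((isDenseInducing_of.prodMap isDenseInducing_of).extend_eq
    (f := fun p : MInf B × MInf B => of (p.1 * p.2))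
    (continuous_of.comp (continuous_mul (M := MInf B))) (a, b)).symm

instance : ContinuousMul (Stabilization B) where
  continuous_mul := by
    let m := (AddMonoidHom.mul : MInf B →+ MInf B →+ MInf B).compr₂ ofAddHom
    have hm : Continuous fun p : MInf B × MInf B => m p.1 p.2 :=
      continuous_of.comp (continuous_mul (M := MInf B))
    have di : IsDenseInducing (ofAddHom : MInf B → Stabilization B) := isDenseInducing_of
    exact di.extend_Z_bilin di hm

/-- The involution, extended from `M_∞(B)` by continuity. -/
instance : Star (Stabilization B) where
  star x := Completion.map (star : MInf B → MInf B) x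

theorem uniformContinuous_star_mInf : UniformContinuous (star : MInf B → MInf B) :=
  star_isometry.uniformContinuous

theorem of_star (a : MInf B) : of (star a) = star (of a) :=
  (Completion.map_coe uniformContinuous_star_mInf a).symm

theorem continuous_star' : Continuous (star : Stabilization B → Stabilization B) :=
  Completion.continuous_map

instance : NonUnitalNormedRing (Stabilization B) where
  __ := (inferInstance : NormedAddCommGroup (Stabilization B))
  mul_assoc x y z := by
    refine induction₃ x y z (isClosed_eq (by fun_prop) (by fun_prop)) fun a b c => ?_
    simp only [← of_mul, mul_assoc]
  left_distrib x y z := by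
    refine induction₃ x y z (isClosed_eq (by fun_prop) (by fun_prop)) fun a b c => ?_
    simp only [← of_mul, ← of_add, mul_add]
  right_distrib x y z := by
    refine induction₃ x y z (isClosed_eq (by fun_prop) (by fun_prop)) fun a b c => ?_
    simp only [← of_mul, ← of_add, add_mul]
  zero_mul x := by
    refine induction₁ x (isClosed_eq (by fun_prop) (by fun_prop)) fun a => ?_
    rw [← of_zero, ← of_mul, zero_mul]
  mul_zero x := by
    refine induction₁ x (isClosed_eq (by fun_prop) (by fun_prop)) fun a => ?_
    rw [← of_zero, ← of_mul, mul_zero]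
  norm_mul_le x y := by
    refine induction₂ x y (isClosed_le (by fun_prop) (by fun_prop)) fun a b => ?_
    rw [← of_mul, norm_of, norm_of, norm_of]
    exact norm_mul_le a b

instance : StarRing (Stabilization B) where
  star_involutive x := by
    refine induction₁ x (isClosed_eq (continuous_star'.comp continuous_star') continuous_id)
      fun a => ?_
    rw [← of_star, ← of_star, star_star]
  star_mul x y := by
    refine induction₂ x y (isClosed_eq (continuous_star'.comp (by fun_prop))
      ((continuous_star'.comp continuous_snd).mul (continuous_star'.comp continuous_fst)))
      fun a b => ?_
    rw [← of_mul, ← of_star, ← of_star, ← of_star, star_mul, of_mul]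
  star_add x y := by
    refine induction₂ x y (isClosed_eq (continuous_star'.comp (by fun_prop))
      ((continuous_star'.comp continuous_fst).add (continuous_star'.comp continuous_snd)))
      fun a b => ?_
    rw [← of_add, ← of_star, ← of_star, ← of_star, star_add, of_add]

theorem continuous_smul' (c : ℂ) : Continuous fun x : Stabilization B => c • x :=
  continuous_const_smul c

/-- `𝒦 ⊗ B` is a C*-algebra. -/
instance : NonUnitalCStarAlgebra (Stabilization B) where
  norm_mul_self_le x := by
    refine induction₁ x (isClosed_le (by fun_prop)
      ((continuous_star'.mul continuous_id).norm)) fun a => ?_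
    rw [← of_star, ← of_mul, norm_of, norm_of, CStarRing.norm_star_mul_self]
  smul_assoc c x y := by
    change (c • x) * y = c • (x * y)
    refine induction₂ x y (isClosed_eq (((continuous_smul' c).comp continuous_fst).mul
      continuous_snd) ((continuous_smul' c).comp continuous_mul)) fun a b => ?_
    rw [← of_smul, ← of_mul, ← of_mul, ← of_smul, smul_mul_assoc]
  smul_comm c x y := by
    change c • (x * y) = x * (c • y)
    refine induction₂ x y (isClosed_eq ((continuous_smul' c).comp continuous_mul)
      (continuous_fst.mul ((continuous_smul' c).comp continuous_snd))) fun a b => ?_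
    rw [← of_smul, ← of_mul, ← of_mul, ← of_smul, mul_smul_comm]
  star_smul c x := by
    refine induction₁ x (isClosed_eq (continuous_star'.comp (continuous_smul' c))
      ((continuous_smul' (star c)).comp continuous_star')) fun a => ?_
    rw [← of_smul, ← of_star, ← of_star, star_smul, of_smul]

/-- The inclusion of `M_∞(B)` in `𝒦 ⊗ B` as a `*`-homomorphism. -/
def ofHom : MInf B →⋆ₙₐ[ℂ] Stabilization B where
  toFun := of
  map_zero' := of_zero
  map_add' := of_add
  map_smul' := of_smul
  map_mul' := of_mul
  map_star' := of_star

theorem continuous_ofHom : Continuous (ofHom (B := B)) := continuous_of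

variable {C : Type v} [NonUnitalCStarAlgebra C]

theorem uniformContinuous_mInf_map (φ : B →⋆ₙₐ[ℂ] C) : UniformContinuous (MInf.map φ) :=
  uniformContinuous_addMonoidHom_of_continuous (MInf.continuous_map φ)

/-- The extension of `M_∞(B) → M_∞(C)` by continuity. -/
def mapFun (φ : B →⋆ₙₐ[ℂ] C) (x : Stabilization B) : Stabilization C :=
  Completion.map (MInf.map φ) x

theorem continuous_mapFun (φ : B →⋆ₙₐ[ℂ] C) : Continuous (mapFun φ) := Completion.continuous_map

theorem mapFun_of (φ : B →⋆ₙₐ[ℂ] C) (a : MInf B) : mapFun φ (of a) = of (MInf.map φ a) :=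
  Completion.map_coe (uniformContinuous_mInf_map φ) a

/-- The homomorphism `𝒦 ⊗ B → 𝒦 ⊗ C` induced by a homomorphism `B → C`, extended from
`M_∞(B) → M_∞(C)` by continuity. -/
def map (φ : B →⋆ₙₐ[ℂ] C) : Stabilization B →⋆ₙₐ[ℂ] Stabilization C where
  toFun := mapFun φ
  map_zero' := by rw [← of_zero, mapFun_of, map_zero, of_zero]
  map_add' x y := by
    refine induction₂ x y (isClosed_eq ((continuous_mapFun φ).comp continuous_add)
      (((continuous_mapFun φ).comp continuous_fst).add
        ((continuous_mapFun φ).comp continuous_snd))) fun a b => ?_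
    rw [← of_add, mapFun_of, mapFun_of, mapFun_of, map_add, of_add]
  map_smul' c x := by
    refine induction₁ x (isClosed_eq ((continuous_mapFun φ).comp (continuous_smul' c))
      ((continuous_smul' c).comp (continuous_mapFun φ))) fun a => ?_
    rw [← of_smul, mapFun_of, mapFun_of, map_smul, of_smul]
    rfl
  map_mul' x y := by
    refine induction₂ x y (isClosed_eq ((continuous_mapFun φ).comp continuous_mul)
      (((continuous_mapFun φ).comp continuous_fst).mul
        ((continuous_mapFun φ).comp continuous_snd))) fun a b => ?_
    rw [← of_mul, mapFun_of, mapFun_of, mapFun_of, map_mul, of_mul]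
  map_star' x := by
    refine induction₁ x (isClosed_eq ((continuous_mapFun φ).comp continuous_star')
      (continuous_star'.comp (continuous_mapFun φ))) fun a => ?_
    rw [← of_star, mapFun_of, mapFun_of, map_star, of_star]

theorem map_of (φ : B →⋆ₙₐ[ℂ] C) (a : MInf B) : map φ (of a) = of (MInf.map φ a) :=
  mapFun_of φ a

end Stabilization

/-- Every `*`-homomorphism `M_∞(B) → M_∞(C)` is continuous. -/
theorem MInf.continuous_hom {B : Type u} [NonUnitalCStarAlgebra B] {C : Type v}
    [NonUnitalCStarAlgebra C] (f : MInf B →⋆ₙₐ[ℂ] MInf C) : Continuous f :=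
  AddMonoidHomClass.continuous_of_bound f 1 fun a => by
    have h := MInf.norm_hom_le (Stabilization.ofHom.comp f) a
    rw [one_mul]
    exact (le_of_eq (Stabilization.norm_of (f a)).symm).trans h

/-! ### Cuntz comparison -/

section Cuntz

variable {B : Type u} [NonUnitalCStarAlgebra B]

/-- Cuntz subequivalence in `M_∞(B)`: there is a sequence `cₙ` in `M_∞(B)` with
`cₙ b cₙ* → a`. -/
def CuntzSubequiv (a b : MInf B) : Prop :=
  ∃ c : ℕ → MInf B, Filter.Tendsto (fun n => c n * b * star (c n)) Filter.atTop (nhds a)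

theorem cuntzSubequiv_iff_mem_closure {a b : MInf B} :
    CuntzSubequiv a b ↔ a ∈ closure (Set.range fun c : MInf B => c * b * star c) := by
  rw [mem_closure_iff_seq_limit]
  constructor
  · rintro ⟨c, hc⟩
    exact ⟨_, fun n => ⟨c n, rfl⟩, hc⟩
  · rintro ⟨x, hx, hlim⟩
    choose c hc using hx
    refine ⟨c, ?_⟩
    simpa only [hc] using hlim

theorem CuntzSubequiv.of_tendsto {ι : Type*} {l : Filter ι} [l.NeBot] {a b : MInf B}
    (c : ι → MInf B) (h : Filter.Tendsto (fun t => c t * b * star (c t)) l (nhds a)) :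
    CuntzSubequiv a b :=
  cuntzSubequiv_iff_mem_closure.2 (mem_closure_of_tendsto h (Filter.Eventually.of_forall
    fun t => ⟨c t, rfl⟩))

theorem CuntzSubequiv.trans {a b d : MInf B} (h1 : CuntzSubequiv a b) (h2 : CuntzSubequiv b d) :
    CuntzSubequiv a d := by
  rw [cuntzSubequiv_iff_mem_closure] at h1 h2 ⊢
  refine closure_minimal ?_ isClosed_closure h1
  rintro _ ⟨c, rfl⟩
  have hc : Continuous fun x : MInf B => c * x * star c := by fun_prop
  refine map_mem_closure (f := fun x : MInf B => c * x * star c) hc h2 ?_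
  rintro _ ⟨e, rfl⟩
  refine ⟨c * e, ?_⟩
  simp only [star_mul, mul_assoc]

theorem exists_filter_tendsto_conj :
    ∃ l : Filter B, l.NeBot ∧ ∀ x : B, Filter.Tendsto (fun u => u * x * star u) l (nhds x) := by
  let _ := CStarAlgebra.spectralOrder B
  let _ := CStarAlgebra.spectralOrderedRing B
  refine ⟨CStarAlgebra.approximateUnit B, inferInstance, fun x => ?_⟩
  have hl := CStarAlgebra.increasingApproximateUnit B
  have h1 := hl.toIsApproximateUnit.tendsto_mul_left x
  have h2 := hl.toIsApproximateUnit.tendsto_mul_right x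
  have hn := hl.eventually_norm
  have hsa := hl.eventually_isSelfAdjoint
  rw [tendsto_iff_norm_sub_tendsto_zero] at h1 h2 ⊢
  have h3 := h1.add h2
  rw [add_zero] at h3
  refine squeeze_zero' (Filter.Eventually.of_forall fun _ => norm_nonneg _) ?_ h3
  filter_upwards [hn, hsa] with u hu hs
  rw [hs.star_eq]
  calc ‖u * x * u - x‖ = ‖u * (x * u - x) + (u * x - x)‖ := by congr 1; noncomm_ring
    _ ≤ ‖u * (x * u - x)‖ + ‖u * x - x‖ := norm_add_le _ _
    _ ≤ ‖x * u - x‖ + ‖u * x - x‖ := by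
        gcongr
        refine (norm_mul_le _ _).trans ?_
        exact mul_le_of_le_one_left (norm_nonneg _) hu
    _ = _ := by ring

/-- The matrix with the entry `u` at the positions `(i, σ i)` for `i < n` in `S`. -/
def partialPerm (n : ℕ) (S : Set ℕ) (σ : ℕ → ℕ) (u : B) : MInf B :=
  open Classical in
  MInf.mk (fun i k => if (i < n ∧ i ∈ S) ∧ k = σ i then u else 0) <| by
    refine ⟨max n ((Finset.range n).sup σ + 1), fun i k h => if_neg ?_⟩
    rintro ⟨⟨hi, -⟩, rfl⟩
    have := Finset.le_sup (f := σ) (Finset.mem_range.2 hi)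
    omega

theorem coeff_partialPerm_conj (n : ℕ) (S : Set ℕ) (σ : ℕ → ℕ) (u : B) (b : MInf B) (i j : ℕ) :
    open Classical in
    (partialPerm n S σ u * b * star (partialPerm n S σ u)).coeff i j =
      if (i < n ∧ i ∈ S) ∧ (j < n ∧ j ∈ S) then u * b.coeff (σ i) (σ j) * star u else 0 := by
  classical
  have h1 : ∀ k, (partialPerm n S σ u * b).coeff i k =
      if i < n ∧ i ∈ S then u * b.coeff (σ i) k else 0 := by
    intro k
    rw [MInf.coeff_mul, finsum_eq_single _ (σ i)]
    · by_cases hi : i < n ∧ i ∈ S <;> simp [partialPerm, hi]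
    · intro k hk
      simp [partialPerm, hk]
  rw [MInf.coeff_mul, finsum_eq_single _ (σ j)]
  · rw [h1]
    by_cases hi : i < n ∧ i ∈ S <;> by_cases hj : j < n ∧ j ∈ S <;> simp [partialPerm, hi, hj]
  · intro k hk
    simp [partialPerm, hk]

/-- Moving the entries of a finite matrix to other rows and columns does not increase its
Cuntz class. -/
theorem CuntzSubequiv.of_reindex {a b : MInf B} (S : Set ℕ) (σ : ℕ → ℕ)
    (ha : ∀ i j, i ∉ S ∨ j ∉ S → a.coeff i j = 0)
    (h : ∀ i j, i ∈ S → j ∈ S → b.coeff (σ i) (σ j) = a.coeff i j) :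
    CuntzSubequiv a b := by
  classical
  obtain ⟨n, hn⟩ := a.exists_supp
  obtain ⟨l, hl, hlim⟩ := exists_filter_tendsto_conj (B := B)
  refine CuntzSubequiv.of_tendsto (l := l) (partialPerm n S σ) ?_
  refine MInf.tendsto_of_coeff (n := n) (fun u i j hij => ?_) hn fun i j => ?_
  · rw [coeff_partialPerm_conj, if_neg (by omega)]
  · simp only [coeff_partialPerm_conj]
    by_cases hij : (i < n ∧ i ∈ S) ∧ (j < n ∧ j ∈ S)
    · simp only [if_pos hij, h i j hij.1.2 hij.2.2]
      exact hlim _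
    · simp only [if_neg hij]
      have h0 : a.coeff i j = 0 := by
        by_cases h' : i ∉ S ∨ j ∉ S
        · exact ha i j h'
        · push Not at h'
          refine hn i j ?_
          by_contra hcon
          exact hij ⟨⟨by omega, h'.1⟩, ⟨by omega, h'.2⟩⟩
      rw [h0]
      exact tendsto_const_nhds

theorem CuntzSubequiv.refl (a : MInf B) : CuntzSubequiv a a :=
  .of_reindex Set.univ id (by simp) (by simp)

theorem CuntzSubequiv.map {C : Type v} [NonUnitalCStarAlgebra C] (f : MInf B →⋆ₙₐ[ℂ] MInf C)
    {a b : MInf B} (h : CuntzSubequiv a b) : CuntzSubequiv (f a) (f b) := by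
  obtain ⟨c, hc⟩ := h
  refine ⟨fun n => f (c n), ?_⟩
  refine (((MInf.continuous_hom f).tendsto a).comp hc).congr fun n => ?_
  simp [map_star]

/-! ### Direct sums -/

namespace MInf

/-- The direct sum `a ⊕ b` in `M_∞(B)`: `a` is placed on the even rows and columns and `b` on the
odd ones. By `cuntzSubequiv_blockSum` and `blockSum_cuntzSubequiv` below this is Cuntz equivalent
to any block diagonal matrix `diag(a, b)`. -/
def dsum (a b : MInf B) : MInf B :=
  mk (fun i j => if i % 2 = 0 ∧ j % 2 = 0 then a.coeff (i / 2) (j / 2)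
      else if i % 2 = 1 ∧ j % 2 = 1 then b.coeff (i / 2) (j / 2) else 0) <| by
    obtain ⟨n, ha, hb⟩ := exists_supp₂ a b
    refine ⟨2 * n, fun i j h => ?_⟩
    rw [ha _ _ (by omega), hb _ _ (by omega)]
    simp

theorem coeff_dsum (a b : MInf B) (i j : ℕ) : (dsum a b).coeff i j =
    if i % 2 = 0 ∧ j % 2 = 0 then a.coeff (i / 2) (j / 2)
      else if i % 2 = 1 ∧ j % 2 = 1 then b.coeff (i / 2) (j / 2) else 0 := rfl

/-- The matrix `diag(a, b)` with `a` as a block of size `n`. -/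
def blockSum (n : ℕ) (a b : MInf B) : MInf B :=
  mk (fun i j => if i < n ∧ j < n then a.coeff i j
      else if n ≤ i ∧ n ≤ j then b.coeff (i - n) (j - n) else 0) <| by
    obtain ⟨m, ha, hb⟩ := exists_supp₂ a b
    refine ⟨n + m, fun i j h => ?_⟩
    rw [ha _ _ (by omega), hb _ _ (by omega)]
    simp

theorem supp_dsum {n : ℕ} {a b : MInf B} (ha : Supp n a) (hb : Supp n b) :
    Supp (2 * n) (dsum a b) := by
  intro i j h
  rw [coeff_dsum, ha _ _ (by omega), hb _ _ (by omega)]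
  simp

theorem dsum_star (a b : MInf B) : dsum (star a) (star b) = star (dsum a b) := by
  refine ext fun i j => ?_
  simp only [coeff_dsum, coeff_star]
  split_ifs <;> first | rfl | omega | simp

theorem dsum_mul (a b c d : MInf B) : dsum a b * dsum c d = dsum (a * c) (b * d) := by
  obtain ⟨n, ha, hb⟩ := exists_supp₂ a b
  refine ext fun i j => ?_
  have key : ∀ f : ℕ → B, ∑ k : Fin (2 * n), f k = ∑ k : Fin n, (f (2 * k) + f (2 * k + 1)) := by
    intro f
    rw [← Finset.sum_range (fun k => f k), ← Finset.sum_range (fun k => f (2 * k) + f (2 * k + 1))]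
    clear ha hb
    induction n with
    | zero => simp
    | succ n ih =>
      rw [show 2 * (n + 1) = 2 * n + 1 + 1 by ring, Finset.sum_range_succ, Finset.sum_range_succ,
        ih, Finset.sum_range_succ, add_assoc]
  rw [coeff_mul_of_supp (supp_dsum ha hb),
    key (fun k => (dsum a b).coeff i k * (dsum c d).coeff k j), coeff_dsum,
    coeff_mul_of_supp ha, coeff_mul_of_supp hb]
  have e1 : ∀ k : ℕ, (2 * k + 1) / 2 = k := fun k => by omega
  have e2 : ∀ k : ℕ, (2 * k + 1) % 2 = 1 := fun k => by omega
  rcases Nat.mod_two_eq_zero_or_one i with hi | hi <;>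
    rcases Nat.mod_two_eq_zero_or_one j with hj | hj <;>
    simp [coeff_dsum, hi, hj, e1, e2]

theorem dsum_add (a b c d : MInf B) : dsum (a + c) (b + d) = dsum a b + dsum c d := by
  refine ext fun i j => ?_
  simp only [coeff_dsum, coeff_add]
  split_ifs <;> simp

theorem dsum_smul (t : ℂ) (a b : MInf B) : dsum (t • a) (t • b) = t • dsum a b := by
  refine ext fun i j => ?_
  simp only [coeff_dsum, coeff_smul]
  split_ifs <;> simp

theorem dsum_zero_zero : dsum (0 : MInf B) 0 = 0 := by
  refine ext fun i j => ?_
  simp [coeff_dsum]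

/-- `a ↦ a ⊕ 0` as a `*`-homomorphism. -/
def inl : MInf B →⋆ₙₐ[ℂ] MInf B where
  toFun a := dsum a 0
  map_zero' := dsum_zero_zero
  map_add' a b := by rw [← dsum_add, add_zero]
  map_smul' t a := by
    change dsum (t • a) 0 = t • dsum a 0
    rw [← dsum_smul, smul_zero]
  map_mul' a b := by rw [dsum_mul, mul_zero]
  map_star' a := by rw [← dsum_star, star_zero]

/-- `b ↦ 0 ⊕ b` as a `*`-homomorphism. -/
def inr : MInf B →⋆ₙₐ[ℂ] MInf B where
  toFun b := dsum 0 b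
  map_zero' := dsum_zero_zero
  map_add' a b := by rw [← dsum_add, add_zero]
  map_smul' t a := by
    change dsum 0 (t • a) = t • dsum 0 a
    rw [← dsum_smul, smul_zero]
  map_mul' a b := by rw [dsum_mul, mul_zero]
  map_star' a := by rw [← dsum_star, star_zero]

theorem continuous_dsum : Continuous fun p : MInf B × MInf B => dsum p.1 p.2 := by
  have h : (fun p : MInf B × MInf B => dsum p.1 p.2) = fun p => inl p.1 + inr p.2 := by
    funext p
    change dsum p.1 p.2 = dsum p.1 0 + dsum 0 p.2
    rw [← dsum_add, add_zero, zero_add]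
  rw [h]
  exact ((continuous_hom inl).comp continuous_fst).add ((continuous_hom inr).comp continuous_snd)

theorem map_dsum {C : Type v} [NonUnitalCStarAlgebra C] (φ : B →⋆ₙₐ[ℂ] C) (a b : MInf B) :
    map φ (dsum a b) = dsum (map φ a) (map φ b) := by
  refine ext fun i j => ?_
  simp only [coeff_dsum, coeff_map]
  split_ifs <;> simp

end MInf

theorem cuntzSubequiv_blockSum {n : ℕ} {a : MInf B} (ha : MInf.Supp n a) (b : MInf B) :
    CuntzSubequiv (MInf.dsum a b) (MInf.blockSum n a b) := by
  refine .of_reindex {i | i % 2 = 1 ∨ i < 2 * n} (fun i => if i % 2 = 1 then n + i / 2 else i / 2)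
    (fun i j h => ?_) (fun i j hi hj => ?_)
  · simp only [Set.mem_ofPred_eq] at h
    rw [MInf.coeff_dsum]
    split_ifs with h1 h2
    · exact ha _ _ (by omega)
    · omega
    · rfl
  · simp only [Set.mem_ofPred_eq] at hi hj
    simp only [MInf.blockSum, MInf.coeff_mk, MInf.coeff_dsum]
    split_ifs <;> first | omega | (congr 1 <;> omega)

theorem blockSum_cuntzSubequiv (n : ℕ) (a b : MInf B) :
    CuntzSubequiv (MInf.blockSum n a b) (MInf.dsum a b) := by
  refine .of_reindex Set.univ (fun i => if i < n then 2 * i else 2 * (i - n) + 1)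
    (by simp) (fun i j _ _ => ?_)
  simp only [MInf.blockSum, MInf.coeff_mk, MInf.coeff_dsum]
  split_ifs <;> first | omega | (congr 1 <;> omega)

theorem CuntzSubequiv.dsum {a b c d : MInf B} (h1 : CuntzSubequiv a c) (h2 : CuntzSubequiv b d) :
    CuntzSubequiv (MInf.dsum a b) (MInf.dsum c d) := by
  obtain ⟨x, hx⟩ := h1
  obtain ⟨y, hy⟩ := h2
  refine ⟨fun n => MInf.dsum (x n) (y n), ?_⟩
  have h := (MInf.continuous_dsum.tendsto (a, b)).comp (hx.prodMk_nhds hy)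
  refine h.congr fun n => ?_
  rw [← MInf.dsum_star, MInf.dsum_mul, MInf.dsum_mul]
  rfl

theorem cuntzSubequiv_dsum_comm (a b : MInf B) :
    CuntzSubequiv (MInf.dsum a b) (MInf.dsum b a) := by
  refine .of_reindex Set.univ (fun i => if i % 2 = 0 then i + 1 else i - 1)
    (by simp) (fun i j _ _ => ?_)
  simp only [MInf.coeff_dsum]
  split_ifs <;> first | omega | (congr 1 <;> omega)

theorem cuntzSubequiv_dsum_assoc (a b c : MInf B) :
    CuntzSubequiv (MInf.dsum (MInf.dsum a b) c) (MInf.dsum a (MInf.dsum b c)) := by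
  refine .of_reindex Set.univ
    (fun i => if i % 2 = 1 then 2 * i + 1 else if i / 2 % 2 = 0 then i / 2 else i - 1)
    (by simp) (fun i j _ _ => ?_)
  have key : ∀ i : ℕ, (∃ k, i = 4 * k) ∨ (∃ k, i = 4 * k + 2) ∨ ∃ k, i = 2 * k + 1 := by
    intro i
    rcases Nat.even_or_odd' i with ⟨k, rfl | rfl⟩
    · rcases Nat.even_or_odd' k with ⟨l, rfl | rfl⟩
      · exact .inl ⟨l, by ring⟩
      · exact .inr (.inl ⟨l, by ring⟩)
    · exact .inr (.inr ⟨k, rfl⟩)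
  have e1 : ∀ k, 4 * k % 2 = 0 := fun k => by omega
  have e2 : ∀ k, 4 * k / 2 = 2 * k := fun k => by omega
  have e3 : ∀ k, (4 * k + 2) % 2 = 0 := fun k => by omega
  have e4 : ∀ k, (4 * k + 2) / 2 = 2 * k + 1 := fun k => by omega
  have e5 : ∀ k, (2 * k + 1) % 2 = 1 := fun k => by omega
  have e6 : ∀ k, (2 * k + 1) / 2 = k := fun k => by omega
  have e7 : ∀ k, 4 * k + 2 - 1 = 2 * (2 * k) + 1 := fun k => by omega
  have e8 : ∀ k, 2 * k % 2 = 0 := fun k => by omega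
  have e9 : ∀ k, 2 * k / 2 = k := fun k => by omega
  simp only [MInf.coeff_dsum]
  rcases key i with ⟨k, rfl⟩ | ⟨k, rfl⟩ | ⟨k, rfl⟩ <;>
    rcases key j with ⟨l, rfl⟩ | ⟨l, rfl⟩ | ⟨l, rfl⟩ <;>
    simp [e1, e2, e3, e4, e5, e6, e7, e8, e9]

theorem cuntzSubequiv_dsum_assoc' (a b c : MInf B) :
    CuntzSubequiv (MInf.dsum a (MInf.dsum b c)) (MInf.dsum (MInf.dsum a b) c) :=
  (cuntzSubequiv_dsum_comm _ _).trans
    (((cuntzSubequiv_dsum_comm b c).dsum (CuntzSubequiv.refl a)).trans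
      ((cuntzSubequiv_dsum_assoc c b a).trans
        ((cuntzSubequiv_dsum_comm _ _).trans
          ((cuntzSubequiv_dsum_comm b a).dsum (CuntzSubequiv.refl c)))))

theorem cuntzSubequiv_dsum_zero (a : MInf B) : CuntzSubequiv a (MInf.dsum a 0) := by
  refine .of_reindex Set.univ (fun i => 2 * i) (by simp) (fun i j _ _ => ?_)
  simp [MInf.coeff_dsum]

theorem dsum_zero_cuntzSubequiv (a : MInf B) : CuntzSubequiv (MInf.dsum a 0) a := by
  refine .of_reindex {i | i % 2 = 0} (fun i => i / 2) (fun i j h => ?_) (fun i j hi hj => ?_)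
  · simp only [Set.mem_ofPred_eq] at h
    rw [MInf.coeff_dsum, if_neg (by tauto)]
    simp
  · simp only [Set.mem_ofPred_eq] at hi hj
    rw [MInf.coeff_dsum, if_pos ⟨hi, hj⟩]

end Cuntz

/-! ### Cuntz semigroups -/

theorem IsPositiveElement.map {R : Type u} {S : Type v} [NonUnitalNonAssocSemiring R] [Star R]
    [Module ℂ R] [NonUnitalNonAssocSemiring S] [Star S] [Module ℂ S] (f : R →⋆ₙₐ[ℂ] S) {a : R}
    (h : IsPositiveElement a) : IsPositiveElement (f a) := by
  obtain ⟨c, rfl⟩ := h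
  exact ⟨f c, by rw [map_mul, map_star]⟩

/-- The positive elements `M_∞(B)₊`, preordered by Cuntz subequivalence. -/
def PositiveMInf (B : Type u) [NonUnitalCStarAlgebra B] : Type u :=
  {a : MInf B // IsPositiveElement a}

instance (B : Type u) [NonUnitalCStarAlgebra B] : Preorder (PositiveMInf B) where
  le a b := CuntzSubequiv a.1 b.1
  le_refl a := CuntzSubequiv.refl a.1
  le_trans _ _ _ := CuntzSubequiv.trans

/-- The Cuntz semigroup `W(B)`: the set of classes of elements of `M_∞(B)₊`, where two elements
are equivalent if each is Cuntz subequivalent to the other. -/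
def WSemigroup (B : Type u) [NonUnitalCStarAlgebra B] : Type u :=
  Antisymmetrization (PositiveMInf B) (· ≤ ·)

namespace WSemigroup

variable {B : Type u} [NonUnitalCStarAlgebra B]

/-- The order induced by Cuntz subequivalence. -/
instance : PartialOrder (WSemigroup B) :=
  inferInstanceAs (PartialOrder (Antisymmetrization (PositiveMInf B) (· ≤ ·)))

/-- The class `⟨a⟩` of a positive element `a`. -/
def cls (a : MInf B) (ha : IsPositiveElement a) : WSemigroup B :=
  toAntisymmetrization (· ≤ ·) (⟨a, ha⟩ : PositiveMInf B)

theorem cls_le_cls {a b : MInf B} {ha : IsPositiveElement a} {hb : IsPositiveElement b} :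
    cls a ha ≤ cls b hb ↔ CuntzSubequiv a b := Iff.rfl

theorem cls_eq_cls {a b : MInf B} {ha : IsPositiveElement a} {hb : IsPositiveElement b} :
    cls a ha = cls b hb ↔ CuntzSubequiv a b ∧ CuntzSubequiv b a := by
  rw [le_antisymm_iff, cls_le_cls, cls_le_cls]

@[elab_as_elim]
theorem ind {p : WSemigroup B → Prop} (h : ∀ a ha, p (cls a ha)) (x : WSemigroup B) : p x :=
  Quotient.inductionOn x fun a => h a.1 a.2

theorem isPositiveElement_dsum {a b : MInf B} (ha : IsPositiveElement a)
    (hb : IsPositiveElement b) : IsPositiveElement (MInf.dsum a b) := by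
  obtain ⟨x, rfl⟩ := ha
  obtain ⟨y, rfl⟩ := hb
  exact ⟨MInf.dsum x y, by rw [← MInf.dsum_star, MInf.dsum_mul]⟩

theorem isPositiveElement_zero : IsPositiveElement (0 : MInf B) := ⟨0, by simp⟩

/-- `0 = ⟨0⟩`. -/
instance : Zero (WSemigroup B) := ⟨cls 0 isPositiveElement_zero⟩

/-- `⟨a⟩ + ⟨b⟩ = ⟨a ⊕ b⟩`. -/
instance : Add (WSemigroup B) where
  add := Quotient.map₂
    (fun a b => ⟨MInf.dsum a.1 b.1, isPositiveElement_dsum a.2 b.2⟩)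
    (fun _ _ h _ _ h' => ⟨CuntzSubequiv.dsum h.1 h'.1, CuntzSubequiv.dsum h.2 h'.2⟩)

theorem zero_def : (0 : WSemigroup B) = cls 0 isPositiveElement_zero := rfl

theorem cls_add_cls (a b : MInf B) (ha : IsPositiveElement a) (hb : IsPositiveElement b) :
    cls a ha + cls b hb = cls (MInf.dsum a b) (isPositiveElement_dsum ha hb) := rfl

theorem add_comm' (x y : WSemigroup B) : x + y = y + x := by
  refine ind (fun a ha => ?_) x
  refine ind (fun b hb => ?_) y
  rw [cls_add_cls, cls_add_cls, cls_eq_cls]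
  exact ⟨cuntzSubequiv_dsum_comm a b, cuntzSubequiv_dsum_comm b a⟩

theorem add_zero' (x : WSemigroup B) : x + 0 = x := by
  refine ind (fun a ha => ?_) x
  rw [zero_def, cls_add_cls, cls_eq_cls]
  exact ⟨dsum_zero_cuntzSubequiv a, cuntzSubequiv_dsum_zero a⟩

instance : AddCommMonoid (WSemigroup B) where
  add_assoc x y z := by
    refine ind (fun a ha => ?_) x
    refine ind (fun b hb => ?_) y
    refine ind (fun c hc => ?_) z
    rw [cls_add_cls, cls_add_cls, cls_add_cls, cls_add_cls, cls_eq_cls]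
    exact ⟨cuntzSubequiv_dsum_assoc a b c, cuntzSubequiv_dsum_assoc' a b c⟩
  zero_add x := (add_comm' 0 x).trans (add_zero' x)
  add_zero := add_zero'
  add_comm := add_comm'
  nsmul := nsmulRec

instance : IsOrderedAddMonoid (WSemigroup B) where
  add_le_add_left x y h z := by
    revert h
    refine ind (fun a ha => ?_) x
    refine ind (fun b hb => ?_) y
    refine ind (fun c hc => ?_) z
    intro h
    exact CuntzSubequiv.dsum h (CuntzSubequiv.refl c)

variable {C : Type v} [NonUnitalCStarAlgebra C]

/-- The map `W(φ) : W(B) → W(C)`, `⟨a⟩ ↦ ⟨φ(a)⟩`, induced by a homomorphism `φ : B → C`. -/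
def map (φ : B →⋆ₙₐ[ℂ] C) : WSemigroup B →+ WSemigroup C where
  toFun := Quotient.map (fun a => ⟨MInf.map φ a.1, a.2.map (MInf.map φ)⟩)
    (fun _ _ h => ⟨CuntzSubequiv.map (MInf.map φ) h.1, CuntzSubequiv.map (MInf.map φ) h.2⟩)
  map_zero' := by
    change cls (MInf.map φ 0) _ = cls 0 _
    simp only [map_zero]
  map_add' x y := by
    refine ind (fun a ha => ?_) x
    refine ind (fun b hb => ?_) y
    change cls (MInf.map φ (MInf.dsum a b)) _ = cls (MInf.dsum (MInf.map φ a) (MInf.map φ b)) _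
    simp only [MInf.map_dsum]

theorem map_cls (φ : B →⋆ₙₐ[ℂ] C) (a : MInf B) (ha : IsPositiveElement a) :
    map φ (cls a ha) = cls (MInf.map φ a) (ha.map (MInf.map φ)) := rfl

end WSemigroup

/-- The (stabilized) Cuntz semigroup `Cu(B) = W(𝒦 ⊗ B)`. -/
abbrev CuSemigroup (B : Type u) [NonUnitalCStarAlgebra B] : Type u :=
  WSemigroup (Stabilization B)

/-- The map `Cu(φ) : Cu(B) → Cu(C)` induced by a homomorphism `φ : B → C`. -/
def CuSemigroup.map {B : Type u} [NonUnitalCStarAlgebra B] {C : Type v} [NonUnitalCStarAlgebra C]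
    (φ : B →⋆ₙₐ[ℂ] C) : CuSemigroup B →+ CuSemigroup C :=
  WSemigroup.map (Stabilization.map φ)

section Pure

variable (B : Type u) [NonUnitalCStarAlgebra B]

/-- The homomorphism `M_∞(B) → M_∞(𝒦 ⊗ B)` given by the inclusions `M_∞(B) ⊆ 𝒦 ⊗ B` and
`𝒦 ⊗ B = M₁(𝒦 ⊗ B)`. -/
def MInf.toStable : MInf B →⋆ₙₐ[ℂ] MInf (Stabilization B) :=
  MInf.single.comp Stabilization.ofHom

/-- The map `W(B) → Cu(B)` induced by the inclusion `M_∞(B) ⊆ 𝒦 ⊗ B`. -/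
def WSemigroup.toCu : WSemigroup B → CuSemigroup B :=
  Quotient.map (fun a => ⟨MInf.toStable B a.1, a.2.map (MInf.toStable B)⟩)
    (fun _ _ h => ⟨CuntzSubequiv.map (MInf.toStable B) h.1,
      CuntzSubequiv.map (MInf.toStable B) h.2⟩)

variable {B} in
/-- A positive element `a` of `B` is purely positive (`a ∈ B₊₊`) if there is no projection
`q ∈ M_∞(B)` with `⟨a⟩ = ⟨q⟩`. -/
def IsPurelyPositive (a : B) : Prop :=
  IsPositiveElement a ∧ ¬ ∃ q : MInf B, IsStarProjection q ∧
    CuntzSubequiv (MInf.single a) q ∧ CuntzSubequiv q (MInf.single a)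

/-- `Cu₊(B)`, the set of classes of purely positive elements of `𝒦 ⊗ B`. -/
def CuPlus : Set (CuSemigroup B) :=
  {x | ∃ (a : Stabilization B) (ha : IsPurelyPositive a),
    x = WSemigroup.cls (MInf.single a) (ha.1.map MInf.single)}

/-- `W₊(B) = Cu₊(B) ∩ W(B)`. -/
def WPlus : Set (WSemigroup B) := {x | WSemigroup.toCu B x ∈ CuPlus B}

end Pure

/-! ### Crossed products by finite groups -/

/-- The crossed product `C*(G, A, α)` of a unital C*-algebra by an action of a finite group. Its
elements are the formal sums `∑ a_g u_g`, given by their coefficient functions `g ↦ a_g`; the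
multiplication is determined by `u_g a u_g* = α_g(a)` and `u_g u_h = u_{gh}`, with `u_g` unitary. -/
def CrossedProduct {A : Type u} [CStarAlgebra A] {G : Type v} [Group G] [Fintype G]
    (_α : G →* (A ≃⋆ₐ[ℂ] A)) : Type (max u v) := G → A

namespace CrossedProduct

attribute [local instance] CStarAlgebra.spectralOrder CStarAlgebra.spectralOrderedRing

variable {A : Type u} [CStarAlgebra A] {G : Type v} [Group G] [Fintype G]
  {α : G →* (A ≃⋆ₐ[ℂ] A)}

instance : AddCommGroup (CrossedProduct α) := inferInstanceAs (AddCommGroup (G → A))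

instance : Module ℂ (CrossedProduct α) := inferInstanceAs (Module ℂ (G → A))

/-- The coefficients `a_g` of `∑ a_g u_g`. -/
def coeff (a : CrossedProduct α) : G → A := a

/-- The element `∑ a_g u_g`. -/
def mk (f : G → A) : CrossedProduct α := f

@[simp] theorem coeff_mk (f : G → A) (g : G) : (mk f : CrossedProduct α).coeff g = f g := rfl

@[simp] theorem coeff_add (a b : CrossedProduct α) (g : G) :
    (a + b).coeff g = a.coeff g + b.coeff g := rfl
@[simp] theorem coeff_zero (g : G) : (0 : CrossedProduct α).coeff g = 0 := rfl
@[simp] theorem coeff_smul (c : ℂ) (a : CrossedProduct α) (g : G) :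
    (c • a).coeff g = c • a.coeff g := rfl

theorem ext {a b : CrossedProduct α} (h : ∀ g, a.coeff g = b.coeff g) : a = b := funext h

instance : Mul (CrossedProduct α) where
  mul a b := mk fun g => ∑ h : G, a.coeff h * α h (b.coeff (h⁻¹ * g))

theorem coeff_mul (a b : CrossedProduct α) (g : G) :
    (a * b).coeff g = ∑ h : G, a.coeff h * α h (b.coeff (h⁻¹ * g)) := rfl

instance : Star (CrossedProduct α) where
  star a := mk fun g => α g (star (a.coeff g⁻¹))

@[simp] theorem coeff_star (a : CrossedProduct α) (g : G) :
    (star a).coeff g = α g (star (a.coeff g⁻¹)) := rfl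

open Classical in
instance : One (CrossedProduct α) where
  one := mk fun g => if g = 1 then 1 else 0

open Classical in
theorem coeff_one (g : G) : (1 : CrossedProduct α).coeff g = if g = 1 then 1 else 0 := rfl

/-- The regular representation of the crossed product on `A^G`. -/
def toMatrix (a : CrossedProduct α) : CStarMatrix G G A :=
  CStarMatrix.ofMatrix fun s t => α s⁻¹ (a.coeff (s * t⁻¹))

theorem toMatrix_apply (a : CrossedProduct α) (s t : G) :
    toMatrix a s t = α s⁻¹ (a.coeff (s * t⁻¹)) := rfl

theorem apply_apply (g h : G) (x : A) : α g (α h x) = α (g * h) x := by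
  rw [map_mul]; rfl

theorem one_apply (x : A) : α 1 x = x := by
  rw [map_one]; rfl

theorem toMatrix_injective : Function.Injective (toMatrix (α := α)) := by
  intro a b h
  refine ext fun g => ?_
  have := congrFun (congrFun h 1) g⁻¹
  rw [toMatrix_apply, toMatrix_apply] at this
  simpa [one_apply] using this

theorem toMatrix_add (a b : CrossedProduct α) : toMatrix (a + b) = toMatrix a + toMatrix b := by
  ext s t
  simp [toMatrix_apply]

theorem toMatrix_zero : toMatrix (0 : CrossedProduct α) = 0 := by
  ext s t
  simp [toMatrix_apply]

theorem toMatrix_smul (c : ℂ) (a : CrossedProduct α) : toMatrix (c • a) = c • toMatrix a := by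
  ext s t
  simp [toMatrix_apply]

theorem toMatrix_mul (a b : CrossedProduct α) : toMatrix (a * b) = toMatrix a * toMatrix b := by
  ext s t
  rw [toMatrix_apply, coeff_mul, CStarMatrix.mul_apply, map_sum]
  refine Fintype.sum_equiv ((Equiv.inv G).trans (Equiv.mulRight s)) _ _ fun h => ?_
  rw [toMatrix_apply, toMatrix_apply, map_mul, apply_apply]
  simp [mul_assoc]

theorem toMatrix_star (a : CrossedProduct α) : toMatrix (star a) = star (toMatrix a) := by
  ext s t
  rw [CStarMatrix.star_apply, toMatrix_apply, toMatrix_apply, coeff_star, apply_apply]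
  simp [map_star]

open Classical in
theorem toMatrix_one : toMatrix (1 : CrossedProduct α) = 1 := by
  ext s t
  rw [toMatrix_apply, coeff_one, CStarMatrix.one_apply]
  by_cases h : s = t
  · simp [h]
  · simp [h, mul_inv_eq_one]

instance : Ring (CrossedProduct α) where
  __ := (inferInstance : AddCommGroup (CrossedProduct α))
  mul_assoc a b c := toMatrix_injective (by simp only [toMatrix_mul, mul_assoc])
  one_mul a := by
    classical
    exact toMatrix_injective (by rw [toMatrix_mul, toMatrix_one, one_mul])
  mul_one a := by
    classical
    exact toMatrix_injective (by rw [toMatrix_mul, toMatrix_one, mul_one])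
  left_distrib a b c := toMatrix_injective (by simp only [toMatrix_mul, toMatrix_add, mul_add])
  right_distrib a b c := toMatrix_injective (by simp only [toMatrix_mul, toMatrix_add, add_mul])
  zero_mul a := toMatrix_injective (by rw [toMatrix_mul, toMatrix_zero, zero_mul])
  mul_zero a := toMatrix_injective (by rw [toMatrix_mul, toMatrix_zero, mul_zero])

instance : StarRing (CrossedProduct α) where
  star_involutive a := toMatrix_injective (by rw [toMatrix_star, toMatrix_star, star_star])
  star_mul a b := toMatrix_injective (by simp only [toMatrix_mul, toMatrix_star, star_mul])
  star_add a b := toMatrix_injective (by simp only [toMatrix_add, toMatrix_star, star_add])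

instance : Algebra ℂ (CrossedProduct α) :=
  Algebra.ofModule
    (fun c a b => toMatrix_injective (by
      rw [toMatrix_mul, toMatrix_smul, toMatrix_smul, toMatrix_mul, smul_mul_assoc]))
    (fun c a b => toMatrix_injective (by
      rw [toMatrix_mul, toMatrix_smul, toMatrix_smul, toMatrix_mul, mul_smul_comm]))

/-- The C*-norm of the crossed product, defined through the (faithful) regular representation.
As `G` is finite, the crossed product is complete in this norm, so this is its only C*-norm, and
the full and the reduced crossed product agree. -/
instance : Norm (CrossedProduct α) where
  norm a := ‖toMatrix a‖

theorem norm_def (a : CrossedProduct α) : ‖a‖ = ‖toMatrix a‖ := rfl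

theorem normCore : NormedSpace.Core ℂ (CrossedProduct α) where
  norm_nonneg a := norm_nonneg (toMatrix a)
  norm_smul c a := by rw [norm_def, toMatrix_smul, norm_smul, norm_def]
  norm_triangle a b := by
    rw [norm_def, toMatrix_add]
    exact norm_add_le _ _
  norm_eq_zero_iff a := by
    rw [norm_def, norm_eq_zero, ← toMatrix_zero (α := α)]
    exact toMatrix_injective.eq_iff

instance : NormedAddCommGroup (CrossedProduct α) := NormedAddCommGroup.ofCore normCore

instance : NormedRing (CrossedProduct α) where
  __ := (inferInstance : NormedAddCommGroup (CrossedProduct α))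
  __ := (inferInstance : Ring (CrossedProduct α))
  norm_mul_le a b := by
    rw [norm_def, toMatrix_mul]
    exact norm_mul_le _ _

theorem range_toMatrix : Set.range (toMatrix (α := α)) =
    {x | ∀ r s t : G, x (s * r) (t * r) = α r⁻¹ (x s t)} := by
  ext x
  constructor
  · rintro ⟨a, rfl⟩ r s t
    rw [toMatrix_apply, toMatrix_apply, apply_apply]
    simp [mul_assoc]
  · intro hx
    refine ⟨mk fun g => x 1 g⁻¹, ?_⟩
    ext s t
    rw [toMatrix_apply, coeff_mk, ← hx s 1]
    simp

theorem isometry_toMatrix : Isometry (toMatrix (α := α)) :=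
  AddMonoidHomClass.isometry_of_norm
    ({ toFun := toMatrix, map_zero' := toMatrix_zero, map_add' := toMatrix_add } :
      CrossedProduct α →+ CStarMatrix G G A) fun _ => rfl

instance : CompleteSpace (CrossedProduct α) := by
  rw [completeSpace_iff_isComplete_range (isometry_toMatrix (α := α)).isUniformInducing,
    range_toMatrix]
  refine IsClosed.isComplete ?_
  simp only [Set.ofPred_forall]
  refine isClosed_iInter fun r => isClosed_iInter fun s => isClosed_iInter fun t => ?_
  have hev : ∀ s t : G, Continuous fun x : CStarMatrix G G A => x s t := fun s t =>
    (continuous_apply t).comp (continuous_apply (A := fun _ : G => G → A) s)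
  have hα : Continuous (α r⁻¹) := (StarAlgEquiv.isometry (α r⁻¹)).continuous
  exact isClosed_eq (hev _ _) (hα.comp (hev s t))

/-- `C*(G, A, α)` is a unital C*-algebra. -/
instance : CStarAlgebra (CrossedProduct α) where
  norm_mul_self_le a := by
    rw [norm_def, norm_def, toMatrix_mul, toMatrix_star, CStarRing.norm_star_mul_self]
  norm_smul_le c a := by rw [norm_def, toMatrix_smul, norm_smul, norm_def]
  star_smul c a := toMatrix_injective (by
    simp only [toMatrix_smul, toMatrix_star, star_smul])

variable (α) in
open Classical in
/-- The inclusion `ι : A → C*(G, A, α)`, `a ↦ a u_1`. -/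
def incl : A →⋆ₙₐ[ℂ] CrossedProduct α where
  toFun a := mk fun g => if g = 1 then a else 0
  map_zero' := ext fun g => by simp
  map_add' a b := ext fun g => by
    simp only [coeff_mk, coeff_add]
    split_ifs <;> simp
  map_smul' c a := ext fun g => by
    change (if g = 1 then c • a else 0) = c • (if g = 1 then a else 0)
    split_ifs <;> simp
  map_mul' a b := ext fun g => by
    rw [coeff_mul, Finset.sum_eq_single 1]
    · by_cases hg : g = 1 <;> simp [hg]
    · intro h _ hh
      simp [hh]
    · simp
  map_star' a := ext fun g => by
    by_cases hg : g = 1 <;> simp [hg]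

end CrossedProduct

/-! ### The hypotheses -/

/-- A unital C*-algebra is simple if it is nonzero and has no closed two-sided ideals other than
`0` and itself. -/
def IsSimpleCStarAlgebra (A : Type u) [CStarAlgebra A] : Prop :=
  Nontrivial A ∧ ∀ I : TwoSidedIdeal A, IsClosed (I : Set A) → I = ⊥ ∨ I = ⊤

/-- A unital C*-algebra is stably finite if every isometry in a matrix algebra over it is
unitary. -/
def IsStablyFiniteCStarAlgebra (A : Type u) [CStarAlgebra A] : Prop :=
  ∀ (n : ℕ) (v : CStarMatrix (Fin n) (Fin n) A), star v * v = 1 → v * star v = 1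

/-- A C*-algebra `A` is of type I if every nonzero quotient `A / I` by a closed two-sided ideal
contains a nonzero abelian element, that is, the image of a positive element `x` of `A` that is not
in `I`, such that `x A x` is commutative modulo `I`. -/
def IsTypeI (A : Type u) [CStarAlgebra A] : Prop :=
  ∀ I : TwoSidedIdeal A, IsClosed (I : Set A) → I ≠ ⊤ →
    ∃ x : A, IsPositiveElement x ∧ x ∉ I ∧
      ∀ a b : A, (x * a * x) * (x * b * x) - (x * b * x) * (x * a * x) ∈ I

/-- The projections `p` and `q` are Murray-von Neumann equivalent. -/
def MurrayVonNeumannEquiv {A : Type u} [CStarAlgebra A] (p q : A) : Prop :=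
  ∃ v : A, star v * v = p ∧ v * star v = q

/-- The hereditary C*-subalgebra generated by a positive element `x`, i.e. the closure of
`x A x`. -/
def hereditarySubalgebra {A : Type u} [CStarAlgebra A] (x : A) : Set A :=
  closure (Set.range fun a : A => x * a * x)

/-- `z` is a unitary of the corner `e A e`, where `e` is a projection. -/
def IsCornerUnitary {A : Type u} [CStarAlgebra A] (e z : A) : Prop :=
  e * z * e = z ∧ star z * z = e ∧ z * star z = e

/-- Tracially strictly approximately inner actions (of finite groups on infinite-dimensional simple
unital C*-algebras). -/
def IsTraciallyStrictlyApproximatelyInner {A : Type u} [CStarAlgebra A] {G : Type v} [Group G]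
    (α : G →* (A ≃⋆ₐ[ℂ] A)) : Prop :=
  ∀ (F : Finset A) (ε : ℝ), 0 < ε → ∀ x : A, IsPositiveElement x → ‖x‖ = 1 →
    ∃ (e : A) (z : G → A), IsStarProjection e ∧ (∀ g, IsCornerUnitary e (z g)) ∧
      (∀ a ∈ F, ‖e * a - a * e‖ < ε) ∧
      (∀ a ∈ F, ∀ g, ‖α g (e * a * e) - z g * (e * a * e) * star (z g)‖ < ε) ∧
      (∀ g h, ‖z g * z h - z (g * h)‖ < ε) ∧
      (∃ q : A, IsStarProjection q ∧ q ∈ hereditarySubalgebra x ∧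
        MurrayVonNeumannEquiv (1 - e) q) ∧
      1 - ε < ‖e * x * e‖

/-- A subset `S` of `M` containing `0` is a subsemigroup, and `f` restricts to an isomorphism of
ordered semigroups from `S` onto its image, the order and the addition on the image being those
of `N`. -/
def RestrictsToOrderedSemigroupIso {M : Type u} {N : Type v} [AddCommMonoid M] [PartialOrder M]
    [AddCommMonoid N] [PartialOrder N] (f : M →+ N) (S : Set M) : Prop :=
  ∃ T : AddSubmonoid M, (T : Set M) = S ∧
    ∃ e : T ≃+o T.map f, ∀ x : T, ((e x : T.map f) : N) = f x

end

/-! The inclusion ι preserves addition and order for free. Two facts carry the theorem: ι(a) ≾ ι(b)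
implies a ≾ b for purely positive b, and a sum of two purely positive classes is purely positive.
Given the first, injectivity follows by antisymmetry. Statement (a) is deduced from (b), because W →
Cu is additive and an order embedding.

Reflection of the order (`IsTraciallyStrictlyApproximatelyInner.cuntzLE_of_map`). Let c ι(b) c* be
close to ι(a). The hypothesis on α gives projections e that almost commute with given elements of A,
and unitaries z_g of eAe that almost implement α. Hence S(∑ a_g u_g) = ∑ e a_g e z_g is
asymptotically multiplicative and *-preserving, is bounded by |G|, and sends ι(x) close to exe. Thus
S(c) b S(c)* is close to eae, while a is close to eae + (1-e)a(1-e)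
(`AsymptoticallyImplements.tendsto_compress`). The last summand is dominated by finitely many copies
of 1-e, so b must have room for them. Pure positivity forces spectrum of b in every interval (0,d),
so b dominates (b-d)₊ ⊕ f with f ≠ 0 supported in that interval (`scls_cutDown_add_scls_bump_le`,
`IsPurelyPositive.bump_ne_zero`). As A is simple and not of type I, f dominates n copies of some
nonzero x in A (`exists_single_le`, `IsSimpleCStarAlgebra.exists_nsmul_le`), and e can be chosen
with 1-e ≾ x.

Sums (`CuPlus.add_mem`). If ⟨a⟩ + ⟨b⟩ = ⟨q⟩ for a projection q, then q is already below (a-d)₊ ⊕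
(b-d)₊ for some d > 0. The unused spectral room of a yields ⟨q⟩ + ⟨f⟩ ≤ ⟨q⟩ with f ≠ 0. Iterating
this and using simplicity contradicts stable finiteness (`not_cls_add_scls_le`). -/

noncomputable section

universe u v

/-! ### Cuntz comparison of single elements -/

/-- Cuntz subequivalence inside a C*-algebra: `a` is a limit of elements `c b c*`. -/
def CuntzLE {D : Type u} [NonUnitalNormedRing D] [Star D] (a b : D) : Prop :=
  a ∈ closure (Set.range fun c : D => c * b * star c)

namespace CuntzLE

section General

variable {D : Type u} [NonUnitalNormedRing D] [StarRing D]

theorem conj (c b : D) : CuntzLE (c * b * star c) b := subset_closure ⟨c, rfl⟩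

theorem trans {a b d : D} (h1 : CuntzLE a b) (h2 : CuntzLE b d) : CuntzLE a d := by
  refine closure_minimal ?_ isClosed_closure h1
  rintro _ ⟨c, rfl⟩
  have hc : Continuous fun x : D => c * x * star c := by fun_prop
  refine map_mem_closure (f := fun x : D => c * x * star c) hc h2 ?_
  rintro _ ⟨e, rfl⟩
  refine ⟨c * e, ?_⟩
  simp only [star_mul, mul_assoc]

theorem of_tendsto {ι : Type*} {l : Filter ι} [l.NeBot] {x : ι → D} {a b : D}
    (h : Filter.Tendsto x l (nhds a)) (hx : ∀ i, CuntzLE (x i) b) : CuntzLE a b :=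
  isClosed_closure.mem_of_tendsto h (Filter.Eventually.of_forall hx)

theorem zero (b : D) : CuntzLE 0 b := subset_closure ⟨0, by simp⟩

theorem eq_zero {a : D} (h : CuntzLE a 0) : a = 0 := by
  have : (Set.range fun c : D => c * 0 * star c) = {0} := by
    ext x
    simp
  rwa [CuntzLE, this, closure_singleton, Set.mem_singleton_iff] at h

end General

variable {D : Type u} [NonUnitalCStarAlgebra D]

/-- A star homomorphism preserves Cuntz subequivalence. -/
theorem map {C : Type v} [NonUnitalCStarAlgebra C] (φ : D →⋆ₙₐ[ℂ] C) {a b : D}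
    (h : CuntzLE a b) : CuntzLE (φ a) (φ b) := by
  have hφ : Continuous φ := AddMonoidHomClass.continuous_of_bound φ 1 fun x => by
    simpa using NonUnitalStarAlgHom.norm_apply_le φ x
  refine map_mem_closure hφ h ?_
  rintro _ ⟨c, rfl⟩
  exact ⟨φ c, by simp [map_star]⟩

/-- With h_d = √(fg)/(g + d) one has h_d² g = f g²/(g + d)², which tends to f uniformly on the
spectrum as d → 0 because f ≤ C g there. So the h_d(a) are the conjugators. -/
theorem cfcₙ_le {a : D} (_ha : IsSelfAdjoint a) {f g : ℝ → ℝ} (hf : Continuous f)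
    (hg : Continuous g) (hf0 : f 0 = 0) (hg0 : g 0 = 0) (hfn : ∀ t, 0 ≤ f t)
    (hgn : ∀ t, 0 ≤ g t) {C : ℝ} (hC : 0 ≤ C) (hfg : ∀ t ∈ quasispectrum ℝ a, f t ≤ C * g t) :
    CuntzLE (cfcₙ f a) (cfcₙ g a) := by
  let h : ℝ → ℝ → ℝ := fun d t => Real.sqrt (f t * g t) / (g t + d)
  have hh : ∀ d, 0 < d → Continuous (h d) := fun d hd =>
    (Real.continuous_sqrt.comp (hf.mul hg)).div (hg.add continuous_const)
      fun t => by have := hgn t; positivity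
  have hh0 : ∀ d, h d 0 = 0 := fun d => by simp [h, hf0]
  have hlim : Filter.Tendsto (fun d => cfcₙ (h d) a * cfcₙ g a * star (cfcₙ (h d) a))
      (nhdsWithin 0 (Set.Ioi (0 : ℝ))) (nhds (cfcₙ f a)) := by
    rw [tendsto_iff_norm_sub_tendsto_zero]
    have h2 : Filter.Tendsto (fun d : ℝ => 2 * C * d) (nhdsWithin 0 (Set.Ioi 0)) (nhds 0) := by
      have : Filter.Tendsto (fun d : ℝ => 2 * C * d) (nhds 0) (nhds (2 * C * 0)) :=
        (continuous_const.mul continuous_id).tendsto 0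
      rw [mul_zero] at this
      exact this.mono_left nhdsWithin_le_nhds
    refine squeeze_zero' (Filter.Eventually.of_forall fun _ => norm_nonneg _) ?_ h2
    filter_upwards [self_mem_nhdsWithin] with d hd
    have hd : 0 < d := hd
    have hs : star (cfcₙ (h d) a) = cfcₙ (h d) a := (cfcₙ_predicate (h d) a : IsSelfAdjoint _)
    rw [hs, ← cfcₙ_mul (h d) g a ((hh d hd).continuousOn) (hh0 d) hg.continuousOn hg0,
      ← cfcₙ_mul (fun t => h d t * g t) (h d) a (((hh d hd).mul hg).continuousOn) (by simp [hg0])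
        (hh d hd).continuousOn (hh0 d),
      ← cfcₙ_sub (fun t => h d t * g t * h d t) f a
        ((((hh d hd).mul hg).mul (hh d hd)).continuousOn) (by simp [hg0]) hf.continuousOn hf0]
    refine norm_cfcₙ_le fun t ht => ?_
    have h1 := hfn t
    have h3 := hgn t
    have h4 := hfg t ht
    have h5 : h d t * g t * h d t - f t = - (f t * (2 * g t * d + d ^ 2)) / (g t + d) ^ 2 := by
      have : Real.sqrt (f t * g t) * Real.sqrt (f t * g t) = f t * g t :=
        Real.mul_self_sqrt (by positivity)
      have h6 : g t + d ≠ 0 := by positivity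
      simp only [h]
      field_simp
      rw [sq (Real.sqrt _), this]
      ring
    rw [h5, Real.norm_eq_abs, abs_div, abs_neg, abs_of_nonneg (by positivity),
      abs_of_nonneg (by positivity), div_le_iff₀ (by positivity)]
    -- The error is f·(2gd + d²)/(g + d)². Replacing f by C g bounds it by 2Cd, uniformly in t.
    calc f t * (2 * g t * d + d ^ 2) ≤ (C * g t) * (2 * g t * d + d ^ 2) := by gcongr
      _ ≤ 2 * C * d * (g t + d) ^ 2 := by
        have : 2 * C * d * (g t + d) ^ 2 - (C * g t) * (2 * g t * d + d ^ 2) =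
          C * d * (3 * g t * d + 2 * d ^ 2) := by ring
        have h7 : 0 ≤ C * d * (3 * g t * d + 2 * d ^ 2) := by positivity
        linarith
  have hne : (nhdsWithin 0 (Set.Ioi (0 : ℝ))).NeBot := inferInstance
  exact of_tendsto hlim fun d => conj _ _

end CuntzLE

/-! ### Positive elements, cut-downs (a - d)₊ and comparison of functions of one element. -/

section Positive

attribute [local instance] CStarAlgebra.spectralOrder CStarAlgebra.spectralOrderedRing

variable {D : Type u} [NonUnitalCStarAlgebra D]

/-- Positivity in a C*-algebra. -/
abbrev IsPosElem (a : D) : Prop := IsPositiveElement a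

theorem IsPosElem.map {C : Type v} [NonUnitalCStarAlgebra C] (φ : D →⋆ₙₐ[ℂ] C) {a : D}
    (ha : IsPosElem a) : IsPosElem (φ a) :=
  IsPositiveElement.map φ ha

theorem isPosElem_of {a : MInf D} (ha : IsPositiveElement a) : IsPosElem (Stabilization.of a) :=
  IsPositiveElement.map Stabilization.ofHom ha

theorem isPositiveElement_iff_nonneg {a : D} : IsPositiveElement a ↔ 0 ≤ a :=
  CStarAlgebra.nonneg_iff_eq_star_mul_self.symm

theorem IsPositiveElement.isSelfAdjoint {R : Type u} [NonUnitalSemiring R] [StarRing R] {a : R}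
    (ha : IsPositiveElement a) : IsSelfAdjoint a := by
  obtain ⟨c, rfl⟩ := ha
  exact IsSelfAdjoint.star_mul_self c

theorem IsPositiveElement.conj {R : Type u} [NonUnitalSemiring R] [StarRing R] {a : R}
    (ha : IsPositiveElement a) (c : R) : IsPositiveElement (c * a * star c) := by
  obtain ⟨d, rfl⟩ := ha
  exact ⟨d * star c, by simp [mul_assoc]⟩

theorem IsPositiveElement.add {a b : D} (ha : IsPositiveElement a) (hb : IsPositiveElement b) :
    IsPositiveElement (a + b) := by
  rw [isPositiveElement_iff_nonneg] at *
  exact add_nonneg ha hb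

theorem isPositiveElement_cfcₙ (f : ℝ → ℝ) (a : D) (hf : ∀ t, 0 ≤ f t) :
    IsPositiveElement (cfcₙ f a) := by
  rw [isPositiveElement_iff_nonneg]
  exact cfcₙ_nonneg fun x _ => hf x

theorem IsPositiveElement.quasispectrum_nonneg {a : D} (ha : IsPositiveElement a) {t : ℝ}
    (ht : t ∈ quasispectrum ℝ a) : 0 ≤ t :=
  quasispectrum_nonneg_of_nonneg a (isPositiveElement_iff_nonneg.1 ha) t ht

/-- The truncation is invisible on the spectrum, but `CuntzLE.cfcₙ_le` asks for functions that are
nonnegative on all of ℝ. -/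
theorem IsPositiveElement.eq_cfcₙ {a : D} (ha : IsPositiveElement a) :
    a = cfcₙ (fun t : ℝ => max t 0) a := by
  conv_lhs => rw [← cfcₙ_id' ℝ a (ha := ha.isSelfAdjoint)]
  exact cfcₙ_congr fun t ht => by simp [ha.quasispectrum_nonneg ht]

theorem norm_le_of_mem_quasispectrum {a : D} (ha : IsSelfAdjoint a) {t : ℝ}
    (ht : t ∈ quasispectrum ℝ a) : |t| ≤ ‖a‖ := by
  have := norm_apply_le_norm_cfcₙ (fun t : ℝ => t) a ht
  rwa [cfcₙ_id' ℝ a] at this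

namespace CuntzLE

theorem self_mul_self {a : D} (ha : IsPositiveElement a) : CuntzLE (a * a) a := by
  have h1 : a * a = cfcₙ (fun t : ℝ => t ^ 2) a := by
    rw [← cfcₙ_id' ℝ a (ha := ha.isSelfAdjoint), ← cfcₙ_mul _ _ _, cfcₙ_id' ℝ a (ha := ha.isSelfAdjoint)]
    simp only [sq]
  conv => arg 2; rw [ha.eq_cfcₙ]
  rw [h1]
  refine cfcₙ_le ha.isSelfAdjoint (by fun_prop) (by fun_prop) (by simp) (by simp)
    (fun t => by positivity) (fun t => le_max_right _ _) (norm_nonneg a) fun t ht => ?_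
  have h2 := norm_le_of_mem_quasispectrum ha.isSelfAdjoint ht
  rw [max_eq_left (ha.quasispectrum_nonneg ht), sq]
  have := ha.quasispectrum_nonneg ht
  rw [abs_of_nonneg this] at h2
  gcongr

end CuntzLE

/-- The element `(a - d)₊`. -/
def cutDown (d : ℝ) (a : D) : D := cfcₙ (fun t : ℝ => max (t - d) 0) a

theorem isPositiveElement_cutDown (d : ℝ) (a : D) : IsPositiveElement (cutDown d a) :=
  isPositiveElement_cfcₙ _ a fun _ => le_max_right _ _

theorem tendsto_cutDown {a : D} (ha : IsPositiveElement a) :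
    Filter.Tendsto (fun d => cutDown d a) (nhdsWithin 0 (Set.Ioi (0 : ℝ))) (nhds a) := by
  rw [tendsto_iff_norm_sub_tendsto_zero]
  have h2 : Filter.Tendsto (fun d : ℝ => d) (nhdsWithin 0 (Set.Ioi 0)) (nhds 0) :=
    Filter.tendsto_id.mono_left nhdsWithin_le_nhds
  refine squeeze_zero' (Filter.Eventually.of_forall fun _ => norm_nonneg _) ?_ h2
  filter_upwards [self_mem_nhdsWithin] with d hd
  have hd : 0 < d := hd
  rw [cutDown]
  conv_lhs => arg 1; arg 2; rw [ha.eq_cfcₙ]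
  rw [← cfcₙ_sub _ _ _ (by fun_prop) (by simp [hd.le]) (by fun_prop) (by simp)]
  refine norm_cfcₙ_le fun t _ => ?_
  rw [Real.norm_eq_abs, abs_le]
  rcases le_total t 0 with h | h <;> rcases le_total (t - d) 0 with h' | h' <;>
    simp only [max_eq_left h, max_eq_right h, max_eq_left h', max_eq_right h'] <;>
    constructor <;> linarith

namespace CuntzLE

/-- In general t is not bounded by a multiple of g(t) near 0. After cutting down it is: (t - d)₊ ≤
(‖a‖ / g(d)) g(t) on the spectrum, since g is monotone. Letting d → 0 finishes the argument, as ≾ is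
closed in its first variable. -/
theorem le_cfcₙ {a : D} (ha : IsPositiveElement a) {g : ℝ → ℝ} (hg : Continuous g)
    (hg0 : g 0 = 0) (hgm : Monotone g) (hgp : ∀ t, 0 < t → 0 < g t) (hgn : ∀ t, 0 ≤ g t) :
    CuntzLE a (cfcₙ g a) := by
  refine isClosed_closure.mem_of_tendsto (tendsto_cutDown ha) ?_
  filter_upwards [self_mem_nhdsWithin] with d hd
  have hd : 0 < d := hd
  have hgd := hgp d hd
  refine cfcₙ_le ha.isSelfAdjoint (by fun_prop) hg (by simp [hd.le]) hg0
    (fun t => le_max_right _ _) hgn (C := ‖a‖ / g d) (by positivity) fun t ht => ?_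
  have h2 := norm_le_of_mem_quasispectrum ha.isSelfAdjoint ht
  rcases le_total t d with h | h
  · rw [max_eq_right (by linarith)]
    have := hgn t
    positivity
  · rw [max_eq_left (by linarith), div_mul_eq_mul_div, le_div_iff₀ hgd]
    have h3 := hgm h
    have h4 := le_abs_self t
    exact mul_le_mul (by linarith) h3 hgd.le (norm_nonneg _)

theorem le_mul_self {a : D} (ha : IsPositiveElement a) : CuntzLE a (a * a) := by
  have h1 : a * a = cfcₙ (fun t : ℝ => (max t 0) ^ 2) a := by
    conv_lhs => rw [ha.eq_cfcₙ]
    rw [← cfcₙ_mul _ _ _ (by fun_prop) (by simp) (by fun_prop) (by simp)]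
    simp only [sq]
  rw [h1]
  refine le_cfcₙ ha (by fun_prop) (by simp) (fun s t h => ?_) (fun t ht => ?_) fun t => ?_
  · gcongr
  · rw [max_eq_left ht.le]
    positivity
  · positivity

theorem self_le_cube {a : D} (ha : IsPositiveElement a) : CuntzLE a (a * a * a) := by
  have h1 : a * a * a = cfcₙ (fun t : ℝ => (max t 0) ^ 3) a := by
    conv_lhs => rw [ha.eq_cfcₙ]
    rw [← cfcₙ_mul _ _ _ (by fun_prop) (by simp) (by fun_prop) (by simp),
      ← cfcₙ_mul _ _ _ (by fun_prop) (by simp) (by fun_prop) (by simp)]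
    congr 1
    ext t
    ring
  rw [h1]
  refine le_cfcₙ ha (by fun_prop) (by simp) (fun s t h => ?_) (fun t ht => ?_) fun t => ?_
  · gcongr
  · rw [max_eq_left ht.le]
    positivity
  · positivity

/-- zz* ≾ (zz*)² = z(z*z)z*. This is the Cuntz version of Murray-von Neumann equivalence and is the
usual way to flip a product below. -/
theorem mul_star_le (z : D) : CuntzLE (z * star z) (star z * z) := by
  have hp : IsPositiveElement (z * star z) := ⟨star z, by simp⟩
  have h : CuntzLE (z * star z * (z * star z)) (star z * z) := by
    have := conj z (star z * z)
    simpa [mul_assoc] using this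
  exact (le_mul_self hp).trans h

end CuntzLE
end Positive
end

noncomputable section

universe u v

/-! ### Comparison in M_∞(D): elements of D, projections, sums and multiples of classes. -/

section Single

variable {D : Type u} [NonUnitalCStarAlgebra D]

namespace MInf

theorem single_injective : Function.Injective (single (B := D)) := fun x y h => by
  have := congrArg (fun z => z.coeff 0 0) h
  simpa [coeff_single] using this

theorem norm_coeff_le (a : MInf D) (i j : ℕ) : ‖a.coeff i j‖ ≤ ‖a‖ := by
  let _ := CStarAlgebra.spectralOrder D
  let _ := CStarAlgebra.spectralOrderedRing D
  obtain ⟨n, hn⟩ := a.exists_supp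
  by_cases h : n ≤ i ∨ n ≤ j
  · rw [hn i j h, norm_zero]
    exact norm_nonneg _
  · push Not at h
    rw [norm_eq hn]
    exact CStarMatrix.norm_entry_le_norm (M := corner n a) (i := ⟨i, h.1⟩) (j := ⟨j, h.2⟩)

theorem continuous_coeff (i j : ℕ) : Continuous fun a : MInf D => a.coeff i j := by
  let f : MInf D →+ D :=
    { toFun := fun a => a.coeff i j, map_zero' := rfl, map_add' := fun _ _ => rfl }
  refine AddMonoidHomClass.continuous_of_bound f 1 fun a => ?_
  rw [one_mul]
  exact norm_coeff_le a i j

end MInf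

open MInf

theorem conj_single_coeff (c : MInf D) (b : D) (i j : ℕ) :
    (c * single b * star c).coeff i j = c.coeff i 0 * b * star (c.coeff j 0) := by
  have h1 : ∀ k, (c * single b).coeff i k = if k = 0 then c.coeff i 0 * b else 0 := by
    intro k
    rw [coeff_mul, finsum_eq_single _ 0]
    · by_cases hk : k = 0 <;> simp [coeff_single, hk]
    · intro l hl
      simp [coeff_single, hl]
  rw [coeff_mul, finsum_eq_single _ 0]
  · simp [h1]
  · intro l hl
    simp [h1, hl]

/-- Matrix conjugators bring nothing new: the (0,0) entry of c b c* only involves the entry c₀₀. -/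
theorem cuntzSubequiv_single_iff {a b : D} :
    CuntzSubequiv (single a) (single b) ↔ CuntzLE a b := by
  rw [cuntzSubequiv_iff_mem_closure]
  constructor
  · intro h
    have := map_mem_closure (continuous_coeff (D := D) 0 0) h (t := Set.range fun c : D => c * b * star c) ?_
    · exact this
    · rintro _ ⟨c, rfl⟩
      exact ⟨c.coeff 0 0, (conj_single_coeff c b 0 0).symm⟩
  · intro h
    refine map_mem_closure (continuous_single (B := D)) h ?_
    rintro _ ⟨c, rfl⟩
    exact ⟨single c, by simp [map_star]⟩

theorem cuntzSubequiv_iff_cuntzLE {a b : MInf D} : CuntzSubequiv a b ↔ CuntzLE a b :=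
  cuntzSubequiv_iff_mem_closure

/-- Conjugators from the completion can be approximated by conjugators from the dense subalgebra.
This is what makes W → Cu an order embedding. -/
theorem cuntzLE_of_iff {a b : MInf D} :
    CuntzLE (Stabilization.of a) (Stabilization.of b) ↔ CuntzSubequiv a b := by
  rw [cuntzSubequiv_iff_mem_closure, Stabilization.isDenseInducing_of.isInducing.closure_eq_preimage_closure_image]
  constructor
  · intro h
    rw [Set.mem_preimage]
    refine closure_minimal ?_ isClosed_closure h
    rintro _ ⟨c, rfl⟩
    have hc : Continuous fun x : Stabilization D => x * Stabilization.of b * star x := by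
      have := Stabilization.continuous_star' (B := D)
      fun_prop
    refine map_mem_closure (f := fun x : Stabilization D => x * Stabilization.of b * star x) hc (Stabilization.denseRange_of c) ?_
    rintro _ ⟨x, rfl⟩
    refine ⟨x * b * star x, ⟨x, rfl⟩, ?_⟩
    simp only [Stabilization.of_mul, Stabilization.of_star]
  · intro h
    refine closure_mono ?_ (Set.mem_preimage.1 h)
    rintro _ ⟨_, ⟨x, rfl⟩, rfl⟩
    refine ⟨Stabilization.of x, ?_⟩
    simp only [Stabilization.of_mul, Stabilization.of_star]

theorem MInf.mul_star_cuntzSubequiv (z : MInf D) : CuntzSubequiv (z * star z) (star z * z) := by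
  rw [← cuntzLE_of_iff, Stabilization.of_mul, Stabilization.of_mul, Stabilization.of_star]
  exact CuntzLE.mul_star_le _

theorem CuntzSubequiv.conj (c b : MInf D) : CuntzSubequiv (c * b * star c) b :=
  cuntzSubequiv_iff_cuntzLE.2 (CuntzLE.conj c b)

/-- A positive element close to a projection dominates it. -/
theorem IsStarProjection.cuntzSubequiv_of_norm_sub_lt {q y : MInf D} (hq : IsStarProjection q)
    (hy : IsPositiveElement y) (h : ‖q - y‖ < 1) : CuntzSubequiv q y := by
  have hqq : q * q = q := hq.isIdempotentElem
  have hqs : star q = q := hq.isSelfAdjoint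
  obtain ⟨t, ht⟩ := hy
  have hqn : ‖q‖ ≤ 1 := hq.norm_le
  set k := q * y * q with hk
  set r := q - k with hr
  have hkq : k * q = k := by rw [hk, mul_assoc, hqq]
  have hqk : q * k = k := by rw [hk, ← mul_assoc, ← mul_assoc, hqq]
  have hks : star k = k := by simp [hk, ht, hqs, mul_assoc]
  have hrn : ‖r‖ < 1 := by
    have : r = q * (q - y) * q := by
      rw [hr, hk, mul_sub, sub_mul, hqq, hqq]
    rw [this]
    calc ‖q * (q - y) * q‖ ≤ ‖q‖ * ‖q - y‖ * ‖q‖ := (norm_mul_le _ _).trans (by gcongr; exact norm_mul_le _ _)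
      _ ≤ 1 * ‖q - y‖ * 1 := by gcongr
      _ < 1 := by simpa using h
  have hrq : r * q = r := by rw [hr, sub_mul, hqq, hkq]
  have hrs : star r = r := by rw [hr, star_sub, hqs, hks]
  -- A Neumann series in the corner with unit q: p n = rⁿq and s n = q + r + ⋯ + rⁿ. Since M_∞(D) is
  -- neither unital nor complete, the partial sums s n serve as approximate inverses of k = q - r.
  let p : ℕ → MInf D := fun n => Nat.rec q (fun _ x => r * x) n
  let s : ℕ → MInf D := fun n => Nat.rec q (fun _ x => q + r * x) n
  have hp0 : p 0 = q := rfl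
  have hs0 : s 0 = q := rfl
  have hp1 : ∀ n, p (n + 1) = r * p n := fun _ => rfl
  have hs1 : ∀ n, s (n + 1) = q + r * s n := fun _ => rfl
  have hsk : ∀ n, s n * k = q - r * p n := by
    intro n
    induction n with
    | zero => rw [hs0, hp0, hqk, hrq, hr]; abel
    | succ n ih => rw [hs1, hp1, add_mul, mul_assoc, ih, hqk, mul_sub, hrq, hr]; abel
  have hpn : ∀ n, ‖r * p n‖ ≤ ‖r‖ ^ n := by
    intro n
    induction n with
    | zero => rw [hp0, hrq, pow_zero]; exact hrn.le
    | succ n ih =>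
      rw [hp1, pow_succ']
      exact (norm_mul_le _ _).trans (by gcongr)
  have hlim : Filter.Tendsto (fun n => s n * k) Filter.atTop (nhds q) := by
    rw [tendsto_iff_norm_sub_tendsto_zero]
    refine squeeze_zero (fun _ => norm_nonneg _) (fun n => ?_)
      (tendsto_pow_atTop_nhds_zero_of_lt_one (norm_nonneg r) hrn)
    rw [hsk, sub_sub_cancel_left, norm_neg]
    exact hpn n
  have hlim2 : Filter.Tendsto (fun n => s n * (k * star k) * star (s n)) Filter.atTop (nhds q) := by
    have := hlim.mul hlim.star
    rw [hqs, hqq] at this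
    refine this.congr fun n => ?_
    simp [mul_assoc]
  have h1 : CuntzSubequiv q (k * star k) := CuntzSubequiv.of_tendsto _ hlim2
  refine h1.trans ?_
  -- As y = t*t, the element kk* is a conjugate of (tq)(tq)*. Flipping that product gives qyq, which
  -- is a conjugate of y.
  have h3 : k * star k = (q * star t) * (t * q * star t) * star (q * star t) := by
    rw [hks, hk, ht]
    simp only [star_mul, star_star, hqs, mul_assoc]
    rw [← mul_assoc q q, hqq]
  have h4 : t * q * star t = (t * q) * star (t * q) := by
    rw [star_mul, hqs, mul_assoc, mul_assoc, ← mul_assoc q q, hqq]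
  have h5 : star (t * q) * (t * q) = q * y * star q := by
    rw [star_mul, hqs, ht]; simp only [mul_assoc]
  rw [h3]
  refine (CuntzSubequiv.conj _ _).trans ?_
  rw [h4]
  refine (MInf.mul_star_cuntzSubequiv _).trans ?_
  rw [h5]
  exact CuntzSubequiv.conj _ _

namespace MInf

/-- The matrix with the entries `x`, `y` in its first row. -/
def row (x y : D) : MInf D :=
  mk (fun i j => if i = 0 ∧ j = 0 then x else if i = 0 ∧ j = 1 then y else 0)
    ⟨2, fun i j h => by rw [if_neg (by omega), if_neg (by omega)]⟩

theorem coeff_row (x y : D) (i j : ℕ) : (row x y).coeff i j =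
    if i = 0 ∧ j = 0 then x else if i = 0 ∧ j = 1 then y else 0 := rfl

theorem supp_row (x y : D) : Supp 2 (row x y) := fun i j h => by
  rw [coeff_row, if_neg (by omega), if_neg (by omega)]

theorem dsum_single_single (x y : D) : dsum (single x) (single y) =
    mk (fun i j => if i = 0 ∧ j = 0 then x else if i = 1 ∧ j = 1 then y else 0)
      ⟨2, fun i j h => by rw [if_neg (by omega), if_neg (by omega)]⟩ := by
  refine ext fun i j => ?_
  simp only [coeff_dsum, coeff_single, coeff_mk]
  split_ifs <;> first | rfl | omega

theorem row_mul_dsum_mul_star_row (x y u v : D) :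
    row x y * dsum (single u) (single v) * star (row x y) =
      single (x * u * star x + y * v * star y) := by
  have h1 : row x y * dsum (single u) (single v) = row (x * u) (y * v) := by
    refine ext fun i k => ?_
    rw [coeff_mul_of_supp (supp_row x y), Fin.sum_univ_two, dsum_single_single]
    by_cases hi : i = 0 <;> by_cases hk : k = 0 <;> simp [coeff_row, hi, hk]
  refine ext fun i j => ?_
  rw [h1, coeff_mul_of_supp (supp_row _ _), Fin.sum_univ_two]
  by_cases hi : i = 0 <;> by_cases hj : j = 0 <;>
    simp [coeff_row, coeff_single, hi, hj, -map_add, -map_mul]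

theorem star_row_mul_single_mul_row (x y s : D) :
    star (row x y) * single s * row x y =
      mk (fun i j => if i = 0 ∧ j = 0 then star x * s * x else if i = 0 ∧ j = 1 then
        star x * s * y else if i = 1 ∧ j = 0 then star y * s * x else if i = 1 ∧ j = 1 then
        star y * s * y else 0) ⟨2, fun i j h => by
          rw [if_neg (by omega), if_neg (by omega), if_neg (by omega), if_neg (by omega)]⟩ := by
  refine ext fun i j => ?_
  have := conj_single_coeff (star (row x y)) s i j
  rw [star_star] at this
  rw [this]
  simp only [coeff_star, coeff_row, coeff_mk]
  by_cases hi : i = 0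
  · by_cases hj : j = 0
    · simp [hi, hj]
    · by_cases hj1 : j = 1 <;> simp [hi, hj, hj1]
  · by_cases hi1 : i = 1
    · by_cases hj : j = 0
      · simp [hi1, hj]
      · by_cases hj1 : j = 1 <;> simp [hi1, hj, hj1]
    · simp [hi, hi1]

end MInf

/-- The class of an element of `D`. -/
def scls (a : D) (ha : IsPositiveElement a) : WSemigroup D :=
  WSemigroup.cls (MInf.single a) (ha.map MInf.single)

theorem scls_le_scls {a b : D} {ha : IsPositiveElement a} {hb : IsPositiveElement b} :
    scls a ha ≤ scls b hb ↔ CuntzLE a b := by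
  rw [scls, scls, WSemigroup.cls_le_cls, cuntzSubequiv_single_iff]

/-- Conjugating diag(a, b) by the row (w, w) gives waw* + wbw*, which tends to a + b as w runs
through an approximate unit. -/
theorem scls_add_le {a b : D} (ha : IsPositiveElement a) (hb : IsPositiveElement b) :
    scls (a + b) (ha.add hb) ≤ scls a ha + scls b hb := by
  rw [scls, scls, scls, WSemigroup.cls_add_cls, WSemigroup.cls_le_cls]
  obtain ⟨l, hl, hlim⟩ := exists_filter_tendsto_conj (B := D)
  refine CuntzSubequiv.of_tendsto (l := l) (fun w => row w w) ?_
  simp only [row_mul_dsum_mul_star_row]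
  refine ((continuous_single (B := D)).tendsto _).comp ?_
  exact (hlim a).add (hlim b)

/-- Conjugating a + b by the column with entries a, b gives diag(a³, b³), because ab = 0 kills the
off-diagonal entries a(a + b)b. Cubes dominate the original elements by `CuntzLE.self_le_cube`. -/
theorem le_scls_add {a b : D} (ha : IsPositiveElement a) (hb : IsPositiveElement b)
    (hab : a * b = 0) : scls a ha + scls b hb ≤ scls (a + b) (ha.add hb) := by
  have hba : b * a = 0 := by
    have := congrArg star hab
    rwa [star_mul, ha.isSelfAdjoint.star_eq, hb.isSelfAdjoint.star_eq, star_zero] at this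
  have h := (cuntzSubequiv_single_iff.2 (CuntzLE.self_le_cube ha)).dsum
    (cuntzSubequiv_single_iff.2 (CuntzLE.self_le_cube hb))
  refine (show scls a ha + scls b hb ≤ _ from WSemigroup.cls_le_cls.2
    (h.trans ?_) : scls a ha + scls b hb ≤ WSemigroup.cls (single (a + b)) _)
  have := CuntzSubequiv.conj (star (row a b)) (single (a + b))
  rw [star_star, star_row_mul_single_mul_row] at this
  rw [dsum_single_single]
  convert this using 5
  · rw [ha.isSelfAdjoint.star_eq, mul_add, hab, add_zero]
  · rw [ha.isSelfAdjoint.star_eq, hb.isSelfAdjoint.star_eq]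
    simp only [mul_add, hba, hab, mul_assoc, mul_zero, add_zero, zero_add]
    split_ifs <;> first | rfl | omega

namespace MInf

/-- The diagonal matrix with `n` entries `x`. -/
def diag (n : ℕ) (x : D) : MInf D :=
  mk (fun i j => if i = j ∧ i < n then x else 0) ⟨n, fun i j h => if_neg (by omega)⟩

theorem coeff_diag (n : ℕ) (x : D) (i j : ℕ) :
    (diag n x).coeff i j = if i = j ∧ i < n then x else 0 := rfl

theorem supp_diag (n : ℕ) (x : D) : Supp n (diag n x) := fun _ _ _ => if_neg (by omega)

theorem diag_zero_left (x : D) : diag 0 x = 0 := ext fun i j => by simp [coeff_diag]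

theorem diag_succ (n : ℕ) (x : D) : diag (n + 1) x = blockSum n (diag n x) (single x) := by
  refine ext fun i j => ?_
  simp only [blockSum, coeff_mk, coeff_diag, coeff_single]
  split_ifs <;> first | rfl | omega

theorem coeff_diag_mul (n : ℕ) (x : D) (a : MInf D) (i j : ℕ) :
    (diag n x * a).coeff i j = if i < n then x * a.coeff i j else 0 := by
  rw [coeff_mul, finsum_eq_single _ i]
  · by_cases h : i < n <;> simp [coeff_diag, h]
  · intro k hk
    simp [coeff_diag, Ne.symm hk]

theorem coeff_mul_diag (n : ℕ) (x : D) (a : MInf D) (i j : ℕ) :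
    (a * diag n x).coeff i j = if j < n then a.coeff i j * x else 0 := by
  rw [coeff_mul, finsum_eq_single _ j]
  · by_cases h : j < n <;> simp [coeff_diag, h]
  · intro k hk
    simp [coeff_diag, hk]

theorem diag_mul_diag (n : ℕ) (x y : D) : diag n x * diag n y = diag n (x * y) := by
  refine ext fun i j => ?_
  rw [coeff_diag_mul, coeff_diag, coeff_diag]
  split_ifs <;> first | rfl | omega | simp

theorem star_diag (n : ℕ) (x : D) : star (diag n x) = diag n (star x) := by
  refine ext fun i j => ?_
  simp only [coeff_star, coeff_diag]
  split_ifs <;> first | rfl | omega | simp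

theorem isPositiveElement_diag (n : ℕ) {x : D} (hx : IsPositiveElement x) :
    IsPositiveElement (diag n x) := by
  obtain ⟨c, rfl⟩ := hx
  exact ⟨diag n c, by rw [star_diag, diag_mul_diag]⟩

theorem isStarProjection_diag (n : ℕ) {x : D} (hx : IsStarProjection x) :
    IsStarProjection (diag n x) :=
  ⟨by rw [IsIdempotentElem, diag_mul_diag, hx.isIdempotentElem.eq],
    by rw [isSelfAdjoint_iff, star_diag, hx.isSelfAdjoint.star_eq]⟩

end MInf

theorem cls_diag (n : ℕ) (x : D) (hx : IsPositiveElement x) :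
    WSemigroup.cls (diag n x) (isPositiveElement_diag n hx) = n • scls x hx := by
  induction n with
  | zero =>
    rw [zero_smul, WSemigroup.zero_def]
    congr 1
    exact diag_zero_left x
  | succ n ih =>
    rw [succ_nsmul, ← ih, scls, WSemigroup.cls_add_cls, WSemigroup.cls_eq_cls, diag_succ]
    exact ⟨blockSum_cuntzSubequiv n _ _, cuntzSubequiv_blockSum (supp_diag n x) _⟩

theorem zero_le_W (x : WSemigroup D) : 0 ≤ x := by
  refine WSemigroup.ind (fun a ha => ?_) x
  rw [WSemigroup.zero_def, WSemigroup.cls_le_cls, cuntzSubequiv_iff_cuntzLE]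
  exact CuntzLE.zero a

theorem IsStarProjection.isPositiveElement {R : Type u} [NonUnitalSemiring R] [StarRing R] {q : R}
    (hq : IsStarProjection q) : IsPositiveElement q :=
  ⟨q, by rw [hq.isSelfAdjoint.star_eq, hq.isIdempotentElem.eq]⟩

end Single
end

noncomputable section

universe u v

/-! ### The stabilization: extension of homomorphisms and compression to finite corners. -/

namespace Stabilization

open MInf

section Lift

variable {B : Type u} [NonUnitalCStarAlgebra B] {C : Type v} [NonUnitalCStarAlgebra C]

theorem uniformContinuous_hom (f : MInf B →⋆ₙₐ[ℂ] MInf C) : UniformContinuous f :=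
  uniformContinuous_addMonoidHom_of_continuous (MInf.continuous_hom f)

/-- The extension of a homomorphism `M_∞(B) → M_∞(C)` by continuity. -/
def liftFun (f : MInf B →⋆ₙₐ[ℂ] MInf C) (x : Stabilization B) : Stabilization C :=
  UniformSpace.Completion.map f x

theorem continuous_liftFun (f : MInf B →⋆ₙₐ[ℂ] MInf C) : Continuous (liftFun f) :=
  UniformSpace.Completion.continuous_map

theorem liftFun_of (f : MInf B →⋆ₙₐ[ℂ] MInf C) (a : MInf B) : liftFun f (of a) = of (f a) :=
  UniformSpace.Completion.map_coe (uniformContinuous_hom f) a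

/-- The extension of a homomorphism `M_∞(B) → M_∞(C)` to a homomorphism of stabilizations. -/
def lift (f : MInf B →⋆ₙₐ[ℂ] MInf C) : Stabilization B →⋆ₙₐ[ℂ] Stabilization C where
  toFun := liftFun f
  map_zero' := by rw [← of_zero, liftFun_of, map_zero, of_zero]
  map_add' x y := by
    refine induction₂ x y (isClosed_eq ((continuous_liftFun f).comp continuous_add)
      (((continuous_liftFun f).comp continuous_fst).add
        ((continuous_liftFun f).comp continuous_snd))) fun a b => ?_
    rw [← of_add, liftFun_of, liftFun_of, liftFun_of, map_add, of_add]
  map_smul' c x := by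
    refine induction₁ x (isClosed_eq ((continuous_liftFun f).comp (continuous_smul' c))
      ((continuous_smul' c).comp (continuous_liftFun f))) fun a => ?_
    rw [← of_smul, liftFun_of, liftFun_of, map_smul, of_smul]
    rfl
  map_mul' x y := by
    refine induction₂ x y (isClosed_eq ((continuous_liftFun f).comp continuous_mul)
      (((continuous_liftFun f).comp continuous_fst).mul
        ((continuous_liftFun f).comp continuous_snd))) fun a b => ?_
    rw [← of_mul, liftFun_of, liftFun_of, liftFun_of, map_mul, of_mul]
  map_star' x := by
    refine induction₁ x (isClosed_eq ((continuous_liftFun f).comp continuous_star')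
      (continuous_star'.comp (continuous_liftFun f))) fun a => ?_
    rw [← of_star, liftFun_of, liftFun_of, map_star, of_star]

theorem lift_of (f : MInf B →⋆ₙₐ[ℂ] MInf C) (a : MInf B) : lift f (of a) = of (f a) :=
  liftFun_of f a

theorem continuous_lift (f : MInf B →⋆ₙₐ[ℂ] MInf C) : Continuous (lift f) :=
  continuous_liftFun f

theorem lift_inl_mul_lift_inr (x y : Stabilization B) :
    lift (inl (B := B)) x * lift (inr (B := B)) y = 0 := by
  refine induction₂ x y (isClosed_eq (((continuous_lift inl).comp continuous_fst).mul
    ((continuous_lift inr).comp continuous_snd)) continuous_const) fun a b => ?_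
  rw [lift_of, lift_of, ← of_mul, ← of_zero]
  congr 1
  change dsum a 0 * dsum 0 b = 0
  rw [dsum_mul, mul_zero, zero_mul, dsum_zero_zero]

theorem isometry_of : Isometry (of (B := B)) := UniformSpace.Completion.coe_isometry

theorem continuous_map (φ : B →⋆ₙₐ[ℂ] C) : Continuous (map φ) := continuous_mapFun φ

theorem norm_map {φ : B →⋆ₙₐ[ℂ] C} (hφ : Function.Injective φ) (x : Stabilization B) :
    ‖map φ x‖ = ‖x‖ := by
  refine induction₁ x (isClosed_eq (continuous_map φ).norm continuous_norm) fun a => ?_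
  rw [map_of, norm_of, norm_of]
  obtain ⟨n, ha⟩ := a.exists_supp
  let _ := CStarAlgebra.spectralOrder B
  let _ := CStarAlgebra.spectralOrderedRing B
  let _ := CStarAlgebra.spectralOrder C
  let _ := CStarAlgebra.spectralOrderedRing C
  rw [norm_eq ha, norm_eq (n := n) (fun i j h => by simp [ha i j h])]
  refine NonUnitalStarAlgHom.norm_map (CStarMatrix.mapₙₐ (n := Fin n) φ) (fun M N h => ?_) _
  ext i j
  exact hφ (congrFun (congrFun h i) j)

theorem isometry_of_single : Isometry (fun y : B => of (single y)) := by
  refine isometry_of.comp (AddMonoidHomClass.isometry_of_norm (single (B := B)) fun x => ?_)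
  refine le_antisymm ?_ ?_
  · have := NonUnitalStarAlgHom.norm_apply_le ((ofHom (B := B)).comp single) x
    rwa [← norm_of]
  · simpa [coeff_single] using norm_coeff_le (single x) 0 0

theorem isClosed_image_supp (n : ℕ) : IsClosed (of '' {y : MInf B | Supp n y}) := by
  let _ := CStarAlgebra.spectralOrder B
  let _ := CStarAlgebra.spectralOrderedRing B
  have h : of '' {y : MInf B | Supp n y} =
      Set.range (fun M : CStarMatrix (Fin n) (Fin n) B => of (ofCorner n M)) := by
    ext x
    constructor
    · rintro ⟨y, hy, rfl⟩
      exact ⟨corner n y, congrArg of (ofCorner_corner hy)⟩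
    · rintro ⟨M, rfl⟩
      exact ⟨_, supp_ofCorner n M, rfl⟩
  rw [h]
  have hi : Isometry (fun M : CStarMatrix (Fin n) (Fin n) B => of (ofCorner n M)) := by
    refine isometry_of.comp ?_
    refine AddMonoidHomClass.isometry_of_norm (ofCornerHom (B := B) n) fun M => ?_
    change ‖ofCorner n M‖ = _
    rw [norm_eq (supp_ofCorner n M), corner_ofCorner]
  exact hi.isClosedEmbedding.isClosed_range

/-- Mₙ(B) is complete, hence closed in the stabilization, so the assertion passes from the dense
M_∞(B) to all x. It turns compressed elements of 𝒦 ⊗ B into genuine finite matrices. -/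
theorem exists_compress_eq {n : ℕ} {r s : MInf B} (hr : ∀ i j, n ≤ i → r.coeff i j = 0)
    (hs : ∀ i j, n ≤ j → s.coeff i j = 0) (x : Stabilization B) :
    ∃ y, Supp n y ∧ of r * x * of s = of y := by
  have h : of r * x * of s ∈ of '' {y : MInf B | Supp n y} := by
    refine induction₁ x ((isClosed_image_supp n).preimage (by fun_prop)) fun a => ?_
    refine ⟨r * a * s, fun i j h => ?_, by rw [of_mul, of_mul]⟩
    rcases h with h | h
    · rw [mul_assoc, coeff_mul]
      simp [hr i _ h]
    · rw [coeff_mul]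
      simp [hs _ j h]
  obtain ⟨y, hy, hxy⟩ := h
  exact ⟨y, hy, hxy.symm⟩

theorem inl_cuntzSubequiv (x : MInf B) : CuntzSubequiv (inl x) x := dsum_zero_cuntzSubequiv x

theorem cuntzSubequiv_inl (x : MInf B) : CuntzSubequiv x (inl x) := cuntzSubequiv_dsum_zero x

theorem inr_cuntzSubequiv (x : MInf B) : CuntzSubequiv (inr x) x :=
  (cuntzSubequiv_dsum_comm 0 x).trans (dsum_zero_cuntzSubequiv x)

theorem cuntzSubequiv_inr (x : MInf B) : CuntzSubequiv x (inr x) :=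
  (cuntzSubequiv_dsum_zero x).trans (cuntzSubequiv_dsum_comm x 0)

end Lift

variable {A : Type u} [CStarAlgebra A]

/-- The projection `1_n` in `𝒦 ⊗ A`. -/
def oneDiag (A : Type u) [CStarAlgebra A] (n : ℕ) : Stabilization A := of (diag n 1)

theorem isStarProjection_one_diag (n : ℕ) : IsStarProjection (diag n (1 : A)) :=
  isStarProjection_diag n ⟨by simp [IsIdempotentElem], by simp⟩

theorem isStarProjection_oneDiag (n : ℕ) : IsStarProjection (oneDiag A n) := by
  have h := isStarProjection_one_diag (A := A) n
  exact ⟨by rw [IsIdempotentElem, oneDiag, ← of_mul, h.isIdempotentElem.eq],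
    by rw [isSelfAdjoint_iff, oneDiag, ← of_star, h.isSelfAdjoint.star_eq]⟩

theorem diag_one_mul {n : ℕ} {a : MInf A} (ha : ∀ i j, n ≤ i → a.coeff i j = 0) :
    diag n 1 * a = a := by
  refine MInf.ext fun i j => ?_
  rw [coeff_diag_mul]
  split_ifs with h
  · rw [one_mul]
  · rw [ha i j (by omega)]

theorem mul_diag_one {n : ℕ} {a : MInf A} (ha : ∀ i j, n ≤ j → a.coeff i j = 0) :
    a * diag n 1 = a := by
  refine MInf.ext fun i j => ?_
  rw [coeff_mul_diag]
  split_ifs with h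
  · rw [mul_one]
  · rw [ha i j (by omega)]

theorem tendsto_oneDiag_conj (x : Stabilization A) :
    Filter.Tendsto (fun n => oneDiag A n * x * oneDiag A n) Filter.atTop (nhds x) := by
  rw [Metric.tendsto_atTop]
  intro ε hε
  obtain ⟨_, ⟨a, rfl⟩, ha⟩ := Metric.mem_closure_iff.1 (denseRange_of x) (ε / 3) (by positivity)
  obtain ⟨N, hN⟩ := a.exists_supp
  refine ⟨N, fun n hn => ?_⟩
  have hp : ‖oneDiag A n‖ ≤ 1 := (isStarProjection_oneDiag n).norm_le
  have h1 : oneDiag A n * of a * oneDiag A n = of a := by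
    rw [oneDiag, ← of_mul, ← of_mul, diag_one_mul fun i j h => hN i j (by omega),
      mul_diag_one fun i j h => hN i j (by omega)]
  have h2 : oneDiag A n * x * oneDiag A n - x =
      oneDiag A n * (x - of a) * oneDiag A n + (of a - x) := by
    rw [mul_sub, sub_mul, h1]; abel
  rw [dist_eq_norm] at ha ⊢
  rw [h2]
  calc _ ≤ ‖oneDiag A n * (x - of a) * oneDiag A n‖ + ‖of a - x‖ := norm_add_le _ _
    _ ≤ 1 * ‖x - of a‖ * 1 + ‖of a - x‖ := by
      gcongr
      refine (norm_mul_le _ _).trans ?_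
      gcongr
      refine (norm_mul_le _ _).trans ?_
      gcongr
    _ < ε := by rw [norm_sub_rev (of a)]; linarith

theorem oneDiag_conj_le (n : ℕ) (x : Stabilization A) :
    CuntzLE (oneDiag A n * x * oneDiag A n) x := by
  have := CuntzLE.conj (oneDiag A n) x
  rwa [(isStarProjection_oneDiag n).isSelfAdjoint.star_eq] at this

theorem exists_oneDiag_conj_eq (n : ℕ) (x : Stabilization A) :
    ∃ y, Supp n y ∧ oneDiag A n * x * oneDiag A n = of y :=
  exists_compress_eq (fun i j h => supp_diag n 1 i j (.inl h))
    (fun i j h => supp_diag n 1 i j (.inr h)) x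

/-- The hypothesis only concerns finite matrices, so it is applied to 1ₙ a 1ₙ. The image of this
compression is a conjugate of `lift f a`, and the compressions converge to a. -/
theorem le_lift {f : MInf A →⋆ₙₐ[ℂ] MInf A} (hf : ∀ x, CuntzSubequiv x (f x))
    (a : Stabilization A) : CuntzLE a (lift f a) := by
  refine CuntzLE.of_tendsto (tendsto_oneDiag_conj a) fun n => ?_
  obtain ⟨y, -, hy⟩ := exists_oneDiag_conj_eq n a
  rw [hy]
  have h1 := cuntzLE_of_iff.2 (hf y)
  rw [← lift_of, ← hy, map_mul, map_mul] at h1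
  rw [← hy]
  refine h1.trans ?_
  have := CuntzLE.conj (lift f (oneDiag A n)) (lift f a)
  rwa [← map_star, (isStarProjection_oneDiag n).isSelfAdjoint.star_eq] at this

theorem lift_le {f : MInf A →⋆ₙₐ[ℂ] MInf A} (hf : ∀ x, CuntzSubequiv (f x) x)
    (a : Stabilization A) : CuntzLE (lift f a) a := by
  refine CuntzLE.of_tendsto (((continuous_lift f).tendsto a).comp (tendsto_oneDiag_conj a))
    fun n => ?_
  obtain ⟨y, -, hy⟩ := exists_oneDiag_conj_eq n a
  refine CuntzLE.trans ?_ (oneDiag_conj_le n a)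
  rw [Function.comp_apply, hy, lift_of]
  exact cuntzLE_of_iff.2 (hf y)

end Stabilization

open MInf Stabilization

variable {A : Type u} [CStarAlgebra A]

/-- Realizes a sum of two classes by a single element of 𝒦 ⊗ A instead of a 2 × 2 matrix over it, as
membership in `CuPlus` requires. The two lifts embed 𝒦 ⊗ A as orthogonal copies of itself without
changing Cuntz classes. -/
theorem scls_lift_inl_add_lift_inr {a b : Stabilization A} (ha : IsPosElem a)
    (hb : IsPosElem b) :
    scls (lift inl a + lift inr b)
      (IsPositiveElement.add (IsPosElem.map (lift inl) ha) (IsPosElem.map (lift inr) hb)) = scls a ha + scls b hb := by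
  have h1 : scls (lift inl a) (IsPosElem.map _ ha) = scls a ha := le_antisymm
    (scls_le_scls.2 (lift_le inl_cuntzSubequiv a)) (scls_le_scls.2 (le_lift cuntzSubequiv_inl a))
  have h2 : scls (lift inr b) (IsPosElem.map _ hb) = scls b hb := le_antisymm
    (scls_le_scls.2 (lift_le inr_cuntzSubequiv b)) (scls_le_scls.2 (le_lift cuntzSubequiv_inr b))
  rw [← h1, ← h2]
  exact le_antisymm (scls_add_le _ _) (le_scls_add _ _ (lift_inl_mul_lift_inr a b))

/-! ### The additive order embedding W → Cu and its naturality. -/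

namespace WSemigroup

theorem toCu_cls (a : MInf A) (ha : IsPositiveElement a) :
    toCu A (cls a ha) = scls (of a) (isPosElem_of ha) := rfl

theorem toCu_le_iff {x y : WSemigroup A} : toCu A x ≤ toCu A y ↔ x ≤ y := by
  refine ind (fun a ha => ?_) x
  refine ind (fun b hb => ?_) y
  rw [toCu_cls, toCu_cls, scls_le_scls, cls_le_cls, cuntzLE_of_iff]

theorem toCu_zero : toCu A 0 = 0 := by
  rw [zero_def, toCu_cls, zero_def, scls]
  congr 1
  exact map_zero MInf.single

theorem toCu_add (x y : WSemigroup A) : toCu A (x + y) = toCu A x + toCu A y := by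
  refine ind (fun a ha => ?_) x
  refine ind (fun b hb => ?_) y
  rw [cls_add_cls, toCu_cls, toCu_cls, toCu_cls, ← scls_lift_inl_add_lift_inr]
  congr 1
  rw [lift_of, lift_of, ← of_add]
  congr 1
  change dsum a b = dsum a 0 + dsum 0 b
  rw [← dsum_add, add_zero, zero_add]

theorem toCu_nsmul (n : ℕ) (x : WSemigroup A) : toCu A (n • x) = n • toCu A x := by
  induction n with
  | zero => rw [zero_smul, zero_smul, toCu_zero]
  | succ n ih => rw [succ_nsmul, succ_nsmul, toCu_add, ih]

theorem map_scls {B : Type u} [NonUnitalCStarAlgebra B] {C : Type v} [NonUnitalCStarAlgebra C]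
    (φ : B →⋆ₙₐ[ℂ] C) (a : B) (ha : IsPositiveElement a) :
    map φ (scls a ha) = scls (φ a) (IsPosElem.map φ ha) := by
  rw [scls, map_cls, scls]
  congr 1
  refine MInf.ext fun i j => ?_
  rw [coeff_map, coeff_single, coeff_single]
  split_ifs <;> simp

theorem map_toCu {C : Type v} [CStarAlgebra C] (φ : A →⋆ₙₐ[ℂ] C) (x : WSemigroup A) :
    CuSemigroup.map φ (toCu A x) = toCu C (map φ x) := by
  refine ind (fun a ha => ?_) x
  rw [toCu_cls, CuSemigroup.map, map_scls, map_cls, toCu_cls]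
  congr 1
  exact map_of φ a

end WSemigroup

/-! ### Diagonal entries of positive elements of 𝒦 ⊗ A. -/

theorem isClosed_setOf_isPositiveElement {B : Type u} [NonUnitalCStarAlgebra B] :
    IsClosed {y : B | IsPositiveElement y} := by
  let _ := CStarAlgebra.spectralOrder B
  let _ := CStarAlgebra.spectralOrderedRing B
  simp only [isPositiveElement_iff_nonneg]
  exact isClosed_Ici

theorem isPositiveElement_coeff {B : Type u} [NonUnitalCStarAlgebra B] {z : MInf B}
    (hz : IsPositiveElement z) (i : ℕ) : IsPositiveElement (z.coeff i i) := by
  let _ := CStarAlgebra.spectralOrder B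
  let _ := CStarAlgebra.spectralOrderedRing B
  obtain ⟨x, rfl⟩ := hz
  obtain ⟨n, hn⟩ := x.exists_supp
  rw [isPositiveElement_iff_nonneg, coeff_mul_of_supp hn.star]
  exact Finset.sum_nonneg fun k _ => star_mul_self_nonneg _

/-- The matrix unit at the position `(0, i)`. -/
def MInf.rowUnit (A : Type u) [CStarAlgebra A] (i : ℕ) : MInf A :=
  mk (fun k l => if k = 0 ∧ l = i then 1 else 0) ⟨i + 1, fun k l h => if_neg (by omega)⟩

theorem MInf.coeff_rowUnit (i k l : ℕ) :
    (rowUnit A i).coeff k l = if k = 0 ∧ l = i then 1 else 0 := rfl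

theorem MInf.rowUnit_mul (i : ℕ) (x : MInf A) (k l : ℕ) :
    (rowUnit A i * x).coeff k l = if k = 0 then x.coeff i l else 0 := by
  rw [coeff_mul, finsum_eq_single _ i]
  · by_cases hk : k = 0 <;> simp [coeff_rowUnit, hk]
  · intro m hm
    simp [coeff_rowUnit, hm]

theorem MInf.mul_star_rowUnit (i : ℕ) (x : MInf A) (k l : ℕ) :
    (x * star (rowUnit A i)).coeff k l = if l = 0 then x.coeff k i else 0 := by
  rw [coeff_mul, finsum_eq_single _ i]
  · by_cases hk : l = 0 <;> simp [coeff_rowUnit, hk]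
  · intro m hm
    simp [coeff_rowUnit, hm]

theorem MInf.rowUnit_conj (i : ℕ) (x : MInf A) :
    rowUnit A i * x * star (rowUnit A i) = single (x.coeff i i) := by
  refine MInf.ext fun k l => ?_
  rw [mul_star_rowUnit, rowUnit_mul, coeff_single]
  split_ifs <;> first | rfl | omega

theorem MInf.diag_one_eq_sum (n : ℕ) :
    diag n (1 : A) = ∑ i ∈ Finset.range n, star (rowUnit A i) * rowUnit A i := by
  have h4 : ∀ i k l, (star (rowUnit A i) * rowUnit A i).coeff k l =
      if k = i ∧ l = i then 1 else 0 := by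
    intro i k l
    rw [coeff_mul, finsum_eq_single _ 0]
    · by_cases hk : k = i <;> simp [coeff_rowUnit, hk]
    · intro m hm
      simp [coeff_rowUnit, hm]
  refine MInf.ext fun k l => ?_
  let f : MInf A →+ A :=
    { toFun := fun a => a.coeff k l, map_zero' := rfl, map_add' := fun _ _ => rfl }
  change _ = f _
  rw [map_sum]
  change _ = ∑ i ∈ Finset.range n, (star (rowUnit A i) * rowUnit A i).coeff k l
  simp only [h4, coeff_diag]
  by_cases hkl : k = l
  · subst hkl
    simp
  · rw [if_neg (by tauto), Finset.sum_eq_zero]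
    intro i _
    rw [if_neg (by omega)]

/-- A diagonal entry of a positive element of `𝒦 ⊗ A`. -/
theorem exists_rowUnit_conj_eq (t : Stabilization A) (i : ℕ) : ∃ y : A, IsPositiveElement y ∧
    of (rowUnit A i) * (star t * t) * star (of (rowUnit A i)) = of (single y) := by
  have hcl : IsClosed ((fun y : A => of (single y)) '' {y | IsPositiveElement y}) :=
    (isometry_of_single.isClosedEmbedding).isClosedMap _ isClosed_setOf_isPositiveElement
  have h : of (rowUnit A i) * (star t * t) * star (of (rowUnit A i)) ∈
      (fun y : A => of (single y)) '' {y | IsPositiveElement y} := by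
    have hc := Stabilization.continuous_star' (B := A)
    refine induction₁ t (hcl.preimage ((continuous_const.mul
      (hc.mul continuous_id)).mul continuous_const)) fun z => ?_
    refine ⟨(star z * z).coeff i i, isPositiveElement_coeff ⟨z, rfl⟩ i, ?_⟩
    dsimp only
    rw [← of_star, ← of_star, ← of_mul, ← of_mul, ← of_mul, rowUnit_conj]
  obtain ⟨y, hy, h⟩ := h
  exact ⟨y, hy, h.symm⟩

/-- A nonzero positive element of `𝒦 ⊗ A` dominates a nonzero positive element of `A`. -/
theorem exists_single_le {f : Stabilization A} (hf : IsPosElem f) (hf0 : f ≠ 0) :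
    ∃ y : A, IsPositiveElement y ∧ y ≠ 0 ∧ CuntzLE (of (single y)) f := by
  obtain ⟨t, rfl⟩ := hf
  choose y hpos hy using exists_rowUnit_conj_eq t
  by_contra hcon
  push Not at hcon
  -- The i-th diagonal entry of t*t is w*w for w = t eᵢ*, where eᵢ is the matrix unit. If every
  -- diagonal entry vanishes, t annihilates every 1ₙ, and therefore t = 0.
  have h0 : ∀ i, t * star (of (rowUnit A i)) = 0 := by
    intro i
    by_cases hyi : y i = 0
    · rw [← CStarRing.star_mul_self_eq_zero_iff]
      have := hy i
      rw [hyi, map_zero, of_zero] at this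
      rw [star_mul, star_star, mul_assoc, ← this]
      simp only [mul_assoc]
    · exact absurd (by rw [← hy]; exact CuntzLE.conj _ _) (hcon (y i) (hpos i) hyi)
  have h1 : ∀ n, t * oneDiag A n = 0 := by
    intro n
    have h3 : oneDiag A n =
        ∑ i ∈ Finset.range n, star (of (rowUnit A i)) * of (rowUnit A i) := by
      rw [oneDiag, diag_one_eq_sum]
      change ofAddHom _ = _
      rw [map_sum]
      refine Finset.sum_congr rfl fun i _ => ?_
      change of _ = _
      rw [of_mul, of_star]
    rw [h3, Finset.mul_sum]
    refine Finset.sum_eq_zero fun i _ => ?_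
    rw [← mul_assoc, h0, zero_mul]
  have h2 : t = 0 := by
    have h3 := tendsto_oneDiag_conj t
    simp only [mul_assoc, h1, mul_zero] at h3
    exact (tendsto_nhds_unique h3 tendsto_const_nhds)
  exact hf0 (by rw [h2, mul_zero])
end

noncomputable section

universe u v

open MInf Stabilization

/-! ### Consequences of simplicity. -/

section Algebra

variable {A : Type u} [CStarAlgebra A]

/-- The closed ideal generated by f is everything, so some finite sum ∑ r f s lies within distance 1
of the unit. Such a sum is invertible, and its inverse can be absorbed into the right factors. -/
theorem IsSimpleCStarAlgebra.exists_list_sum_eq_one (hs : IsSimpleCStarAlgebra A) {f : A}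
    (hf : f ≠ 0) : ∃ l : List (A × A), (l.map fun p => p.1 * f * p.2).sum = 1 := by
  let S : AddSubgroup A := AddSubgroup.closure {x | ∃ r s : A, x = r * f * s}
  let I : TwoSidedIdeal A := TwoSidedIdeal.mk' (S.topologicalClosure : Set A)
    S.topologicalClosure.zero_mem S.topologicalClosure.add_mem S.topologicalClosure.neg_mem
    (fun {x y} hy => by
      refine map_mem_closure (f := fun y => x * y) (by fun_prop) hy fun z hz => ?_
      induction hz using AddSubgroup.closure_induction with
      | mem z hz =>
        obtain ⟨r, s, rfl⟩ := hz
        exact AddSubgroup.subset_closure ⟨x * r, s, by simp only [mul_assoc]⟩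
      | zero => simp
      | add a b _ _ ha hb => simpa [mul_add] using S.add_mem ha hb
      | neg a _ ha => simpa using S.neg_mem ha)
    (fun {x y} hx => by
      refine map_mem_closure (f := fun x => x * y) (by fun_prop) hx fun z hz => ?_
      induction hz using AddSubgroup.closure_induction with
      | mem z hz =>
        obtain ⟨r, s, rfl⟩ := hz
        exact AddSubgroup.subset_closure ⟨r, s * y, by simp only [mul_assoc]⟩
      | zero => simp
      | add a b _ _ ha hb => simpa [add_mul] using S.add_mem ha hb
      | neg a _ ha => simpa using S.neg_mem ha)
  have hI : ∀ x, x ∈ I ↔ x ∈ S.topologicalClosure := fun x => TwoSidedIdeal.mem_mk' ..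
  have hcl : IsClosed (I : Set A) := by
    have : (I : Set A) = S.topologicalClosure := Set.ext hI
    rw [this]
    exact S.isClosed_topologicalClosure
  have hfI : f ∈ I := (hI f).2 (S.le_topologicalClosure
    (AddSubgroup.subset_closure ⟨1, 1, by simp⟩))
  have htop : I = ⊤ := (hs.2 I hcl).resolve_left fun h => hf (by rwa [h, TwoSidedIdeal.mem_bot] at hfI)
  have h1 : (1 : A) ∈ closure (S : Set A) := (hI 1).1 (by rw [htop]; trivial)
  obtain ⟨x, hx, hx1⟩ := Metric.mem_closure_iff.1 h1 1 one_pos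
  rw [dist_eq_norm] at hx1
  have hl : ∃ l : List (A × A), (l.map fun p => p.1 * f * p.2).sum = x := by
    clear hx1
    induction hx using AddSubgroup.closure_induction with
    | mem z hz =>
      obtain ⟨r, s, rfl⟩ := hz
      exact ⟨[(r, s)], by simp⟩
    | zero => exact ⟨[], by simp⟩
    | add a b _ _ ha hb =>
      obtain ⟨l, rfl⟩ := ha
      obtain ⟨l', rfl⟩ := hb
      exact ⟨l ++ l', by simp⟩
    | neg a _ ha =>
      obtain ⟨l, rfl⟩ := ha
      refine ⟨l.map fun p => (-p.1, p.2), ?_⟩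
      rw [List.map_map, ← neg_one_mul, ← List.sum_map_mul_left]
      simp [Function.comp_def]
  obtain ⟨l, rfl⟩ := hl
  obtain ⟨w, hw⟩ : ∃ w, (l.map fun p => p.1 * f * p.2).sum * w = 1 := by
    have : IsUnit (l.map fun p => p.1 * f * p.2).sum := by
      have := (Units.oneSub _ hx1).isUnit
      rwa [Units.val_oneSub, sub_sub_cancel] at this
    exact ⟨_, this.mul_val_inv⟩
  refine ⟨l.map fun p => (p.1, p.2 * w), ?_⟩
  rw [← hw, ← List.sum_map_mul_right, List.map_map]
  simp [Function.comp_def, mul_assoc]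

/-- Simple algebras are prime: writing 1 = ∑ r g s, the vanishing of all f r g would give f = ∑ f r
g s = 0. -/
theorem IsSimpleCStarAlgebra.exists_mul_mul_ne_zero (hs : IsSimpleCStarAlgebra A) {f g : A}
    (hf : f ≠ 0) (hg : g ≠ 0) : ∃ s, f * s * g ≠ 0 := by
  by_contra! h
  obtain ⟨l, hl⟩ := hs.exists_list_sum_eq_one hg
  refine hf ?_
  rw [← mul_one f, ← hl, ← List.sum_map_mul_left]
  refine List.sum_eq_zero fun x hx => ?_
  obtain ⟨p, -, rfl⟩ := List.mem_map.1 hx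
  rw [← mul_assoc, ← mul_assoc, h, zero_mul]

theorem isPositiveElement_one {R : Type u} [Semiring R] [StarRing R] :
    IsPositiveElement (1 : R) := ⟨1, by simp⟩

/-- Write 1 = ∑ r f s as a matrix product R F S with a row R, F = diag(f, …, f) and a column S. Then
1 = S*(FR*)(FR*)*S ≾ (FR*)*(FR*) = R F² R* ≾ F² ≾ F. -/
theorem IsSimpleCStarAlgebra.exists_one_le_nsmul (hs : IsSimpleCStarAlgebra A) {f : A}
    (hf : IsPositiveElement f) (hf0 : f ≠ 0) :
    ∃ n : ℕ, scls (1 : A) isPositiveElement_one ≤ n • scls f hf := by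
  obtain ⟨l, hl⟩ := hs.exists_list_sum_eq_one hf0
  refine ⟨l.length, ?_⟩
  rw [← cls_diag, scls, WSemigroup.cls_le_cls]
  -- The default value is never seen: `R` and `S` only use indices below `l.length`.
  let p : ℕ → A × A := fun i => l.getD i 0
  let R : MInf A := mk (fun i j => if i = 0 ∧ j < l.length then (p j).1 else 0)
    ⟨l.length + 1, fun i j h => if_neg (by omega)⟩
  let S : MInf A := mk (fun i j => if j = 0 ∧ i < l.length then (p i).2 else 0)
    ⟨l.length + 1, fun i j h => if_neg (by omega)⟩
  have hRFS : R * diag l.length f * S = single 1 := by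
    refine MInf.ext fun i j => ?_
    have hsupp : ∀ k, l.length ≤ k → (R * diag l.length f).coeff i k = 0 := fun k hk => by
      rw [coeff_mul_diag, if_neg (by omega)]
    have : (R * diag l.length f * S).coeff i j =
        ∑ k : Fin l.length, (R * diag l.length f).coeff i k * S.coeff k j := by
      rw [coeff_mul, finsum_eq_sum_of_support_subset (s := Finset.range l.length),
        Finset.sum_range]
      intro k hk
      simp only [Finset.coe_range, Set.mem_Iio]
      by_contra hcon
      exact hk (by simp [hsupp k (by omega)])
    rw [this, coeff_single]
    simp only [coeff_mul_diag, Fin.is_lt, if_true]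
    by_cases hi : i = 0
    · by_cases hj : j = 0
      · rw [if_pos ⟨hi, hj⟩, ← hl, ← Fin.sum_univ_fun_getElem]
        refine Finset.sum_congr rfl fun k _ => ?_
        simp [R, S, hi, hj, p]
      · simp [S, hj]
    · simp [R, hi]
  have hF : IsSelfAdjoint (diag l.length f) :=
    (isPositiveElement_diag l.length hf).isSelfAdjoint
  have h1 : single (1 : A) = star S * (diag l.length f * star R * star (diag l.length f * star R))
      * star (star S) := by
    have h2 : single (1 : A) = star (single 1) * single 1 := by
      rw [← map_star, ← map_mul, star_one, one_mul]
    rw [h2, ← hRFS]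
    simp only [star_mul, star_star, mul_assoc, hF.star_eq]
  rw [h1]
  refine (CuntzSubequiv.conj _ _).trans ((mul_star_cuntzSubequiv _).trans ?_)
  have h3 : star (diag l.length f * star R) * (diag l.length f * star R) =
      R * diag l.length (f * f) * star R := by
    rw [← diag_mul_diag, star_mul, star_star, hF.star_eq]
    simp only [mul_assoc]
  rw [h3]
  refine (CuntzSubequiv.conj _ _).trans ?_
  have hff : IsPositiveElement (f * f) := ⟨f, by rw [hf.isSelfAdjoint.star_eq]⟩
  have : l.length • scls (f * f) hff ≤ l.length • scls f hf :=
    nsmul_le_nsmul_right (scls_le_scls.2 (CuntzLE.self_mul_self hf)) _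
  rwa [← cls_diag, ← cls_diag, WSemigroup.cls_le_cls] at this

end Algebra

/-! ### Spectral splitting of a self-adjoint element. -/

section Orthogonal

variable {D : Type u} [NonUnitalCStarAlgebra D]

/-- A self-adjoint element is a multiple of a projection, or there are orthogonal elements below
its square. -/
theorem IsSelfAdjoint.exists_orthogonal {h : D} (hh : IsSelfAdjoint h) :
    (∃ c : ℝ, h * h = c • h) ∨ ∃ u v : D, IsPositiveElement u ∧ IsPositiveElement v ∧ u ≠ 0 ∧
      v ≠ 0 ∧ u * v = 0 ∧ CuntzLE (u + v) (h * h) := by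
  by_cases hσ : ∃ c : ℝ, ∀ t ∈ quasispectrum ℝ h, t * t = c * t
  · obtain ⟨c, hc⟩ := hσ
    refine .inl ⟨c, ?_⟩
    have h1 : h * h = cfcₙ (fun t : ℝ => t * t) h := by
      rw [cfcₙ_mul _ _ _, cfcₙ_id' ℝ h]
    have h2 : c • h = cfcₙ (fun t : ℝ => c * t) h := by
      rw [cfcₙ_const_mul _ _ _, cfcₙ_id' ℝ h]
    rw [h1, h2]
    exact cfcₙ_congr hc
  · right
    -- If there were at most one nonzero spectral value c, then t² = c t on the spectrum, which is
    -- the first alternative.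
    obtain ⟨a, ha, ha0, b, hb, hb0, hab⟩ : ∃ a ∈ quasispectrum ℝ h, a ≠ 0 ∧
        ∃ b ∈ quasispectrum ℝ h, b ≠ 0 ∧ a ≠ b := by
      by_contra! hcon
      apply hσ
      by_cases hex : ∃ a ∈ quasispectrum ℝ h, a ≠ 0
      · obtain ⟨a, ha, ha0⟩ := hex
        refine ⟨a, fun t ht => ?_⟩
        by_cases ht0 : t = 0
        · simp [ht0]
        · rw [hcon a ha ha0 t ht ht0]
      · push Not at hex
        exact ⟨0, fun t ht => by simp [hex t ht]⟩
    -- With this r the tents of radius r around a and b have disjoint supports and both vanish at 0.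
    obtain ⟨r, hr, hra, hrb, hrab⟩ : ∃ r : ℝ, 0 < r ∧ 2 * r ≤ |a| ∧ 2 * r ≤ |b| ∧
        2 * r ≤ |a - b| := by
      have h1 := abs_pos.2 ha0
      have h2 := abs_pos.2 hb0
      have h3 := abs_pos.2 (sub_ne_zero.2 hab)
      refine ⟨min |a| (min |b| |a - b|) / 2, by positivity, ?_, ?_, ?_⟩
      · linarith [min_le_left |a| (min |b| |a - b|)]
      · linarith [min_le_right |a| (min |b| |a - b|), min_le_left |b| |a - b|]
      · linarith [min_le_right |a| (min |b| |a - b|), min_le_right |b| |a - b|]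
    let f : ℝ → ℝ → ℝ := fun c t => max (r - |t - c|) 0
    have hf : ∀ c, Continuous (f c) := fun c => by fun_prop
    have hf0 : ∀ c, 2 * r ≤ |c| → f c 0 = 0 := fun c hc => by
      simp only [f, zero_sub, abs_neg]
      exact max_eq_right (by linarith)
    have hfn : ∀ c t, 0 ≤ f c t := fun c t => le_max_right _ _
    have hfr : ∀ c t, f c t ≤ r := fun c t => max_le (by linarith [abs_nonneg (t - c)]) hr.le
    have hne : ∀ c ∈ quasispectrum ℝ h, 2 * r ≤ |c| → cfcₙ (f c) h ≠ 0 := by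
      intro c hc hrc h0
      have := norm_apply_le_norm_cfcₙ (f c) h hc (hf c).continuousOn (hf0 c hrc)
      rw [h0, norm_zero] at this
      simp only [f, sub_self, abs_zero, sub_zero, max_eq_left hr.le, Real.norm_eq_abs,
        abs_of_pos hr] at this
      linarith
    have hfz : ∀ c t, f c t ≠ 0 → |t - c| < r := fun c t ht => by
      by_contra hcon
      exact ht (max_eq_right (by linarith))
    refine ⟨cfcₙ (f a) h, cfcₙ (f b) h, isPositiveElement_cfcₙ _ _ (hfn a),
      isPositiveElement_cfcₙ _ _ (hfn b), hne a ha hra, hne b hb hrb, ?_, ?_⟩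
    · rw [← cfcₙ_mul _ _ _ (hf a).continuousOn (hf0 a hra) (hf b).continuousOn (hf0 b hrb)]
      rw [← cfcₙ_zero ℝ h]
      congr 1
      ext t
      by_contra hcon
      have h1 := hfz a t (left_ne_zero_of_mul hcon)
      have h2 := hfz b t (right_ne_zero_of_mul hcon)
      have h3 : |a - b| ≤ |t - a| + |t - b| := by
        rw [abs_sub_comm t a]
        exact abs_sub_le a t b
      linarith
    · rw [← cfcₙ_add _ _ _ (hf a).continuousOn (hf0 a hra) (hf b).continuousOn (hf0 b hrb)]
      have h1 : h * h = cfcₙ (fun t : ℝ => t * t) h := by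
        rw [cfcₙ_mul _ _ _, cfcₙ_id' ℝ h]
      rw [h1]
      -- On the supports |t| ≥ r, and each tent is at most r, so the sum is at most 2r ≤ (2/r) t².
      -- The square h² appears because h need not be positive.
      refine CuntzLE.cfcₙ_le hh ((hf a).add (hf b)) (by fun_prop) (by simp [hf0 a hra, hf0 b hrb])
        (by simp) (fun t => add_nonneg (hfn a t) (hfn b t)) (fun t => mul_self_nonneg t)
        (C := 2 / r) (by positivity) fun t _ => ?_
      by_cases ht : f a t = 0 ∧ f b t = 0
      · rw [ht.1, ht.2, add_zero]
        have := mul_self_nonneg t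
        positivity
      · have h2 : r ≤ |t| := by
          have h3 : ∀ c, 2 * r ≤ |c| → f c t ≠ 0 → r ≤ |t| := fun c hc h => by
            have h4 := hfz c t h
            have h5 := abs_sub_abs_le_abs_sub c t
            rw [abs_sub_comm] at h5
            linarith
          by_cases h4 : f a t = 0
          · exact h3 b hrb fun h5 => ht ⟨h4, h5⟩
          · exact h3 a hra h4
        have h3 : r * r ≤ t * t := by
          rw [← abs_mul_abs_self t]
          gcongr
        calc f a t + f b t ≤ r + r := add_le_add (hfr a t) (hfr b t)
          _ = 2 / r * (r * r) := by field_simp; ring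
          _ ≤ 2 / r * (t * t) := by gcongr

end Orthogonal

/-! ### Simple algebras not of type I: dividing positive elements. -/

section NotTypeI

variable {A : Type u} [CStarAlgebra A]

theorem IsSimpleCStarAlgebra.exists_not_commute (hs : IsSimpleCStarAlgebra A) (hI : ¬ IsTypeI A)
    {x : A} (hx : IsPositiveElement x) (hx0 : x ≠ 0) :
    ∃ a b : A, (x * a * x) * (x * b * x) ≠ (x * b * x) * (x * a * x) := by
  by_contra! h
  refine hI fun I hcl hI' => ?_
  obtain rfl := (hs.2 I hcl).resolve_right hI'
  refine ⟨x, hx, hx0, fun a b => ?_⟩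
  rw [TwoSidedIdeal.mem_bot, h a b, sub_self]

/-- Otherwise `IsSelfAdjoint.exists_orthogonal` makes every self-adjoint h with h² ≾ y satisfy h² =
c h. Applied to y itself, this makes y a multiple of a projection p. Applied to the compressions
pkp, it forces pAp to be the scalar multiples of p. Then the elements of yAy commute, which is
impossible when A is simple and not of type I. -/
theorem IsSimpleCStarAlgebra.exists_orthogonal (hs : IsSimpleCStarAlgebra A) (hI : ¬ IsTypeI A)
    {y : A} (hy : IsPositiveElement y) (hy0 : y ≠ 0) :
    ∃ u v : A, IsPositiveElement u ∧ IsPositiveElement v ∧ u ≠ 0 ∧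
      v ≠ 0 ∧ u * v = 0 ∧ CuntzLE (u + v) y := by
  by_contra hcon
  have hmul : ∀ h : A, IsSelfAdjoint h → CuntzLE (h * h) y → ∃ c : ℝ, h * h = c • h := by
    intro h hh hle
    refine hh.exists_orthogonal.resolve_right ?_
    rintro ⟨u, v, h1, h2, h3, h4, h5, h6⟩
    exact hcon ⟨u, v, h1, h2, h3, h4, h5, h6.trans hle⟩
  have hys := hy.isSelfAdjoint
  obtain ⟨d, hd⟩ := hmul y hys (CuntzLE.self_mul_self hy)
  have hd0 : d ≠ 0 := by
    rintro rfl
    rw [zero_smul, ← hys.star_eq] at hd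
    nth_rw 2 [hys.star_eq] at hd
    exact hy0 ((CStarRing.star_mul_self_eq_zero_iff y).1 hd)
  let p : A := d⁻¹ • y
  have hyp : y = d • p := by simp [p, smul_smul, hd0]
  have hp0 : p ≠ 0 := fun h => hy0 (by rw [hyp, h, smul_zero])
  have hpp : p * p = p := by
    simp only [p, smul_mul_smul, hd, smul_smul]
    congr 1
    field_simp
  have hps : IsSelfAdjoint p := by
    rw [isSelfAdjoint_iff, star_smul, hys.star_eq, star_trivial]
  have hpk : ∀ k : A, IsSelfAdjoint k → ∃ c : ℝ, (p * k * p) * (p * k * p) = c • (p * k * p) := by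
    intro k hk
    refine hmul _ ?_ ?_
    · rw [isSelfAdjoint_iff]
      simp [hk.star_eq, hps.star_eq, mul_assoc]
    · refine CuntzLE.trans ?_ (CuntzLE.self_mul_self hy)
      have h1 := CuntzLE.conj ((d⁻¹ * d⁻¹) • (y * k)) (y * y)
      convert h1 using 1
      simp only [p, star_smul, star_mul, hk.star_eq, hys.star_eq, star_trivial,
        smul_mul_assoc, mul_smul_comm, smul_smul, mul_assoc]
  clear_value p
  have hscal : ∀ k : A, IsSelfAdjoint k → ∃ c : ℝ, p * k * p = c • p := by
    intro k hk
    set h := p * k * p with hh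
    have hph : p * h = h := by rw [hh, ← mul_assoc, ← mul_assoc, hpp]
    have hhp : h * p = h := by rw [hh, mul_assoc, hpp]
    -- For h = pkp, the elements h, h + p and h + 2p are all proportional to their squares. With
    -- factors a, b, c this gives (a + 2 - b)h = (b - 1)p and (a + 4 - c)h = (2c - 4)p. If both
    -- coefficients of h vanished, then b = 1 and c = 2, so a would be both -1 and -2.
    obtain ⟨a, ha⟩ := hpk k hk
    obtain ⟨b, hb⟩ := hpk (k + 1) (hk.add (.one A))
    obtain ⟨c, hc⟩ := hpk (k + 2) (hk.add (by
      rw [← one_add_one_eq_two]; exact (IsSelfAdjoint.one A).add (.one A)))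
    have e1 : p * (k + 1) * p = h + p := by rw [mul_add, add_mul, mul_one, hpp]
    have e2 : p * (k + 2) * p = h + (2 : ℝ) • p := by
      rw [mul_add, add_mul, ← hh, two_smul, ← one_add_one_eq_two, mul_add, mul_one, add_mul, hpp]
    rw [← hh] at ha
    rw [e1] at hb
    rw [e2] at hc
    simp only [mul_add, add_mul, ha, hhp, hph, hpp, smul_mul_assoc, mul_smul_comm, smul_smul,
      smul_add] at hb hc
    have hb' : (a + 2 - b) • h = (b - 1) • p := by
      rw [← sub_eq_zero] at hb ⊢
      rw [← hb]; module
    have hc' : (a + 4 - c) • h = (2 * c - 4) • p := by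
      rw [← sub_eq_zero] at hc ⊢
      rw [← hc]; module
    by_cases h1 : a + 2 - b = 0
    · rw [h1, zero_smul, eq_comm, smul_eq_zero, or_iff_left hp0] at hb'
      by_cases h2 : a + 4 - c = 0
      · rw [h2, zero_smul, eq_comm, smul_eq_zero, or_iff_left hp0] at hc'
        linarith
      · refine ⟨(a + 4 - c)⁻¹ * (2 * c - 4), ?_⟩
        rw [mul_smul, ← hc', smul_smul, inv_mul_cancel₀ h2, one_smul]
    · refine ⟨(a + 2 - b)⁻¹ * (b - 1), ?_⟩
      rw [mul_smul, ← hb', smul_smul, inv_mul_cancel₀ h1, one_smul]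
  have hscal' : ∀ k : A, ∃ c : ℂ, y * k * y = c • p := by
    intro k
    obtain ⟨a, ha⟩ := hscal (realPart k) (realPart k).2
    obtain ⟨b, hb⟩ := hscal (imaginaryPart k) (imaginaryPart k).2
    refine ⟨(d : ℂ) * (d : ℂ) * ((a : ℂ) + Complex.I * (b : ℂ)), ?_⟩
    have h1 : p * k * p = ((a : ℂ) + Complex.I * (b : ℂ)) • p := by
      conv_lhs => rw [← realPart_add_I_smul_imaginaryPart k]
      rw [mul_add, add_mul, ha, mul_smul_comm, smul_mul_assoc, hb, add_smul, mul_smul,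
        Complex.coe_smul, Complex.coe_smul]
    rw [mul_smul, ← h1, hyp, mul_smul, Complex.coe_smul, Complex.coe_smul]
    simp only [smul_mul_assoc, mul_smul_comm, mul_assoc]
  obtain ⟨a, b, hab⟩ := hs.exists_not_commute hI hy hy0
  obtain ⟨s, hs⟩ := hscal' a
  obtain ⟨t, ht⟩ := hscal' b
  refine hab ?_
  rw [hs, ht, smul_mul_smul, smul_mul_smul, mul_comm]

/-- Repeated halving. Below y there are orthogonal nonzero u and v, and primeness gives s with usv ≠
0. The element (usv)(usv)* is below both u and v, so twice its class is at most ⟨u + v⟩ ≤ ⟨y⟩. Since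
n ≤ 2ⁿ, powers of two suffice, and they suit the induction. -/
theorem IsSimpleCStarAlgebra.exists_nsmul_le (hs : IsSimpleCStarAlgebra A) (hI : ¬ IsTypeI A)
    (n : ℕ) {y : A} (hy : IsPositiveElement y) (hy0 : y ≠ 0) :
    ∃ (x : A) (hx : IsPositiveElement x), x ≠ 0 ∧ n • scls x hx ≤ scls y hy := by
  suffices h : ∃ (x : A) (hx : IsPositiveElement x), x ≠ 0 ∧ 2 ^ n • scls x hx ≤ scls y hy by
    obtain ⟨x, hx, hx0, h⟩ := h
    exact ⟨x, hx, hx0, (nsmul_le_nsmul_left (zero_le_W _) n.lt_two_pow_self.le).trans h⟩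
  induction n generalizing y with
  | zero => exact ⟨y, hy, hy0, by simp⟩
  | succ n ih =>
    obtain ⟨u, v, hu, hv, hu0, hv0, huv, hle⟩ := hs.exists_orthogonal hI hy hy0
    obtain ⟨s, hs0⟩ := hs.exists_mul_mul_ne_zero hu0 hv0
    have hx : IsPositiveElement (u * s * v * star (u * s * v)) := ⟨star (u * s * v), by simp⟩
    obtain ⟨x, hx', hx0, hle'⟩ := ih hx fun h => hs0 ((CStarRing.mul_star_self_eq_zero_iff _).1 h)
    refine ⟨x, hx', hx0, ?_⟩
    have h1 : CuntzLE (u * s * v * star (u * s * v)) v := by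
      refine CuntzLE.trans ?_ (CuntzLE.self_mul_self hv)
      have := CuntzLE.conj (u * s) (v * v)
      convert this using 1
      simp only [star_mul, hv.isSelfAdjoint.star_eq, mul_assoc]
    have h2 : CuntzLE (u * s * v * star (u * s * v)) u := by
      refine (CuntzLE.mul_star_le _).trans ?_
      refine CuntzLE.trans ?_ (CuntzLE.self_mul_self hu)
      have := CuntzLE.conj (star (s * v)) (u * u)
      convert this using 1
      simp only [star_mul, hu.isSelfAdjoint.star_eq, star_star, mul_assoc]
    calc 2 ^ (n + 1) • scls x hx' = 2 ^ n • scls x hx' + 2 ^ n • scls x hx' := by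
          rw [pow_succ, mul_nsmul, two_nsmul]
      _ ≤ scls u hu + scls v hv :=
        add_le_add (hle'.trans (scls_le_scls.2 h2)) (hle'.trans (scls_le_scls.2 h1))
      _ ≤ scls (u + v) (hu.add hv) := le_scls_add hu hv huv
      _ ≤ scls y hy := scls_le_scls.2 hle

end NotTypeI
end

noncomputable section

universe u v

open MInf Stabilization

/-! ### Stable finiteness excludes absorption by projections. -/

section StablyFinite

attribute [local instance] CStarAlgebra.spectralOrder CStarAlgebra.spectralOrderedRing

/-- If every isometry is unitary then a right invertible element has no proper support
projection. -/
theorem eq_one_of_isUnit_mul_star {M : Type u} [CStarAlgebra M]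
    (hM : ∀ v : M, star v * v = 1 → v * star v = 1) {x e : M} (hx : IsUnit (x * star x))
    (hxe : e * star x = star x) : e = 1 := by
  have h0 : 0 ≤ x * star x := mul_star_self_nonneg x
  set s := CFC.sqrt (x * star x) with hs
  have hss : s * s = x * star x := CFC.sqrt_mul_sqrt_self _
  have hsu : IsUnit s := (CFC.isUnit_sqrt_iff _).2 hx
  have hsa : star s = s := (CFC.sqrt_nonneg (x * star x)).isSelfAdjoint
  obtain ⟨w, hw⟩ := hsu
  have hwi : star (↑w⁻¹ : M) = ↑w⁻¹ := by
    have h1 : star w = w := Units.ext (by rw [Units.coe_star, hw, hsa])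
    rw [← Units.coe_star_inv, h1]
  -- The isometry in the polar decomposition of x* is v = x*(xx*)^(-1/2). By hypothesis vv* = 1,
  -- while e fixes the range of x* and hence satisfies e vv* = vv*.
  have hv : star (star x * (↑w⁻¹ : M)) * (star x * ↑w⁻¹) = 1 := by
    rw [star_mul, star_star, hwi, mul_assoc, ← mul_assoc x, ← hss, ← hw]
    simp
  have hv' := hM _ hv
  have : e * ((star x * (↑w⁻¹ : M)) * star (star x * ↑w⁻¹)) =
      (star x * (↑w⁻¹ : M)) * star (star x * ↑w⁻¹) := by
    rw [← mul_assoc, ← mul_assoc, hxe]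
  rwa [hv', mul_one] at this

variable {A : Type u} [CStarAlgebra A]

/-- Such a comparison gives x in M_{n+1}(A) with xx* invertible whose last column vanishes. By
`eq_one_of_isUnit_mul_star` the projection 1ₙ would be the unit of M_{n+1}(A), and comparing the
last diagonal entries gives 0 = 1. -/
theorem IsStablyFiniteCStarAlgebra.not_succ_nsmul_le [Nontrivial A]
    (hA : IsStablyFiniteCStarAlgebra A) (n : ℕ) :
    ¬ (n + 1) • scls (1 : A) isPositiveElement_one ≤ n • scls (1 : A) isPositiveElement_one := by
  intro h
  rw [← cls_diag, ← cls_diag, WSemigroup.cls_le_cls, cuntzSubequiv_iff_cuntzLE] at h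
  obtain ⟨_, ⟨c, rfl⟩, hc⟩ := Metric.mem_closure_iff.1 h 1 one_pos
  rw [dist_eq_norm] at hc
  have hp := isStarProjection_one_diag (A := A) (n + 1)
  have hq := isStarProjection_one_diag (A := A) n
  set p : MInf A := diag (n + 1) 1 with hpdef
  set q : MInf A := diag n 1 with hqdef
  set x : MInf A := p * c * q with hx
  have hxs : Supp (n + 1) x := by
    intro i j hij
    rw [hx, hqdef, hpdef, coeff_mul_diag]
    split_ifs with h
    · rw [coeff_diag_mul, if_neg (by omega), zero_mul]
    · rfl
  have hn : ‖p - x * star x‖ < 1 := by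
    have h1 : p - x * star x = p * (p - c * q * star c) * p := by
      rw [hx, mul_sub, sub_mul, hp.isIdempotentElem.eq, hp.isIdempotentElem.eq]
      simp only [star_mul, hp.isSelfAdjoint.star_eq, hq.isSelfAdjoint.star_eq, mul_assoc]
      rw [← mul_assoc q q, hq.isIdempotentElem.eq]
    rw [h1]
    have hpn : ‖p‖ ≤ 1 := hp.norm_le
    calc ‖p * (p - c * q * star c) * p‖ ≤ ‖p‖ * ‖p - c * q * star c‖ * ‖p‖ :=
          (norm_mul_le _ _).trans (by gcongr; exact norm_mul_le _ _)
      _ ≤ 1 * ‖p - c * q * star c‖ * 1 := by gcongr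
      _ < 1 := by simpa using hc
  have hps : Supp (n + 1) p := supp_diag _ _
  have hqs : Supp (n + 1) q := (supp_diag n _).mono (by omega)
  have hp1 : corner (n + 1) p = 1 := by
    ext i j
    rw [corner_apply, hpdef, coeff_diag, CStarMatrix.one_apply]
    have := i.is_lt
    by_cases hij : i = j
    · rw [if_pos hij, if_pos ⟨by rw [hij], this⟩]
    · rw [if_neg hij, if_neg fun h => hij (Fin.ext h.1)]
  rw [norm_eq (show Supp (n + 1) (p - x * star x) by
    rw [sub_eq_add_neg]; exact hps.add (hxs.mul hxs.star).neg)] at hn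
  have hc1 : corner (n + 1) (p - x * star x) =
      1 - corner (n + 1) x * star (corner (n + 1) x) := by
    rw [sub_eq_add_neg, corner_add, corner_neg, hp1, corner_mul hxs, corner_star, sub_eq_add_neg]
  rw [hc1] at hn
  have hu : IsUnit (corner (n + 1) x * star (corner (n + 1) x)) := by
    have := (Units.oneSub _ hn).isUnit
    rwa [Units.val_oneSub, sub_sub_cancel] at this
  have he := eq_one_of_isUnit_mul_star (e := corner (n + 1) q) (hA (n + 1)) hu (by
    rw [← corner_star, ← corner_mul hqs, hx]
    congr 1
    simp only [star_mul, hp.isSelfAdjoint.star_eq, hq.isSelfAdjoint.star_eq, ← mul_assoc,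
      hq.isIdempotentElem.eq])
  have := congrFun (congrFun he (Fin.last n)) (Fin.last n)
  rw [corner_apply, hqdef, coeff_diag, if_neg (by simp)] at this
  have h2 : (1 : CStarMatrix (Fin (n + 1)) (Fin (n + 1)) A) (Fin.last n) (Fin.last n) = 1 := by
    rw [CStarMatrix.one_apply, if_pos rfl]
  rw [h2] at this
  exact zero_ne_one this

/-- The class of the unit of `A` in `Cu(A)`. -/
def cuOne (A : Type u) [CStarAlgebra A] : CuSemigroup A :=
  WSemigroup.toCu A (scls 1 isPositiveElement_one)

theorem scls_oneDiag (n : ℕ) (h : IsPosElem (oneDiag A n)) :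
    scls (oneDiag A n) h = n • cuOne A := by
  rw [cuOne, ← WSemigroup.toCu_nsmul, ← cls_diag]
  rfl

theorem isPosElem_oneDiag (n : ℕ) : IsPosElem (oneDiag A n) :=
  isPosElem_of (isPositiveElement_diag n isPositiveElement_one)

/-- For e = diag(1_m, …, 1_m) large enough, eqe is within distance 1 of q, so q ≾ eqe = (eq)(eq)* ≾
qeq ≾ e, and the class of e is nm times that of the unit. -/
theorem IsStarProjection.exists_cls_le_nsmul {q : MInf (Stabilization A)} (hq : IsStarProjection q) :
    ∃ n : ℕ, WSemigroup.cls q hq.isPositiveElement ≤ n • cuOne A := by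
  obtain ⟨n, hn⟩ := q.exists_supp
  have hlim : Filter.Tendsto (fun m => diag n (oneDiag A m) * q * diag n (oneDiag A m))
      Filter.atTop (nhds q) := by
    refine tendsto_of_coeff (n := n) (fun m => ((supp_diag _ _).mul hn).mul (supp_diag _ _)) hn
      fun i j => ?_
    simp only [coeff_mul_diag, coeff_diag_mul]
    by_cases hi : i < n
    · by_cases hj : j < n
      · simp only [hi, hj, if_true]
        exact tendsto_oneDiag_conj _
      · simp only [hj, if_false]
        rw [hn i j (by omega)]
        exact tendsto_const_nhds
    · simp only [hi, if_false, zero_mul, ite_self]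
      rw [hn i j (by omega)]
      exact tendsto_const_nhds
  obtain ⟨m, hm⟩ := (Metric.tendsto_nhds.1 hlim 1 one_pos).exists
  rw [dist_comm, dist_eq_norm] at hm
  refine ⟨n * m, ?_⟩
  have hpe := isStarProjection_diag n (isStarProjection_oneDiag (A := A) m)
  have hE : WSemigroup.cls (diag n (oneDiag A m))
      (isPositiveElement_diag n (isPosElem_oneDiag m)) = (n * m) • cuOne A := by
    rw [cls_diag _ _ (isPosElem_oneDiag m), scls_oneDiag, mul_comm, mul_nsmul]
  rw [← hE, WSemigroup.cls_le_cls]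
  set e := diag n (oneDiag A m) with he
  have hes := hpe.isSelfAdjoint.star_eq
  have h1 : e * q * e = (e * q) * star (e * q) := by
    rw [star_mul, hq.isSelfAdjoint.star_eq, hes, mul_assoc, mul_assoc, ← mul_assoc q q,
      hq.isIdempotentElem.eq]
  have h2 : star (e * q) * (e * q) = q * e * star q := by
    rw [star_mul, hq.isSelfAdjoint.star_eq, hes, mul_assoc, ← mul_assoc e e,
      hpe.isIdempotentElem.eq, mul_assoc]
  refine (hq.cuntzSubequiv_of_norm_sub_lt (y := e * q * e) ?_ hm).trans ?_
  · rw [h1]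
    exact ⟨star (e * q), by rw [star_star]⟩
  · rw [h1]
    refine (mul_star_cuntzSubequiv _).trans ?_
    rw [h2]
    exact CuntzSubequiv.conj _ _


/-- If q absorbed f once, it would absorb any number of copies of f. By simplicity finitely many
copies dominate 1, so n + 1 copies of 1 would lie below q. But q lies below n copies of 1 for some
n. -/
theorem not_cls_add_scls_le (hfin : IsStablyFiniteCStarAlgebra A) (hs : IsSimpleCStarAlgebra A)
    {q : MInf (Stabilization A)} (hq : IsStarProjection q) {f : Stabilization A}
    (hf : IsPosElem f) (hf0 : f ≠ 0) :
    ¬ WSemigroup.cls q hq.isPositiveElement + scls f hf ≤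
      WSemigroup.cls q hq.isPositiveElement := by
  intro h
  set x := WSemigroup.cls q hq.isPositiveElement
  have hiter : ∀ n : ℕ, x + n • scls f hf ≤ x := by
    intro n
    induction n with
    | zero => simp
    | succ n ih =>
      rw [succ_nsmul, ← add_assoc]
      exact (add_le_add_left ih _).trans h
  obtain ⟨y, hy, hy0, hyf⟩ := exists_single_le hf hf0
  obtain ⟨m, hm⟩ := hs.exists_one_le_nsmul hy hy0
  have h1 : cuOne A ≤ m • scls f hf := by
    have h2 := WSemigroup.toCu_le_iff.2 hm
    rw [WSemigroup.toCu_nsmul] at h2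
    refine h2.trans (nsmul_le_nsmul_right ?_ m)
    exact (scls_le_scls (ha := isPosElem_of (hy.map single))).2 hyf
  obtain ⟨n, hn⟩ := hq.exists_cls_le_nsmul
  have hnt := hs.1
  refine hfin.not_succ_nsmul_le n ?_
  rw [← WSemigroup.toCu_le_iff, WSemigroup.toCu_nsmul, WSemigroup.toCu_nsmul]
  calc (n + 1) • cuOne A ≤ (n + 1) • (m • scls f hf) := nsmul_le_nsmul_right h1 _
    _ = (m * (n + 1)) • scls f hf := (mul_nsmul _ _ _).symm
    _ ≤ x + (m * (n + 1)) • scls f hf := le_add_of_nonneg_left (zero_le_W x)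
    _ ≤ x := hiter _
    _ ≤ n • cuOne A := hn

end StablyFinite

/-! ### Purely positive elements and their sums. -/

section PurelyPositive

variable {D : Type u} [NonUnitalCStarAlgebra D]

/-- A positive function of `a` that is orthogonal to `(a - d)₊` and that vanishes only if there
is no spectrum between `0` and `d`. -/
def bump (d : ℝ) (a : D) : D := cfcₙ (fun t : ℝ => max (min t (d - t)) 0) a

theorem isPositiveElement_bump (d : ℝ) (a : D) : IsPositiveElement (bump d a) :=
  isPositiveElement_cfcₙ _ a fun _ => le_max_right _ _

/-- The functions (t - d)₊ and max(min(t, d - t), 0) have disjoint supports, and their sum is at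
most t for t ≥ 0. -/
theorem scls_cutDown_add_scls_bump_le {a : D} (ha : IsPositiveElement a) {d : ℝ} (hd : 0 < d) :
    scls (cutDown d a) (isPositiveElement_cutDown d a) +
      scls (bump d a) (isPositiveElement_bump d a) ≤ scls a ha := by
  have e1 : max (0 - d) 0 = 0 := max_eq_right (by linarith)
  have e2 : max (min 0 (d - 0)) 0 = 0 := max_eq_right (min_le_left _ _)
  refine (le_scls_add _ _ ?_).trans (scls_le_scls.2 ?_)
  · rw [cutDown, bump, ← cfcₙ_mul (fun t : ℝ => max (t - d) 0) (fun t : ℝ => max (min t (d - t)) 0) a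
      (by fun_prop) e1 (by fun_prop) e2, ← cfcₙ_zero ℝ a]
    congr 1
    ext t
    rcases le_total t d with h | h
    · rw [max_eq_right (by linarith), zero_mul]
      rfl
    · rw [max_eq_right ((min_le_right _ _).trans (by linarith)), mul_zero]
      rfl
  · rw [cutDown, bump, ← cfcₙ_add (fun t : ℝ => max (t - d) 0) (fun t : ℝ => max (min t (d - t)) 0) a
      (by fun_prop) e1 (by fun_prop) e2]
    conv => arg 2; rw [ha.eq_cfcₙ]
    refine CuntzLE.cfcₙ_le ha.isSelfAdjoint (by fun_prop) (by fun_prop) (by rw [e1, e2, add_zero])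
      (by simp) (fun t => by positivity) (fun t => le_max_right _ _) (C := 1) zero_le_one
      fun t ht => ?_
    have h0 := ha.quasispectrum_nonneg ht
    rw [one_mul, max_eq_left h0]
    rcases le_total t d with h | h
    · rw [max_eq_right (by linarith), zero_add]
      exact max_le (min_le_left _ _) h0
    · rw [max_eq_right ((min_le_right _ _).trans (by linarith) : min t (d - t) ≤ 0),
        max_eq_left (by linarith)]
      linarith

/-- If the bump vanished, the spectrum would miss (0, d), and a would be Cuntz equivalent to its
support projection. -/
theorem IsPurelyPositive.bump_ne_zero {a : D} (ha : IsPurelyPositive a) {d : ℝ} (hd : 0 < d) :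
    bump d a ≠ 0 := by
  intro h0
  have hap := ha.1
  refine ha.2 ?_
  have e2 : max (min 0 (d - 0)) 0 = 0 := max_eq_right (min_le_left _ _)
  have hσ : ∀ t ∈ quasispectrum ℝ a, t = 0 ∨ d ≤ t := by
    intro t ht
    have h1 := norm_apply_le_norm_cfcₙ (fun t : ℝ => max (min t (d - t)) 0) a ht
      (by fun_prop) e2 hap.isSelfAdjoint
    rw [show cfcₙ (fun t : ℝ => max (min t (d - t)) 0) a = 0 from h0, norm_zero,
      Real.norm_eq_abs, abs_of_nonneg (le_max_right _ _)] at h1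
    have h2 : min t (d - t) ≤ 0 := (le_max_left _ _).trans h1
    have h3 := hap.quasispectrum_nonneg ht
    rcases min_le_iff.1 h2 with h | h
    · exact .inl (le_antisymm h h3)
    · exact .inr (by linarith)
  -- A continuous function that takes only the values 0 and 1 on a spectrum with gap (0, d), so χ(a)
  -- is a projection.
  let χ : ℝ → ℝ := fun t => max 0 (min 1 (t / d))
  have hχ : Continuous χ := by fun_prop
  have hχ0 : χ 0 = 0 := by simp [χ]
  have hχn : ∀ t, 0 ≤ χ t := fun t => le_max_left _ _
  have hχ1 : ∀ t, d ≤ t → χ t = 1 := fun t ht => by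
    have : 1 ≤ t / d := by rwa [le_div_iff₀ hd, one_mul]
    simp [χ, min_eq_left this]
  have hp : IsStarProjection (cfcₙ χ a) := by
    refine ⟨?_, cfcₙ_predicate χ a⟩
    rw [IsIdempotentElem, ← cfcₙ_mul _ _ _ hχ.continuousOn hχ0 hχ.continuousOn hχ0]
    refine cfcₙ_congr fun t ht => ?_
    rcases hσ t ht with rfl | h
    · simp [hχ0]
    · simp [hχ1 t h]
  refine ⟨single (cfcₙ χ a), ?_, ?_, ?_⟩
  · exact ⟨by rw [IsIdempotentElem, ← map_mul, hp.isIdempotentElem.eq],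
      by rw [isSelfAdjoint_iff, ← map_star, hp.isSelfAdjoint.star_eq]⟩
  · rw [cuntzSubequiv_single_iff]
    conv => arg 1; rw [hap.eq_cfcₙ]
    refine CuntzLE.cfcₙ_le hap.isSelfAdjoint (by fun_prop) hχ (by simp) hχ0
      (fun t => le_max_right _ _) hχn (norm_nonneg a) fun t ht => ?_
    rcases hσ t ht with rfl | h
    · simp [hχ0]
    · rw [hχ1 t h, mul_one, max_eq_left (hap.quasispectrum_nonneg ht)]
      exact (le_abs_self t).trans (norm_le_of_mem_quasispectrum hap.isSelfAdjoint ht)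
  · rw [cuntzSubequiv_single_iff]
    conv => arg 2; rw [hap.eq_cfcₙ]
    refine CuntzLE.cfcₙ_le hap.isSelfAdjoint hχ (by fun_prop) hχ0 (by simp)
      hχn (fun t => le_max_right _ _) (C := d⁻¹) (by positivity) fun t ht => ?_
    have h3 := hap.quasispectrum_nonneg ht
    rw [max_eq_left h3, inv_mul_eq_div]
    exact max_le (by positivity) (min_le_right _ _)

/-- A projection below a sum is already below the sum of slightly smaller elements. -/
theorem IsStarProjection.exists_cls_le_cutDown {q : MInf D} (hq : IsStarProjection q) {a b : D}
    (ha : IsPositiveElement a) (hb : IsPositiveElement b)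
    (h : WSemigroup.cls q hq.isPositiveElement ≤ scls a ha + scls b hb) :
    ∃ d : ℝ, 0 < d ∧ WSemigroup.cls q hq.isPositiveElement ≤
      scls (cutDown d a) (isPositiveElement_cutDown d a) +
        scls (cutDown d b) (isPositiveElement_cutDown d b) := by
  -- Distance less than 1 from a projection is enough for domination and is an open condition. It
  -- therefore survives replacing a and b by cut-downs with small d.
  obtain ⟨_, ⟨c, rfl⟩, hc⟩ :=
    Metric.mem_closure_iff.1 (cuntzSubequiv_iff_mem_closure.1 (WSemigroup.cls_le_cls.1 h)) 1 one_pos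
  have h1 : Filter.Tendsto (fun d => c * dsum (single (cutDown d a)) (single (cutDown d b)) * star c)
      (nhdsWithin 0 (Set.Ioi (0 : ℝ))) (nhds (c * dsum (single a) (single b) * star c)) := by
    refine (Filter.Tendsto.mul tendsto_const_nhds ?_).mul tendsto_const_nhds
    have := (continuous_dsum.tendsto (single a, single b)).comp
      ((((continuous_single (B := D)).tendsto a).comp (tendsto_cutDown ha)).prodMk_nhds
        (((continuous_single (B := D)).tendsto b).comp (tendsto_cutDown hb)))
    exact this
  have h2 := (tendsto_const_nhds.dist h1).eventually_lt_const hc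
  obtain ⟨d, hd, hd0⟩ := (h2.and self_mem_nhdsWithin).exists
  refine ⟨d, hd0, ?_⟩
  rw [dist_eq_norm] at hd
  rw [scls, scls, WSemigroup.cls_add_cls, WSemigroup.cls_le_cls]
  refine (hq.cuntzSubequiv_of_norm_sub_lt ?_ hd).trans (CuntzSubequiv.conj c _)
  exact (WSemigroup.isPositiveElement_dsum ((isPositiveElement_cutDown d a).map single)
    ((isPositiveElement_cutDown d b).map single)).conj c

end PurelyPositive

variable {A : Type u} [CStarAlgebra A]

/-- If the sum were the class of a projection q, then q would already be below the cut-downs of a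
and b. Adding the bump of a stays below ⟨a⟩ + ⟨b⟩ ≤ ⟨q⟩, so q would absorb a nonzero element. -/
theorem CuPlus.add_mem (hfin : IsStablyFiniteCStarAlgebra A) (hs : IsSimpleCStarAlgebra A)
    {x y : CuSemigroup A} (hx : x ∈ CuPlus A) (hy : y ∈ CuPlus A) : x + y ∈ CuPlus A := by
  obtain ⟨a, ha, rfl⟩ := hx
  obtain ⟨b, hb, rfl⟩ := hy
  change scls a ha.1 + scls b hb.1 ∈ _
  have hab := scls_lift_inl_add_lift_inr ha.1 hb.1
  refine ⟨lift inl a + lift inr b,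
    ⟨(IsPosElem.map (lift inl) ha.1).add (IsPosElem.map (lift inr) hb.1), ?_⟩, hab.symm⟩
  rintro ⟨q, hq, h1, h2⟩
  have hle : scls a ha.1 + scls b hb.1 ≤ WSemigroup.cls q hq.isPositiveElement := by
    rw [← hab]
    exact h1
  have hge : WSemigroup.cls q hq.isPositiveElement ≤ scls a ha.1 + scls b hb.1 := by
    rw [← hab]
    exact h2
  obtain ⟨d, hd, hqd⟩ := hq.exists_cls_le_cutDown ha.1 hb.1 hge
  refine not_cls_add_scls_le hfin hs hq (isPositiveElement_bump d a) (ha.bump_ne_zero hd) ?_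
  have hb1 : scls (cutDown d b) (isPositiveElement_cutDown d b) ≤ scls b hb.1 :=
    le_trans (le_add_of_nonneg_right (zero_le_W _)) (scls_cutDown_add_scls_bump_le hb.1 hd)
  calc _ ≤ scls (cutDown d a) (isPositiveElement_cutDown d a) +
        scls (cutDown d b) (isPositiveElement_cutDown d b) +
          scls (bump d a) (isPositiveElement_bump d a) := add_le_add_left hqd _
    _ = scls (cutDown d a) (isPositiveElement_cutDown d a) +
          scls (bump d a) (isPositiveElement_bump d a) +
            scls (cutDown d b) (isPositiveElement_cutDown d b) := add_right_comm _ _ _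
    _ ≤ scls a ha.1 + scls b hb.1 :=
      add_le_add (scls_cutDown_add_scls_bump_le ha.1 hd) hb1
    _ ≤ _ := hle
end

noncomputable section

universe u v

open MInf Filter Topology

/-! ### Null nets times bounded nets. -/

section Null

variable {J : Type*} {l : Filter J} {R : Type*} [NonUnitalNormedRing R]

theorem tendsto_mul_zero_left {f g : J → R} (hf : Tendsto f l (𝓝 0)) {C : ℝ}
    (hg : ∀ i, ‖g i‖ ≤ C) : Tendsto (fun i => g i * f i) l (𝓝 0) := by
  refine squeeze_zero_norm (fun i => (norm_mul_le _ _).trans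
    (mul_le_mul_of_nonneg_right (hg i) (norm_nonneg _))) ?_
  simpa using hf.norm.const_mul C

theorem tendsto_mul_zero_right {f g : J → R} (hf : Tendsto f l (𝓝 0)) {C : ℝ}
    (hg : ∀ i, ‖g i‖ ≤ C) : Tendsto (fun i => f i * g i) l (𝓝 0) := by
  refine squeeze_zero_norm (fun i => (norm_mul_le _ _).trans
    (mul_le_mul_of_nonneg_left (hg i) (norm_nonneg _))) ?_
  simpa using hf.norm.mul_const C

theorem tendsto_sum_zero {ι : Type*} {s : Finset ι} {f : ι → J → R}
    (hf : ∀ k ∈ s, Tendsto (f k) l (𝓝 0)) : Tendsto (fun i => ∑ k ∈ s, f k i) l (𝓝 0) := by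
  simpa using tendsto_finsetSum s hf

end Null

/-! ### Nets of projections and corner unitaries that asymptotically implement the action. -/

section Approx

variable {A : Type u} [CStarAlgebra A] {G : Type v} [Group G]
  {α : G →* (A ≃⋆ₐ[ℂ] A)}

namespace IsCornerUnitary

theorem left_mul {e z : A} (he : IsStarProjection e) (hz : IsCornerUnitary e z) : e * z = z := by
  conv_rhs => rw [← hz.1]
  conv_lhs => rw [← hz.1]
  rw [← mul_assoc, ← mul_assoc, he.isIdempotentElem.eq]

theorem right_mul {e z : A} (he : IsStarProjection e) (hz : IsCornerUnitary e z) : z * e = z := by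
  conv_rhs => rw [← hz.1]
  conv_lhs => rw [← hz.1]
  rw [mul_assoc, he.isIdempotentElem.eq]

theorem norm_le {e z : A} (he : IsStarProjection e) (hz : IsCornerUnitary e z) : ‖z‖ ≤ 1 := by
  have h1 := CStarRing.norm_star_mul_self (x := z)
  rw [hz.2.1] at h1
  have h2 := he.norm_le
  nlinarith [norm_nonneg z]

end IsCornerUnitary

/-- A net of projections and corner unitaries that asymptotically implements the action. -/
structure AsymptoticallyImplements (α : G →* (A ≃⋆ₐ[ℂ] A)) {J : Type*} (l : Filter J)
    (e : J → A) (z : J → G → A) : Prop where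
  proj : ∀ i, IsStarProjection (e i)
  unit : ∀ i g, IsCornerUnitary (e i) (z i g)
  comm : ∀ a, Tendsto (fun i => e i * a - a * e i) l (𝓝 0)
  conj : ∀ a g, Tendsto (fun i => α g (e i * a * e i) - z i g * (e i * a * e i) * star (z i g))
    l (𝓝 0)
  mul : ∀ g h, Tendsto (fun i => z i g * z i h - z i (g * h)) l (𝓝 0)

namespace AsymptoticallyImplements

variable {J : Type*} {l : Filter J} {e : J → A} {z : J → G → A}
  (H : AsymptoticallyImplements α l e z)
include H

theorem ez (i : J) (g : G) : e i * z i g = z i g := (H.unit i g).left_mul (H.proj i)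
theorem ze (i : J) (g : G) : z i g * e i = z i g := (H.unit i g).right_mul (H.proj i)
theorem ee (i : J) : e i * e i = e i := (H.proj i).isIdempotentElem
theorem es (i : J) : star (e i) = e i := (H.proj i).isSelfAdjoint
theorem norm_e (i : J) : ‖e i‖ ≤ 1 := (H.proj i).norm_le
theorem norm_z (i : J) (g : G) : ‖z i g‖ ≤ 1 := (H.unit i g).norm_le (H.proj i)

/-- z₁² - z₁ tends to 0, and multiplication by z₁* turns this into z₁ - e. -/
theorem tendsto_z_one : Tendsto (fun i => z i 1 - e i) l (𝓝 0) := by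
  have h := tendsto_mul_zero_left (H.mul 1 1) (g := fun i => star (z i 1)) (C := 1)
    fun i => by rw [norm_star]; exact H.norm_z i 1
  refine h.congr fun i => ?_
  rw [mul_sub, ← mul_assoc, mul_one, (H.unit i 1).2.1, H.ez]

/-- The case a = 1 of `conj`, since z_g e z_g* = e. -/
theorem tendsto_apply_e (g : G) : Tendsto (fun i => α g (e i) - e i) l (𝓝 0) := by
  refine (H.conj 1 g).congr fun i => ?_
  rw [mul_one, H.ee, H.ze, (H.unit i g).2.2]

/-- The asymptotic form of u_g y = α_g(y) u_g. Multiply the relation `conj` by z_g on the right and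
replace both factors α_g(e) by e. -/
theorem tendsto_z_mul (y : A) (g : G) :
    Tendsto (fun i => z i g * (e i * y * e i) - e i * α g y * e i * z i g) l (𝓝 0) := by
  have h1 := tendsto_mul_zero_right (H.tendsto_apply_e g)
    (g := fun i => α g y * α g (e i) * z i g) (C := ‖y‖ * 1 * 1) fun i => by
      refine (norm_mul_le _ _).trans (mul_le_mul ((norm_mul_le _ _).trans ?_) (H.norm_z i g)
        (norm_nonneg _) (by positivity))
      rw [StarAlgEquiv.norm_map, StarAlgEquiv.norm_map]
      exact mul_le_mul_of_nonneg_left (H.norm_e i) (norm_nonneg _)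
  have h2 := tendsto_mul_zero_right (tendsto_mul_zero_left (H.tendsto_apply_e g)
    (g := fun i => e i * α g y) (C := 1 * ‖y‖) fun i => by
      refine (norm_mul_le _ _).trans ?_
      rw [StarAlgEquiv.norm_map]
      exact mul_le_mul_of_nonneg_right (H.norm_e i) (norm_nonneg _))
    (g := fun i => z i g) (C := 1) fun i => H.norm_z i g
  have h3 := tendsto_mul_zero_right (H.conj y g) (g := fun i => z i g) (C := 1)
    fun i => H.norm_z i g
  have h := (h1.add h2).sub h3
  simp only [add_zero, sub_zero] at h
  refine h.congr fun i => ?_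
  have h4 : z i g * (e i * y * e i) * star (z i g) * z i g = z i g * (e i * y * e i) := by
    rw [mul_assoc, (H.unit i g).2.1, mul_assoc (z i g), mul_assoc (e i * y), H.ee]
  simp only [sub_mul, mul_sub, h4, map_mul]
  noncomm_ring

/-- The asymptotic form of (x u_g)(y u_h) = x α_g(y) u_{gh}. Three errors occur: moving z_g past y,
replacing z_g z_h by z_{gh}, and removing the e between x and α_g(y). -/
theorem tendsto_term_mul (x y : A) (g h : G) :
    Tendsto (fun i => (e i * x * e i * z i g) * (e i * y * e i * z i h) -
      e i * (x * α g y) * e i * z i (g * h)) l (𝓝 0) := by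
  have hb1 : ∀ i, ‖e i * x * e i‖ ≤ 1 * ‖x‖ * 1 := fun i =>
    (norm_mul_le _ _).trans (mul_le_mul ((norm_mul_le _ _).trans
      (mul_le_mul_of_nonneg_right (H.norm_e i) (norm_nonneg _))) (H.norm_e i)
      (norm_nonneg _) (by positivity))
  have hb2 : ∀ i, ‖e i * x * e i * (α g y * e i)‖ ≤ 1 * ‖x‖ * 1 * (‖y‖ * 1) := fun i => by
    refine (norm_mul_le _ _).trans (mul_le_mul (hb1 i) ((norm_mul_le _ _).trans ?_)
      (norm_nonneg _) (by positivity))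
    rw [StarAlgEquiv.norm_map]
    exact mul_le_mul_of_nonneg_left (H.norm_e i) (norm_nonneg _)
  have hb3 : ∀ i, ‖e i * x‖ ≤ 1 * ‖x‖ := fun i => (norm_mul_le _ _).trans
      (mul_le_mul_of_nonneg_right (H.norm_e i) (norm_nonneg _))
  have h1 := tendsto_mul_zero_right (tendsto_mul_zero_left (H.tendsto_z_mul y g) hb1)
    (g := fun i => z i h) (C := 1) fun i => H.norm_z i h
  have h2 := tendsto_mul_zero_left (H.mul g h) hb2
  have h3 := tendsto_mul_zero_right (tendsto_mul_zero_left (H.comm (α g y)) hb3)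
    (g := fun i => e i * z i (g * h)) (C := 1) fun i => by rw [H.ez]; exact H.norm_z i _
  have hh := (h1.add h2).add h3
  simp only [add_zero] at hh
  refine hh.congr fun i => ?_
  have e1 : ∀ w, e i * (e i * w) = e i * w := fun w => by rw [← mul_assoc, H.ee]
  have e2 : ∀ k w, e i * (z i k * w) = z i k * w := fun k w => by rw [← mul_assoc, H.ez]
  simp only [sub_mul, mul_sub, mul_assoc, e1, e2, H.ez]
  abel

/-- Since z_g z_{g⁻¹} is close to z₁ and so to e, multiplying by the adjoint of z_{g⁻¹} shows that
z_g is close to that adjoint. -/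
theorem tendsto_star_z (g : G) : Tendsto (fun i => z i g - star (z i g⁻¹)) l (𝓝 0) := by
  have h1 := (H.mul g g⁻¹).add H.tendsto_z_one
  rw [add_zero] at h1
  have h := tendsto_mul_zero_right h1 (g := fun i => star (z i g⁻¹)) (C := 1)
    fun i => by rw [norm_star]; exact H.norm_z i _
  refine h.congr fun i => ?_
  have h2 : e i * star (z i g⁻¹) = star (z i g⁻¹) := by
    rw [← H.es i, ← star_mul, H.ze]
  rw [mul_inv_cancel, sub_add_sub_cancel, sub_mul, h2, mul_assoc, (H.unit i g⁻¹).2.2, H.ze]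

theorem tendsto_term_star (w : A) (g : G) :
    Tendsto (fun i => e i * α g w * e i * z i g - star (z i g⁻¹) * (e i * w * e i)) l (𝓝 0) := by
  have hb1 : ∀ i, ‖e i * w * e i‖ ≤ 1 * ‖w‖ * 1 := fun i =>
    (norm_mul_le _ _).trans (mul_le_mul ((norm_mul_le _ _).trans
      (mul_le_mul_of_nonneg_right (H.norm_e i) (norm_nonneg _))) (H.norm_e i)
      (norm_nonneg _) (by positivity))
  have h := (tendsto_mul_zero_right (H.tendsto_star_z g) hb1).sub (H.tendsto_z_mul w g)
  simp only [sub_zero] at h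
  refine h.congr fun i => ?_
  rw [sub_mul]
  abel

/-- The difference is the off-diagonal part ea(1 - e) + (1 - e)ae, which is e[e, a] - [e, a]e. -/
theorem tendsto_sub_conj (a : A) :
    Tendsto (fun i => a - e i * a * e i - (1 - e i) * a * (1 - e i)) l (𝓝 0) := by
  have h1 := (tendsto_mul_zero_left (H.comm a) H.norm_e).sub
    (tendsto_mul_zero_right (H.comm a) H.norm_e)
  simp only [sub_zero] at h1
  refine h1.congr fun i => ?_
  have e1 : ∀ w, e i * (e i * w) = e i * w := fun w => by rw [← mul_assoc, H.ee]
  simp only [sub_mul, mul_sub, mul_assoc, e1, H.ee, one_mul, mul_one]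
  abel

end AsymptoticallyImplements

/-- The net is indexed by finite subsets F of A and tolerances 1/(n + 1), with x fixed. The element
x bounds 1 - e because 1 - e is equivalent to a projection q in the closure of xAx. -/
theorem IsTraciallyStrictlyApproximatelyInner.exists_asymptoticallyImplements
    (hα : IsTraciallyStrictlyApproximatelyInner α) {x : A} (hx : IsPositiveElement x)
    (hx1 : ‖x‖ = 1) :
    ∃ (e : Finset A × ℕ → A) (z : Finset A × ℕ → G → A),
      AsymptoticallyImplements α atTop e z ∧ ∀ i, CuntzLE (1 - e i) x := by
  have h := fun i : Finset A × ℕ => hα i.1 (1 / ((i.2 : ℝ) + 1)) (by positivity) x hx hx1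
  choose e z he hz hcomm hconj hmul hq _ using h
  have hlim : Tendsto (fun i : Finset A × ℕ => 1 / ((i.2 : ℝ) + 1)) atTop (𝓝 0) := by
    rw [← prod_atTop_atTop_eq]
    exact tendsto_one_div_add_atTop_nhds_zero_nat.comp tendsto_snd
  have hmem : ∀ a : A, ∀ᶠ i : Finset A × ℕ in atTop, a ∈ i.1 := fun a => by
    filter_upwards [eventually_ge_atTop (({a} : Finset A), 0)] with i hi
    exact hi.1 (Finset.mem_singleton_self a)
  refine ⟨e, z, ⟨he, hz, fun a => ?_, fun a g => ?_, fun g h => ?_⟩, fun i => ?_⟩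
  · refine squeeze_zero_norm' ?_ hlim
    filter_upwards [hmem a] with i hi
    exact (hcomm i a hi).le
  · refine squeeze_zero_norm' ?_ hlim
    filter_upwards [hmem a] with i hi
    exact (hconj i a hi g).le
  · exact squeeze_zero_norm (fun i => (hmul i g h).le) hlim
  · obtain ⟨q, hqp, hqx, v, hv1, hv2⟩ := hq i
    rw [← hv1]
    refine CuntzLE.trans (b := v * star v) ?_ ?_
    · have := CuntzLE.mul_star_le (star v)
      rwa [star_star] at this
    · rw [hv2]
      refine CuntzLE.trans ?_ (CuntzLE.self_mul_self hx)
      have h1 : q = q * star q := by rw [hqp.isSelfAdjoint.star_eq, hqp.isIdempotentElem.eq]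
      rw [h1]
      -- For y = xax one has yy* = (xa)x²(xa)*, so q = qq* is a limit of conjugates of x².
      refine map_mem_closure (f := fun y : A => y * star y) (by fun_prop) hqx ?_
      rintro _ ⟨a, rfl⟩
      refine ⟨x * a, ?_⟩
      simp only [star_mul, hx.isSelfAdjoint.star_eq, mul_assoc]

open CrossedProduct

variable [Fintype G]

/-- The linear map `∑ a_g u_g ↦ ∑ e a_g e z_g` from the crossed product to `A`. -/
def approxHom (α : G →* (A ≃⋆ₐ[ℂ] A)) (e : A) (z : G → A) : CrossedProduct α →+ A where
  toFun x := ∑ g, e * x.coeff g * e * z g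
  map_zero' := by simp
  map_add' x y := by simp [mul_add, add_mul, Finset.sum_add_distrib]

theorem approxHom_apply (e : A) (z : G → A) (x : CrossedProduct α) :
    approxHom α e z x = ∑ g, e * x.coeff g * e * z g := rfl

theorem CrossedProduct.norm_coeff_le (x : CrossedProduct α) (g : G) : ‖x.coeff g‖ ≤ ‖x‖ := by
  let _ := CStarAlgebra.spectralOrder A
  let _ := CStarAlgebra.spectralOrderedRing A
  have h := CStarMatrix.norm_entry_le_norm (M := toMatrix x) (i := g) (j := 1)
  rw [toMatrix_apply, StarAlgEquiv.norm_map] at h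
  simpa [norm_def] using h

namespace AsymptoticallyImplements

variable {J : Type*} {l : Filter J} {e : J → A} {z : J → G → A}
  (H : AsymptoticallyImplements α l e z)
include H

/-- The maps are not homomorphisms and contractivity is not automatic. This bound, uniform in i,
controls the image of the error of a comparison in the crossed product. -/
theorem norm_approxHom_le (i : J) (x : CrossedProduct α) :
    ‖approxHom α (e i) (z i) x‖ ≤ Fintype.card G * ‖x‖ := by
  rw [approxHom_apply]
  refine (norm_sum_le _ _).trans ?_
  rw [← nsmul_eq_mul]
  refine Finset.sum_le_card_nsmul _ _ _ fun g _ => ?_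
  rw [mul_assoc, H.ez]
  calc ‖e i * x.coeff g * z i g‖ ≤ ‖e i‖ * ‖x.coeff g‖ * ‖z i g‖ :=
        (norm_mul_le _ _).trans (by gcongr; exact norm_mul_le _ _)
    _ ≤ 1 * ‖x‖ * 1 := by
        gcongr
        · exact H.norm_e i
        · exact CrossedProduct.norm_coeff_le x g
        · exact H.norm_z i g
    _ = ‖x‖ := by ring

theorem approxHom_mul_e (i : J) (x : CrossedProduct α) :
    approxHom α (e i) (z i) x * e i = approxHom α (e i) (z i) x := by
  rw [approxHom_apply, Finset.sum_mul]
  refine Finset.sum_congr rfl fun g _ => ?_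
  rw [mul_assoc _ (z i g), H.ze]

theorem tendsto_approxHom_mul (x y : CrossedProduct α) :
    Tendsto (fun i => approxHom α (e i) (z i) (x * y) -
      approxHom α (e i) (z i) x * approxHom α (e i) (z i) y) l (𝓝 0) := by
  have h : Tendsto (fun i => -∑ g, ∑ h, ((e i * x.coeff g * e i * z i g) *
      (e i * y.coeff h * e i * z i h) - e i * (x.coeff g * α g (y.coeff h)) * e i * z i (g * h)))
      l (𝓝 0) := by
    rw [← neg_zero]
    exact (tendsto_sum_zero fun g _ => tendsto_sum_zero fun h _ =>
      H.tendsto_term_mul (x.coeff g) (y.coeff h) g h).neg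
  refine h.congr fun i => ?_
  have h2 : approxHom α (e i) (z i) (x * y) =
      ∑ g, ∑ h, e i * (x.coeff g * α g (y.coeff h)) * e i * z i (g * h) := by
    rw [approxHom_apply]
    simp only [CrossedProduct.coeff_mul, Finset.mul_sum, Finset.sum_mul]
    rw [Finset.sum_comm]
    refine Finset.sum_congr rfl fun g _ => ?_
    -- For fixed g, the summand of total degree k in the product becomes the one with h = g⁻¹k.
    refine Fintype.sum_equiv (Equiv.mulLeft g⁻¹) _ _ fun k => ?_
    simp
  rw [h2, approxHom_apply, approxHom_apply, Finset.sum_mul_sum]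
  simp only [Finset.sum_sub_distrib]
  abel

theorem tendsto_approxHom_star (x : CrossedProduct α) :
    Tendsto (fun i => approxHom α (e i) (z i) (star x) - star (approxHom α (e i) (z i) x))
      l (𝓝 0) := by
  have h : Tendsto (fun i => ∑ g, (e i * α g (star (x.coeff g⁻¹)) * e i * z i g -
      star (z i g⁻¹) * (e i * star (x.coeff g⁻¹) * e i))) l (𝓝 0) :=
    tendsto_sum_zero fun g _ => H.tendsto_term_star (star (x.coeff g⁻¹)) g
  refine h.congr fun i => ?_
  rw [approxHom_apply, approxHom_apply, Finset.sum_sub_distrib, star_sum]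
  congr 1
  refine Fintype.sum_equiv (Equiv.inv G) _ _ fun g => ?_
  simp [H.es, mul_assoc]

theorem tendsto_approxHom_incl (b : A) :
    Tendsto (fun i => approxHom α (e i) (z i) (incl α b) - e i * b * e i) l (𝓝 0) := by
  have hb1 : ∀ i, ‖e i * b * e i‖ ≤ 1 * ‖b‖ * 1 := fun i =>
    (norm_mul_le _ _).trans (mul_le_mul ((norm_mul_le _ _).trans
      (mul_le_mul_of_nonneg_right (H.norm_e i) (norm_nonneg _))) (H.norm_e i)
      (norm_nonneg _) (by positivity))
  refine (tendsto_mul_zero_left H.tendsto_z_one hb1).congr fun i => ?_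
  rw [approxHom_apply, Finset.sum_eq_single 1]
  · rw [mul_sub, mul_assoc _ (e i) (e i), H.ee]
    simp [incl]
  · intro g _ hg
    simp [incl, hg]
  · simp

end AsymptoticallyImplements

end Approx
end

noncomputable section

universe u v

open MInf Stabilization CrossedProduct Filter Topology

/-! ### Norm bounds for finite matrices. -/

section Bound

variable {A : Type u} [CStarAlgebra A]

theorem MInf.rowUnit_mul_mul_star_rowUnit (i j : ℕ) (x : MInf A) :
    rowUnit A i * x * star (rowUnit A j) = single (x.coeff i j) := by
  refine MInf.ext fun k l => ?_
  rw [mul_star_rowUnit, rowUnit_mul, coeff_single]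
  split_ifs <;> first | rfl | omega

theorem norm_single_le (a : A) : ‖single a‖ ≤ ‖a‖ := by
  rw [← norm_of]
  exact NonUnitalStarAlgHom.norm_apply_le ((ofHom (B := A)).comp single) a

theorem MInf.norm_rowUnit_mul_star_le (i : ℕ) : ‖rowUnit A i * star (rowUnit A i)‖ ≤ 1 := by
  have h : rowUnit A i * star (rowUnit A i) = diag 1 1 := by
    refine MInf.ext fun k l => ?_
    rw [mul_star_rowUnit, coeff_rowUnit, coeff_diag]
    split_ifs <;> first | rfl | omega
  rw [h]
  exact (isStarProjection_one_diag 1).norm_le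

theorem MInf.norm_rowUnit_le (i : ℕ) : ‖rowUnit A i‖ ≤ 1 := by
  have h := norm_rowUnit_mul_star_le (A := A) i
  rw [CStarRing.norm_self_mul_star] at h
  nlinarith [norm_nonneg (rowUnit A i)]

/-- Expand a into its n² entries by matrix units. The crude constant n² is harmless because n is
fixed before the tolerances are chosen. -/
theorem MInf.norm_le_of_coeff_le {n : ℕ} {a : MInf A} (ha : Supp n a) {r : ℝ}
    (hr : ∀ i j, ‖a.coeff i j‖ ≤ r) : ‖a‖ ≤ n * (n * r) := by
  have h1 : a = diag n 1 * a * diag n 1 := by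
    rw [diag_one_mul fun i j h => ha i j (.inl h), mul_diag_one fun i j h => ha i j (.inr h)]
  have h2 : a = ∑ i ∈ Finset.range n, ∑ j ∈ Finset.range n,
      star (rowUnit A i) * single (a.coeff i j) * rowUnit A j := by
    conv_lhs => rw [h1, diag_one_eq_sum, Finset.sum_mul, Finset.sum_mul_sum]
    refine Finset.sum_congr rfl fun i _ => Finset.sum_congr rfl fun j _ => ?_
    rw [← rowUnit_mul_mul_star_rowUnit]
    simp only [mul_assoc]
  have h3 : ∀ i j, ‖star (rowUnit A i) * single (a.coeff i j) * rowUnit A j‖ ≤ r := by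
    intro i j
    calc _ ≤ ‖star (rowUnit A i)‖ * ‖single (a.coeff i j)‖ * ‖rowUnit A j‖ :=
          (norm_mul_le _ _).trans (by gcongr; exact norm_mul_le _ _)
      _ ≤ 1 * r * 1 := by
        gcongr
        · exact mul_nonneg zero_le_one ((norm_nonneg _).trans (hr i j))
        · rw [norm_star]
          exact norm_rowUnit_le i
        · exact (norm_single_le _).trans (hr i j)
        · exact norm_rowUnit_le j
      _ = r := by ring
  rw [h2]
  refine (norm_sum_le_of_le _ fun i _ => norm_sum_le_of_le _ fun j _ => h3 i j).trans ?_
  simp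

end Bound

/-! ### Entrywise application of additive maps. -/

section Entrywise

variable {B : Type u} [NonUnitalCStarAlgebra B] {C : Type v} [NonUnitalCStarAlgebra C]

/-- The entrywise application of an additive map to a finite matrix. -/
def MInf.mapAdd (f : B →+ C) : MInf B →+ MInf C where
  toFun a := mk (fun i j => f (a.coeff i j)) <| by
    obtain ⟨n, hn⟩ := a.exists_supp
    exact ⟨n, fun i j h => by rw [hn i j h, map_zero]⟩
  map_zero' := MInf.ext fun i j => by simp
  map_add' a b := MInf.ext fun i j => by simp

theorem MInf.coeff_mapAdd (f : B →+ C) (a : MInf B) (i j : ℕ) :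
    (mapAdd f a).coeff i j = f (a.coeff i j) := rfl

theorem MInf.Supp.mapAdd (f : B →+ C) {a : MInf B} {n : ℕ} (ha : Supp n a) :
    Supp n (mapAdd f a) := fun i j h => by rw [coeff_mapAdd, ha i j h, map_zero]

end Entrywise

/-! ### Reflection of the Cuntz order by the inclusion into the crossed product. -/

section Approx

variable {A : Type u} [CStarAlgebra A] {G : Type v} [Group G]
  {α : G →* (A ≃⋆ₐ[ℂ] A)}

namespace AsymptoticallyImplements

variable {J : Type*} {l : Filter J} {e : J → A} {z : J → G → A}
  (H : AsymptoticallyImplements α l e z)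
include H

theorem tendsto_sub_diag_conj (n : ℕ) {a : MInf A} (ha : Supp n a) :
    Tendsto (fun i => a - diag n (e i) * a * diag n (e i) -
      diag n (1 - e i) * a * diag n (1 - e i)) l (𝓝 0) := by
  refine tendsto_of_coeff (n := n) (fun i => ?_) (supp_zero n) fun j k => ?_
  · rw [sub_eq_add_neg, sub_eq_add_neg]
    exact (ha.add (((supp_diag _ _).mul ha).mul (supp_diag _ _)).neg).add
      (((supp_diag _ _).mul ha).mul (supp_diag _ _)).neg
  · refine (H.tendsto_sub_conj (a.coeff j k)).congr fun i => ?_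
    simp only [coeff_sub, coeff_mul_diag, coeff_diag_mul]
    by_cases h : n ≤ j ∨ n ≤ k
    · rw [ha j k h]
      simp
    · push Not at h
      simp only [if_pos h.1, if_pos h.2]

variable [Fintype G]

theorem norm_mapAdd_le (i : J) {n : ℕ} {a : MInf (CrossedProduct α)} (ha : Supp n a) :
    ‖mapAdd (approxHom α (e i) (z i)) a‖ ≤ n * (n * (Fintype.card G * ‖a‖)) := by
  refine norm_le_of_coeff_le (ha.mapAdd _) fun j k => ?_
  rw [coeff_mapAdd]
  refine (H.norm_approxHom_le i _).trans ?_
  gcongr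
  exact MInf.norm_coeff_le a j k

theorem tendsto_mapAdd_mul (a b : MInf (CrossedProduct α)) :
    Tendsto (fun i => mapAdd (approxHom α (e i) (z i)) (a * b) -
      mapAdd (approxHom α (e i) (z i)) a * mapAdd (approxHom α (e i) (z i)) b) l (𝓝 0) := by
  obtain ⟨n, ha, hb⟩ := exists_supp₂ a b
  refine tendsto_of_coeff (n := n) (fun i => ?_) (supp_zero n) fun j k => ?_
  · rw [sub_eq_add_neg]
    exact ((ha.mul hb).mapAdd _).add ((ha.mapAdd _).mul (hb.mapAdd _)).neg
  · refine (tendsto_sum_zero (s := Finset.univ) fun (m : Fin n) _ =>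
      H.tendsto_approxHom_mul (a.coeff j m) (b.coeff m k)).congr fun i => ?_
    rw [coeff_sub, coeff_mapAdd, coeff_mul_of_supp ha, coeff_mul_of_supp (ha.mapAdd _), map_sum,
      Finset.sum_sub_distrib]
    rfl

theorem tendsto_mapAdd_star (a : MInf (CrossedProduct α)) :
    Tendsto (fun i => mapAdd (approxHom α (e i) (z i)) (star a) -
      star (mapAdd (approxHom α (e i) (z i)) a)) l (𝓝 0) := by
  obtain ⟨n, ha⟩ := a.exists_supp
  refine tendsto_of_coeff (n := n) (fun i => ?_) (supp_zero n) fun j k => ?_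
  · rw [sub_eq_add_neg]
    exact (ha.star.mapAdd _).add (ha.mapAdd _).star.neg
  · exact H.tendsto_approxHom_star (a.coeff k j)

theorem tendsto_mapAdd_incl (n : ℕ) {b : MInf A} (hb : Supp n b) :
    Tendsto (fun i => mapAdd (approxHom α (e i) (z i)) (MInf.map (incl α) b) -
      diag n (e i) * b * diag n (e i)) l (𝓝 0) := by
  have hb' : Supp n (MInf.map (incl α) b) := fun i j h => by rw [coeff_map, hb i j h, map_zero]
  refine tendsto_of_coeff (n := n) (fun i => ?_) (supp_zero n) fun j k => ?_
  · rw [sub_eq_add_neg]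
    exact (hb'.mapAdd _).add (((supp_diag _ _).mul hb).mul (supp_diag _ _)).neg
  · refine (H.tendsto_approxHom_incl (b.coeff j k)).congr fun i => ?_
    rw [coeff_sub, coeff_mapAdd, coeff_map, coeff_mul_diag, coeff_diag_mul]
    by_cases h : n ≤ j ∨ n ≤ k
    · rw [hb j k h]
      simp
    · push Not at h
      rw [if_pos h.1, if_pos h.2]

theorem mapAdd_mul_diag (i : J) {n : ℕ} {a : MInf (CrossedProduct α)} (ha : Supp n a) :
    mapAdd (approxHom α (e i) (z i)) a * diag n (e i) = mapAdd (approxHom α (e i) (z i)) a := by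
  refine MInf.ext fun j k => ?_
  rw [coeff_mul_diag, coeff_mapAdd]
  split_ifs with h
  · exact H.approxHom_mul_e i _
  · rw [ha j k (by omega), map_zero]

/-- Compressing a comparison in the crossed product. -/
theorem tendsto_compress {n m : ℕ} {a b : MInf A} {c : MInf (CrossedProduct α)} (ha : Supp n a)
    (hb : Supp m b) (hc : Supp m c) :
    Tendsto (fun i => a - mapAdd (approxHom α (e i) (z i)) c * b *
        star (mapAdd (approxHom α (e i) (z i)) c) - diag n (1 - e i) * a * diag n (1 - e i) -
      mapAdd (approxHom α (e i) (z i))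
        (MInf.map (incl α) a - c * MInf.map (incl α) b * star c)) l (𝓝 0) := by
  set S : J → MInf (CrossedProduct α) →+ MInf A := fun i => mapAdd (approxHom α (e i) (z i))
  set ιb := MInf.map (incl α) b
  have hιb : Supp m ιb := fun i j h => by
    change (MInf.map (incl α) b).coeff i j = 0
    rw [coeff_map, hb i j h, map_zero]
  have hSc : ∀ i, ‖S i c‖ ≤ m * (m * (Fintype.card G * ‖c‖)) := fun i => H.norm_mapAdd_le i hc
  have hSc' : ∀ i, ‖star (S i c)‖ ≤ m * (m * (Fintype.card G * ‖c‖)) := fun i => by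
    rw [norm_star]; exact hSc i
  have hScs : ∀ i, ‖S i (star c)‖ ≤ m * (m * (Fintype.card G * ‖star c‖)) :=
    fun i => H.norm_mapAdd_le i hc.star
  have hSb : ∀ i, ‖S i ιb‖ ≤ m * (m * (Fintype.card G * ‖ιb‖)) :=
    fun i => H.norm_mapAdd_le i hιb
  -- The chain of replacements: S(c ιb c*) by S(c ιb)S(c*), by S(c)S(ιb)S(c*), by S(c)S(ιb)S(c)*, by
  -- S(c) ebe S(c)*. The last e's disappear because S(c)e = S(c). Likewise a is replaced by eae + (1
  -- - e)a(1 - e), and S(ιa) by eae.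
  have h1 := H.tendsto_sub_diag_conj n ha
  have h2 := H.tendsto_mapAdd_incl n ha
  have h3 := H.tendsto_mapAdd_mul (c * ιb) (star c)
  have h4 := tendsto_mul_zero_right (H.tendsto_mapAdd_mul c ιb) hScs
  have h5 := tendsto_mul_zero_left (tendsto_mul_zero_left (H.tendsto_mapAdd_star c) hSb) hSc
  have h6 := tendsto_mul_zero_right (tendsto_mul_zero_left (H.tendsto_mapAdd_incl m hb) hSc) hSc'
  have h := ((((h1.sub h2).add h3).add h4).add h5).add h6
  simp only [add_zero, sub_zero] at h
  refine h.congr fun i => ?_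
  have e1 : S i c * (diag m (e i) * b * diag m (e i)) * star (S i c) =
      S i c * b * star (S i c) := by
    have e2 : S i c * diag m (e i) = S i c := H.mapAdd_mul_diag i hc
    have e3 : diag m (e i) * star (S i c) = star (S i c) := by
      have := congrArg star e2
      rwa [star_mul, star_diag, H.es] at this
    rw [← mul_assoc, ← mul_assoc, e2, mul_assoc _ (diag m (e i)), e3]
  change a - diag n (e i) * a * diag n (e i) - diag n (1 - e i) * a * diag n (1 - e i) -
    (S i (MInf.map (incl α) a) - diag n (e i) * a * diag n (e i)) +
    (S i (c * ιb * star c) - S i (c * ιb) * S i (star c)) +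
    (S i (c * ιb) - S i c * S i ιb) * S i (star c) +
    S i c * (S i ιb * (S i (star c) - star (S i c))) +
    S i c * (S i ιb - diag m (e i) * b * diag m (e i)) * star (S i c) =
    a - S i c * b * star (S i c) - diag n (1 - e i) * a * diag n (1 - e i) -
    S i (MInf.map (incl α) a - c * ιb * star c)
  rw [map_sub, mul_sub (S i c), sub_mul _ _ (star (S i c)), e1]
  noncomm_ring

end AsymptoticallyImplements

theorem exists_norm_eq_one_le {x : A} (hx : IsPositiveElement x) (hx0 : x ≠ 0) :
    ∃ y : A, IsPositiveElement y ∧ ‖y‖ = 1 ∧ CuntzLE y x := by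
  have hn : 0 < ‖x‖ := norm_pos_iff.2 hx0
  have h : ((Real.sqrt ‖x‖⁻¹) • (1 : A)) * x * star ((Real.sqrt ‖x‖⁻¹) • (1 : A)) =
      ‖x‖⁻¹ • x := by
    rw [star_smul, star_one, star_trivial, smul_mul_assoc, one_mul, smul_mul_smul, mul_one,
      Real.mul_self_sqrt (by positivity)]
  refine ⟨‖x‖⁻¹ • x, ?_, ?_, ?_⟩
  · rw [← h]
    exact hx.conj _
  · rw [norm_smul, norm_inv, norm_norm, inv_mul_cancel₀ hn.ne']
  · rw [← h]
    exact CuntzLE.conj _ _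

/-- Comparison of `a` with an element `w` that is cut down by a small projection. -/
theorem le_of_compress {n : ℕ} {a : Stabilization A} (ha : IsPosElem a)
    {b : Stabilization A} (hb : IsPosElem b) {d : ℝ} (hd : 0 < d) {p x y : A}
    (hp : IsStarProjection p) (hx : IsPositiveElement x) (hy : IsPositiveElement y)
    (hpx : CuntzLE p x) (hxy : n • scls x hx ≤ scls y hy)
    (hyb : CuntzLE (of (single y)) (bump d b)) (c : Stabilization A) :
    CuntzLE (c * cutDown d b * star c + of (diag n p) * a * of (diag n p)) b := by
  have hcut : IsPosElem (cutDown d b) := isPositiveElement_cutDown d b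
  have hpp : IsStarProjection (diag n p) := isStarProjection_diag n hp
  have h1 : star (of (diag n p)) = of (diag n p) := by rw [← of_star, hpp.isSelfAdjoint.star_eq]
  have h1' : of (diag n p) * of (diag n p) = of (diag n p) := by
    rw [← of_mul, hpp.isIdempotentElem.eq]
  have hpos1 : IsPosElem (c * cutDown d b * star c) := IsPositiveElement.conj hcut c
  have hpos2 : IsPosElem (of (diag n p) * a * of (diag n p)) := by
    have := IsPositiveElement.conj ha (of (diag n p))
    rwa [h1] at this
  -- Writing a = t*t and flipping turns the compression of a by diag(p, …, p) into a conjugate of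
  -- diag(p, …, p).
  have h2 : CuntzLE (of (diag n p) * a * of (diag n p)) (of (diag n p)) := by
    obtain ⟨t, rfl⟩ := ha
    have e1 : of (diag n p) * (star t * t) * of (diag n p) =
        (of (diag n p) * star t) * star (of (diag n p) * star t) := by
      rw [star_mul, star_star, h1]
      simp only [mul_assoc]
    have e2 : star (of (diag n p) * star t) * (of (diag n p) * star t) =
        t * of (diag n p) * star t := by
      rw [star_mul, star_star, h1, mul_assoc, ← mul_assoc (of (diag n p)), h1', mul_assoc]
    rw [e1]
    refine (CuntzLE.mul_star_le _).trans ?_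
    rw [e2]
    exact CuntzLE.conj _ _
  have hppos : IsPosElem (of (diag n p)) :=
    isPosElem_of (isPositiveElement_diag n hp.isPositiveElement)
  -- The class of diag(p, …, p) is n⟨p⟩ ≤ n⟨x⟩ ≤ ⟨y⟩, so the n copies of p fit below the bump of b.
  have h3 : scls (of (diag n p)) hppos ≤ scls (bump d b) (isPositiveElement_bump d b) := by
    have e1 : scls (of (diag n p)) hppos =
        WSemigroup.toCu A (n • scls p hp.isPositiveElement) := by
      rw [← cls_diag]
      rfl
    rw [e1]
    refine le_trans (WSemigroup.toCu_le_iff.2 ((nsmul_le_nsmul_right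
      (scls_le_scls.2 hpx) n).trans hxy)) ?_
    exact (scls_le_scls (ha := isPosElem_of (hy.map single))).2 hyb
  have h4 : scls _ (IsPositiveElement.add hpos1 hpos2) ≤ scls b hb :=
    calc _ ≤ scls _ hpos1 + scls _ hpos2 := scls_add_le hpos1 hpos2
      _ ≤ scls _ hcut + scls (bump d b) (isPositiveElement_bump d b) :=
        add_le_add (scls_le_scls.2 (CuntzLE.conj _ _)) ((scls_le_scls.2 h2).trans h3)
      _ ≤ scls b hb := scls_cutDown_add_scls_bump_le hb hd
  exact scls_le_scls.1 h4

variable [Fintype G]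

theorem incl_injective : Function.Injective (incl α) := fun a b h => by
  have := congrArg (fun x => x.coeff 1) h
  simpa [incl] using this

/-- The inclusion into the crossed product reflects the comparison with elements `b` that have
spectrum arbitrarily close to zero. -/
theorem IsTraciallyStrictlyApproximatelyInner.cuntzLE_of_map
    (hα : IsTraciallyStrictlyApproximatelyInner α) (hs : IsSimpleCStarAlgebra A)
    (hI : ¬ IsTypeI A) {a b : Stabilization A} (ha : IsPosElem a) (hb : IsPosElem b)
    (hbump : ∀ d : ℝ, 0 < d → bump d b ≠ 0)
    (h : CuntzLE (Stabilization.map (incl α) a) (Stabilization.map (incl α) b)) :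
    CuntzLE a b := by
  have hstar := Stabilization.continuous_star' (B := CrossedProduct α)
  have hmapc := Stabilization.continuous_map (incl α)
  -- It suffices to treat the compressions 1ₙ a 1ₙ, which are finite matrices.
  refine CuntzLE.of_tendsto (tendsto_oneDiag_conj a) fun n => ?_
  have hP := isStarProjection_oneDiag (A := A) n
  have hpos : IsPosElem (oneDiag A n * a * oneDiag A n) := by
    have := IsPositiveElement.conj ha (oneDiag A n)
    rwa [hP.isSelfAdjoint.star_eq] at this
  have h' := (CuntzLE.map (Stabilization.map (incl α)) (oneDiag_conj_le n a)).trans h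
  obtain ⟨a', ha's, ha'⟩ := exists_oneDiag_conj_eq n a
  rw [ha'] at hpos h' ⊢
  rw [map_of] at h'
  set ι := MInf.map (incl α) with hι
  have hιa : Supp n (ι a') := fun i j h => by rw [hι, coeff_map, ha's i j h, map_zero]
  suffices hsuff : of a' ∈ closure {y : Stabilization A | CuntzLE y b} by
    have : IsClosed {y : Stabilization A | CuntzLE y b} := isClosed_closure
    rwa [this.closure_eq] at hsuff
  rw [Metric.mem_closure_iff]
  intro ε hε
  -- On n × n matrices the approximating maps are bounded by n²|G|, so an error below η in the
  -- crossed product contributes at most ε/2 in A. The summand 1 keeps the denominator positive.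
  set η : ℝ := ε / (2 * (n * (n * Fintype.card G) + 1)) with hη
  have hη0 : 0 < η := by positivity
  obtain ⟨_, ⟨c, rfl⟩, hc⟩ := Metric.mem_closure_iff.1 h' η hη0
  obtain ⟨c₁, hc₁⟩ : ∃ c₁ : MInf (CrossedProduct α),
      dist (of (ι a')) (of c₁ * Stabilization.map (incl α) b * star (of c₁)) < η := by
    have ho : IsOpen {c | dist (of (ι a')) (c * Stabilization.map (incl α) b * star c) < η} :=
      isOpen_lt (by fun_prop) continuous_const
    obtain ⟨_, hx, c₁, rfl⟩ := denseRange_of.inter_open_nonempty _ ho ⟨c, hc⟩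
    exact ⟨c₁, hx⟩
  -- Passing from b to (b - d)₊ frees the part of b below d, where the remainder will be placed.
  obtain ⟨d, hd, hcd⟩ : ∃ d : ℝ, 0 < d ∧ dist (of (ι a'))
      (of c₁ * Stabilization.map (incl α) (cutDown d b) * star (of c₁)) < η := by
    have hl : Tendsto (fun d => dist (of (ι a'))
        (of c₁ * Stabilization.map (incl α) (cutDown d b) * star (of c₁)))
        (𝓝[>] (0 : ℝ)) (𝓝 (dist (of (ι a'))
          (of c₁ * Stabilization.map (incl α) b * star (of c₁)))) :=
      tendsto_const_nhds.dist ((tendsto_const_nhds.mul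
        ((hmapc.tendsto b).comp (tendsto_cutDown hb))).mul tendsto_const_nhds)
    obtain ⟨d, hd, hd0⟩ := ((hl.eventually_lt_const hc₁).and self_mem_nhdsWithin).exists
    exact ⟨d, hd0, hd⟩
  -- Multiplying by 1ₙ puts the error in the n × n corner. Its bound then involves n, and not the
  -- size m of c₂, which is only found after η.
  set c₂ : MInf (CrossedProduct α) := diag n 1 * c₁ with hc₂
  obtain ⟨m, hc₂s⟩ := c₂.exists_supp
  obtain ⟨b', hb's, hb'⟩ := exists_oneDiag_conj_eq m (cutDown d b)
  have hmapdiag : ∀ k, ι (diag k 1) = diag k 1 := fun k => by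
    refine MInf.ext fun i j => ?_
    rw [hι, coeff_map, coeff_diag, coeff_diag]
    split_ifs
    · exact CrossedProduct.ext fun g => by simp [incl, coeff_one]
    · simp
  have hE := isStarProjection_one_diag (A := CrossedProduct α) n
  have hEm := isStarProjection_one_diag (A := CrossedProduct α) m
  have hy : ‖ι a' - c₂ * ι b' * star c₂‖ < η := by
    have hnE : ‖of (diag n (1 : CrossedProduct α))‖ ≤ 1 := by
      rw [norm_of]; exact hE.norm_le
    have e1 : of (ι b') = of (diag m 1) * Stabilization.map (incl α) (cutDown d b) *
        of (diag m 1) := by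
      rw [hι, ← map_of, ← hb', map_mul, map_mul, oneDiag, map_of, ← hι, hmapdiag]
    have e2 : c₂ * diag m 1 = c₂ := mul_diag_one fun i j h => hc₂s i j (.inr h)
    have e3 : diag m 1 * star c₂ = star c₂ := diag_one_mul fun i j h => hc₂s.star i j (.inl h)
    have e4 : of (ι a' - c₂ * ι b' * star c₂) = of (diag n 1) * (of (ι a') -
        of c₁ * Stabilization.map (incl α) (cutDown d b) * star (of c₁)) * of (diag n 1) := by
      have e5 : of (ι a') = of (diag n 1) * of (ι a') * of (diag n 1) := by
        rw [← of_mul, ← of_mul, diag_one_mul fun i j h => hιa i j (.inl h),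
          mul_diag_one fun i j h => hιa i j (.inr h)]
      have e6 : of (c₂ * ι b' * star c₂) = of (diag n 1) * (of c₁ *
          Stabilization.map (incl α) (cutDown d b) * star (of c₁)) * of (diag n 1) := by
        rw [of_mul, of_mul, e1, mul_assoc, mul_assoc, ← of_mul, e3, ← mul_assoc, ← mul_assoc,
          ← of_mul, e2, hc₂, star_mul, hE.isSelfAdjoint.star_eq, of_mul, of_mul, of_star]
        simp only [mul_assoc]
      have e7 : of (ι a' - c₂ * ι b' * star c₂) = of (ι a') - of (c₂ * ι b' * star c₂) :=
        map_sub ofAddHom _ _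
      rw [e7, e6, mul_sub, sub_mul, ← e5]
    rw [← norm_of, e4]
    rw [dist_eq_norm] at hcd
    calc _ ≤ ‖of (diag n (1 : CrossedProduct α))‖ * ‖of (ι a') -
          of c₁ * Stabilization.map (incl α) (cutDown d b) * star (of c₁)‖ *
          ‖of (diag n (1 : CrossedProduct α))‖ :=
          (norm_mul_le _ _).trans (by gcongr; exact norm_mul_le _ _)
      _ ≤ 1 * ‖of (ι a') -
          of c₁ * Stabilization.map (incl α) (cutDown d b) * star (of c₁)‖ * 1 := by gcongr
      _ < η := by rwa [one_mul, mul_one]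
  have hysupp : Supp n (ι a' - c₂ * ι b' * star c₂) := by
    intro i j hij
    have h1 : ∀ w : MInf (CrossedProduct α), n ≤ i ∨ n ≤ j →
        (c₂ * w * star c₂).coeff i j = 0 := by
      intro w hij
      have : c₂ * w * star c₂ = diag n 1 * (c₁ * w * star c₁) * diag n 1 := by
        rw [hc₂, star_mul, hE.isSelfAdjoint.star_eq]
        simp only [mul_assoc]
      rw [this, coeff_mul_diag, coeff_diag_mul]
      split_ifs <;> first | omega | simp
    rw [coeff_sub, hιa i j hij, h1 _ hij, sub_zero]
  -- The projections come last: d fixes the bump, the bump gives y, then x with n copies of x below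
  -- y, and finally the net with 1 - e ≾ x.
  obtain ⟨y, hypos, hy0, hyb⟩ := exists_single_le (isPositiveElement_bump d b) (hbump d hd)
  obtain ⟨x, hxpos, hx0, hxy⟩ := hs.exists_nsmul_le hI n hypos hy0
  obtain ⟨x₁, hx₁, hx₁n, hx₁x⟩ := exists_norm_eq_one_le hxpos hx0
  obtain ⟨e, z, H, hle⟩ := hα.exists_asymptoticallyImplements hx₁ hx₁n
  classical
  have hlim := H.tendsto_compress ha's hb's hc₂s
  have hev := hlim.norm.eventually_lt_const (u := ε / 2) (by rw [norm_zero]; positivity)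
  obtain ⟨i, hi⟩ := hev.exists
  set S := mapAdd (approxHom α (e i) (z i)) with hS
  -- The first summand is a conjugate of (b - d)₊, since b' is a compression of it, and the second
  -- fits below the bump. So the sum is ≾ b.
  refine ⟨of (S c₂ * b' * star (S c₂) + diag n (1 - e i) * a' * diag n (1 - e i)), ?_, ?_⟩
  · have e1 : of (S c₂ * b' * star (S c₂) + diag n (1 - e i) * a' * diag n (1 - e i)) =
        (of (S c₂) * oneDiag A m) * cutDown d b * star (of (S c₂) * oneDiag A m) +
        of (diag n (1 - e i)) * of a' * of (diag n (1 - e i)) := by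
      rw [of_add, of_mul, of_mul, of_mul, of_mul, ← hb', star_mul,
        (isStarProjection_oneDiag m).isSelfAdjoint.star_eq, of_star]
      simp only [mul_assoc]
    rw [Set.mem_ofPred_eq, e1]
    exact le_of_compress hpos hb hd (H.proj i).one_sub hxpos hypos ((hle i).trans hx₁x) hxy hyb _
  · have hsub : ∀ v w : MInf A, of v - of w = of (v - w) :=
      fun v w => (map_sub ofAddHom v w).symm
    rw [dist_eq_norm, hsub, norm_of]
    have hSy := H.norm_mapAdd_le i hysupp
    have : a' - (S c₂ * b' * star (S c₂) + diag n (1 - e i) * a' * diag n (1 - e i)) =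
        (a' - S c₂ * b' * star (S c₂) - diag n (1 - e i) * a' * diag n (1 - e i) -
          S (ι a' - c₂ * ι b' * star c₂)) + S (ι a' - c₂ * ι b' * star c₂) := by abel
    rw [this]
    calc _ ≤ ‖a' - S c₂ * b' * star (S c₂) - diag n (1 - e i) * a' * diag n (1 - e i) -
          S (ι a' - c₂ * ι b' * star c₂)‖ + ‖S (ι a' - c₂ * ι b' * star c₂)‖ := norm_add_le _ _
      _ < ε / 2 + ε / 2 := by
        refine add_lt_add_of_lt_of_le hi (hSy.trans ?_)
        calc _ ≤ (n : ℝ) * (n * (Fintype.card G * η)) := by gcongr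
          _ ≤ ε / 2 := by
            have : (n : ℝ) * (n * (Fintype.card G * η)) =
              (n * (n * Fintype.card G)) * η := by ring
            rw [this]
            have h3 : ε / 2 = (n * (n * Fintype.card G) + 1) * η := by
              rw [hη]; field_simp
            rw [h3]
            gcongr
            linarith
      _ = ε := by ring

end Approx
end

noncomputable section

universe u v

/-! ### From order reflection to the isomorphism theorem. -/

open MInf Stabilization CrossedProduct

/-- Reflecting the order implies injectivity on S, by antisymmetry, so no separate injectivity
argument is needed. -/
theorem restrictsToOrderedSemigroupIso_of_reflects {M : Type u} {N : Type v} [AddCommMonoid M]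
    [PartialOrder M] [AddCommMonoid N] [PartialOrder N] (f : M →+ N) (hf : Monotone f)
    {S : Set M} (h0 : 0 ∈ S) (hadd : ∀ x ∈ S, ∀ y ∈ S, x + y ∈ S)
    (hr : ∀ x ∈ S, ∀ y ∈ S, f x ≤ f y → x ≤ y) : RestrictsToOrderedSemigroupIso f S := by
  let T : AddSubmonoid M :=
    { carrier := S, zero_mem' := h0, add_mem' := fun {x y} hx hy => hadd x hx y hy }
  let g : T → T.map f := fun x => ⟨f x, AddSubmonoid.mem_map_of_mem f x.2⟩
  have hg : Function.Bijective g := by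
    refine ⟨fun x y h => ?_, ?_⟩
    · have h' : f x = f y := congrArg Subtype.val h
      exact Subtype.ext (le_antisymm (hr _ x.2 _ y.2 h'.le) (hr _ y.2 _ x.2 h'.ge))
    · rintro ⟨_, x, hx, rfl⟩
      exact ⟨⟨x, hx⟩, rfl⟩
  exact ⟨T, rfl,
    { Equiv.ofBijective g hg with
      map_add' := fun x y => Subtype.ext (map_add f _ _)
      map_le_map_iff' := fun {x y} => ⟨fun h => hr _ x.2 _ y.2 h, fun h => hf h⟩ },
    fun x => rfl⟩

theorem WSemigroup.monotone_map {B : Type u} [NonUnitalCStarAlgebra B] {C : Type v}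
    [NonUnitalCStarAlgebra C] (φ : B →⋆ₙₐ[ℂ] C) : Monotone (WSemigroup.map φ) := by
  intro x y
  refine WSemigroup.ind (fun a ha => ?_) x
  refine WSemigroup.ind (fun b hb => ?_) y
  intro h
  exact CuntzSubequiv.map (MInf.map φ) h

theorem eq_zero_of_scls_le_zero {D : Type u} [NonUnitalCStarAlgebra D] {a : D}
    {ha : IsPositiveElement a} (h : scls a ha ≤ 0) : a = 0 := by
  rw [WSemigroup.zero_def, scls, WSemigroup.cls_le_cls, cuntzSubequiv_iff_cuntzLE] at h
  exact single_injective (h.eq_zero.trans (map_zero single).symm)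

section Main

variable {A : Type u} [CStarAlgebra A] {G : Type v} [Group G] [Fintype G]
  {α : G →* (A ≃⋆ₐ[ℂ] A)}

theorem CuPlus.add_mem_union (hfin : IsStablyFiniteCStarAlgebra A) (hs : IsSimpleCStarAlgebra A)
    {x y : CuSemigroup A} (hx : x ∈ CuPlus A ∪ {0}) (hy : y ∈ CuPlus A ∪ {0}) :
    x + y ∈ CuPlus A ∪ {0} := by
  rcases hx with hx | rfl
  · rcases hy with hy | rfl
    · exact .inl (CuPlus.add_mem hfin hs hx hy)
    · rw [add_zero]
      exact .inl hx
  · rwa [zero_add]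

theorem IsTraciallyStrictlyApproximatelyInner.le_of_map_le
    (hα : IsTraciallyStrictlyApproximatelyInner α) (hs : IsSimpleCStarAlgebra A)
    (hI : ¬ IsTypeI A) {x y : CuSemigroup A} (hx : x ∈ CuPlus A ∪ {0})
    (hy : y ∈ CuPlus A ∪ {0})
    (h : CuSemigroup.map (incl α) x ≤ CuSemigroup.map (incl α) y) : x ≤ y := by
  rcases hx with ⟨a, ha, rfl⟩ | rfl
  · change CuSemigroup.map (incl α) (scls a ha.1) ≤ _ at h
    change scls a ha.1 ≤ y
    rcases hy with ⟨b, hb, rfl⟩ | rfl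
    · change _ ≤ CuSemigroup.map (incl α) (scls b hb.1) at h
      rw [CuSemigroup.map, WSemigroup.map_scls, WSemigroup.map_scls, scls_le_scls] at h
      exact (scls_le_scls (ha := ha.1) (hb := hb.1)).2
        (hα.cuntzLE_of_map hs hI ha.1 hb.1 (fun d hd => hb.bump_ne_zero hd) h)
    -- The class 0 has no spectral room, but here a vanishes because the induced map of
    -- stabilizations is isometric.
    · rw [map_zero, CuSemigroup.map, WSemigroup.map_scls] at h
      have h0 := eq_zero_of_scls_le_zero h
      have ha0 : a = 0 := by
        rw [← norm_eq_zero, ← Stabilization.norm_map (incl_injective (α := α)), h0, norm_zero]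
      rw [WSemigroup.zero_def, scls, WSemigroup.cls_le_cls, ha0, map_zero]
      exact CuntzSubequiv.refl 0
  · exact zero_le_W y

theorem WSemigroup.toCu_mem_union {x : WSemigroup A} (hx : x ∈ WPlus A ∪ {0}) :
    toCu A x ∈ CuPlus A ∪ {0} := by
  rcases hx with hx | rfl
  · exact .inl hx
  · exact .inr toCu_zero

end Main

end

theorem mainTheorem3 {A : Type*} [CStarAlgebra A] {G : Type*} [Group G] [Fintype G]
    (α : G →* (A ≃⋆ₐ[ℂ] A))
    (hfin : IsStablyFiniteCStarAlgebra A) (hsimple : IsSimpleCStarAlgebra A)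
    (hI : ¬ IsTypeI A) (hα : IsTraciallyStrictlyApproximatelyInner α) :
    RestrictsToOrderedSemigroupIso (WSemigroup.map (CrossedProduct.incl α)) (WPlus A ∪ {0}) ∧
      RestrictsToOrderedSemigroupIso (CuSemigroup.map (CrossedProduct.incl α))
        (CuPlus A ∪ {0}) := by
  refine ⟨restrictsToOrderedSemigroupIso_of_reflects _ (WSemigroup.monotone_map _) (.inr rfl)
      (fun x hx y hy => ?_) fun x hx y hy h => ?_,
    restrictsToOrderedSemigroupIso_of_reflects _ (WSemigroup.monotone_map _) (.inr rfl)
      (fun x hx y hy => CuPlus.add_mem_union hfin hsimple hx hy)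
      fun x hx y hy h => hα.le_of_map_le hsimple hI hx hy h⟩
  -- Closure under addition in W is read off in Cu. If the sum vanishes there, it vanishes in W, as
  -- W → Cu reflects the order.
  · have hmem := CuPlus.add_mem_union hfin hsimple (WSemigroup.toCu_mem_union hx)
      (WSemigroup.toCu_mem_union hy)
    rw [← WSemigroup.toCu_add] at hmem
    rcases hmem with hmem | hmem
    · exact .inl hmem
    · refine .inr (le_antisymm (WSemigroup.toCu_le_iff.1 ?_) (zero_le_W _))
      rw [WSemigroup.toCu_zero]
      exact le_of_eq hmem
  · rw [← WSemigroup.toCu_le_iff]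
    refine hα.le_of_map_le hsimple hI (WSemigroup.toCu_mem_union hx)
      (WSemigroup.toCu_mem_union hy) ?_
    rw [WSemigroup.map_toCu, WSemigroup.map_toCu]
    exact WSemigroup.toCu_le_iff.2 h
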